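/- **Theorem 3.1 (Discrete inf-sup condition).** Let $\Omega\subset\mathbb R^3$ be a bounded connected open set with connected boundary $\Gamma$ and with $\Omega=\operatorname{int}(\overline\Omega)$; for instance, a bounded Lipschitz polyhedron with connected boundary. Let $k\ge 1$ be an integer and $\kappa>0$. There is a constant $C>0$, depending only on $\Omega$, $k$ and $\kappa$, such that the following holds for every conforming partition $\mathcal T_h$ of $\overline\Omega$ into finitely many tetrahedra that is shape regular with constant $\kappa$ (each $T$ contains a ball of radius $h_T/\kappa$), whatever its mesh size $h=\max_T h_T$. *Notation.* $h_T$ is the diameter of the smallest ball containing $T\in\mathcal T_h$ and $h_F$ that of the smallest circle containing the face $F\in\mathcal F_h$; $\boldsymbol n$ is the unit outward normal on $\partial T$; a face is a boundary face if it lies in $\Gamma$ and belongs to the set $\mathcal F_h^o$ of interior faces otherwise; $[\![\boldsymbol n\cdot\boldsymbol v]\!]$ on $F\in\mathcal F_h^o$ is the sum of $\boldsymbol n\cdot\boldsymbol v$ from the two sides. All differential operators act elementwise, $(\cdot,\cdot)_{\mathcal T_h}=\sum_T(\cdot,\cdot)_{L^2(T)}$, $\langle\cdot,\cdot\rangle_{\partial\mathcal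 T_h}=\sum_T\langle\cdot,\cdot\rangle_{L^2(\partial T)}$, with norms $\|\cdot\|_{\mathcal T_h}$ and $\|\cdot\|_{\partial\mathcal T_h}$, and $\|w\|^2_{\mathcal F_h^o}=\sum_{F\in\mathcal F_h^o}\|w\|^2_{L^2(F)}$. $\mathcal P_j(\mathcal T_h)$ and $\mathcal P_j(\mathcal F_h)$ are the piecewise polynomials of degree at most $j$ on the tetrahedra and on the faces. *Spaces.* $\boldsymbol\Sigma_h^{\boldsymbol 0}$ is the space of all tuples $(\boldsymbol r,\boldsymbol u,\widehat{\boldsymbol u},\widehat{\boldsymbol c},p,\widehat p)$ with $\boldsymbol r\in[\mathcal P_{k-1}(\mathcal T_h)]^3$, $\boldsymbol u\in[\mathcal P_k(\mathcal T_h)]^3$, $\widehat{\boldsymbol u}\in[\mathcal P_k(\mathcal F_h)]^3$, $\widehat{\boldsymbol c}\in[\mathcal P_{k-1}(\mathcal F_h)]^3$, $p\in\mathcal P_k(\mathcal T_h)$, $\widehat p\in\mathcal P_k(\mathcal F_h)$, such that $\boldsymbol n\cdot\widehat{\boldsymbol u}=\boldsymbol n\cdot\widehat{\boldsymbol c}=0$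 on every face and $\boldsymbol n\times\widehat{\boldsymbol u}=\boldsymbol n\times\widehat{\boldsymbol c}=\boldsymbol 0$, $\widehat p=0$ on $\Gamma$. *Bilinear form.* For $\boldsymbol\sigma=(\boldsymbol r,\boldsymbol u,\widehat{\boldsymbol u},\widehat{\boldsymbol c},p,\widehat p)$ and $\boldsymbol\tau=(\boldsymbol s,\boldsymbol v,\widehat{\boldsymbol v},\widehat{\boldsymbol d},q,\widehat q)$ let $$\begin{aligned}B_h(\boldsymbol\sigma,\boldsymbol\tau)={}&(\boldsymbol r,\boldsymbol s)_{\mathcal T_h}+b_h(\boldsymbol u,\widehat{\boldsymbol u},\widehat{\boldsymbol c};\boldsymbol s)+b_h(\boldsymbol v,\widehat{\boldsymbol v},\widehat{\boldsymbol d};\boldsymbol r)+c_h(p,\widehat p;\boldsymbol v)+c_h(q,\widehat q;\boldsymbol u)\\&-\langle h_F^{-3}\boldsymbol n\times(\boldsymbol u-\widehat{\boldsymbol u}),\boldsymbol n\times(\boldsymbol v-\widehat{\boldsymbol v})\rangle_{\partial\mathcal T_h}\\&-\langle h_F^{-1}\boldsymbol n\times(\nabla\times\boldsymbol u-\widehat{\boldsymbol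 c}),\boldsymbol n\times(\nabla\times\boldsymbol v-\widehat{\boldsymbol d})\rangle_{\partial\mathcal T_h}+\langle h_F^{-1}(p-\widehat p),q-\widehat q\rangle_{\partial\mathcal T_h},\end{aligned}$$ where $$b_h(\boldsymbol u,\widehat{\boldsymbol u},\widehat{\boldsymbol c};\boldsymbol s)=-(\boldsymbol u,\nabla\times\nabla\times\boldsymbol s)_{\mathcal T_h}-\langle\boldsymbol n\times\widehat{\boldsymbol u},\nabla\times\boldsymbol s\rangle_{\partial\mathcal T_h}-\langle\boldsymbol n\times\widehat{\boldsymbol c},\boldsymbol s\rangle_{\partial\mathcal T_h},$$ $$c_h(q,\widehat q;\boldsymbol u)=(\nabla\cdot\boldsymbol u,q)_{\mathcal T_h}-\langle\boldsymbol n\cdot\boldsymbol u,\widehat q\rangle_{\partial\mathcal T_h}.$$ *Norm.* For $\alpha,\beta\in\{0,1\}$ let $$\begin{aligned}\|\boldsymbol\sigma\|^2_{\boldsymbol\Sigma_h}={}&\|\boldsymbol r\|^2_{\mathcal T_h}+\|\nabla\times\nabla\times\boldsymbol u\|^2_{\mathcal T_h}+\|h_F^{-3/2}\boldsymbol n\times(\boldsymbol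 u-\widehat{\boldsymbol u})\|^2_{\partial\mathcal T_h}+\|h_F^{-1/2}\boldsymbol n\times(\nabla\times\boldsymbol u-\widehat{\boldsymbol c})\|^2_{\partial\mathcal T_h}\\&+\|h_T\nabla\cdot\boldsymbol u\|^2_{\mathcal T_h}+\|h_F^{1/2}[\![\boldsymbol n\cdot\boldsymbol u]\!]\|^2_{\mathcal F_h^o}+\|h_T^{\alpha}\nabla p\|^2_{\mathcal T_h}+\|h_F^{\beta-1/2}(p-\widehat p)\|^2_{\partial\mathcal T_h}.\end{aligned}$$ *Claim.* For every choice of $\alpha,\beta\in\{0,1\}$, $$\sup_{\boldsymbol 0\ne\boldsymbol\tau\in\boldsymbol\Sigma_h^{\boldsymbol 0}}\frac{B_h(\boldsymbol\sigma,\boldsymbol\tau)}{\|\boldsymbol\tau\|_{\boldsymbol\Sigma_h}}\ge C\,\|\boldsymbol\sigma\|_{\boldsymbol\Sigma_h}\quad\text{for all }\boldsymbol\sigma\in\boldsymbol\Sigma_h^{\boldsymbol 0},\qquad \sup_{\boldsymbol 0\ne\boldsymbol\sigma\in\boldsymbol\Sigma_h^{\boldsymbol 0}}\frac{B_h(\boldsymbol\sigma,\boldsymbol\tau)}{\|\boldsymbol\sigma\|_{\boldsymbol\Sigma_h}}\ge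 C\,\|\boldsymbol\tau\|_{\boldsymbol\Sigma_h}\quad\text{for all }\boldsymbol\tau\in\boldsymbol\Sigma_h^{\boldsymbol 0}.$$ -/

import Mathlib

open MeasureTheory
open scoped Matrix

noncomputable section

namespace QuadCurlHDG

/-- Points of three-dimensional Euclidean space. -/
abbrev E3 := EuclideanSpace ℝ (Fin 3)

/-- Values of vector fields. -/
abbrev Vec := Fin 3 → ℝ

/-- Real polynomials in three variables. -/
abbrev Poly := MvPolynomial (Fin 3) ℝ

/-- Vector fields with polynomial components. -/
abbrev VPoly := Fin 3 → Poly

/-! ### Polynomial fields -/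

/-- Polynomials of total degree at most `j`. -/
abbrev polyDeg (j : ℕ) : Submodule ℝ Poly := MvPolynomial.restrictTotalDegree (Fin 3) ℝ j

/-- Value of a polynomial at a point. -/
def ev (p : Poly) (x : E3) : ℝ := MvPolynomial.eval (fun i => x i) p

/-- Value of a polynomial vector field at a point. -/
def evV (v : VPoly) (x : E3) : Vec := fun i => ev (v i) x

/-- The gradient. -/
def grad (p : Poly) : VPoly := fun i => MvPolynomial.pderiv i p

/-- The divergence. -/
def divg (v : VPoly) : Poly := ∑ i, MvPolynomial.pderiv i (v i)

/-- The curl. -/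
def curl (v : VPoly) : VPoly :=
  ![MvPolynomial.pderiv 1 (v 2) - MvPolynomial.pderiv 2 (v 1),
    MvPolynomial.pderiv 2 (v 0) - MvPolynomial.pderiv 0 (v 2),
    MvPolynomial.pderiv 0 (v 1) - MvPolynomial.pderiv 1 (v 0)]

/-- The squared Euclidean length of a vector. -/
def sqLen (w : Vec) : ℝ := w ⬝ᵥ w

/-! ### Simplices -/

/-- The closed simplex (tetrahedron or triangle) with the given vertices. -/
def hull (s : Finset E3) : Set E3 := convexHull ℝ (s : Set E3)

/-- The infimum of the diameters of the balls that contain a simplex. For a triangle this is the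
diameter of the smallest circle around it. -/
def size (s : Finset E3) : ℝ := sInf {d : ℝ | ∃ c : E3, hull s ⊆ Metric.closedBall c (d / 2)}

/-- Integral over a tetrahedron. -/
def cellInt (s : Finset E3) (f : E3 → ℝ) : ℝ := ∫ x in hull s, f x

/-- Surface integral over a triangle: `μHE[2]` is the two-dimensional Hausdorff measure, normalized
to be the area on planes. -/
def faceInt (t : Finset E3) (f : E3 → ℝ) : ℝ := ∫ x in hull t, f x ∂μHE[2]

/-- `n` is one of the two unit normal vectors of the triangle `t`. -/
def IsUnitNormal (t : Finset E3) (n : Vec) : Prop :=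
  sqLen n = 1 ∧ ∀ a ∈ t, ∀ b ∈ t, n ⬝ᵥ (fun i => b i - a i) = 0

/-- `n` is the unit normal vector of the face `t` of the tetrahedron `s` that points out of `s`. -/
def IsOuterNormal (s t : Finset E3) (n : Vec) : Prop :=
  IsUnitNormal t n ∧ ∀ a ∈ t, ∀ b ∈ s, b ∉ t → n ⬝ᵥ (fun i => b i - a i) < 0

/-- The outward unit normal vector of the tetrahedron `s` on its face `t`. -/
def outerNormal (s t : Finset E3) : Vec := Classical.epsilon (IsOuterNormal s t)

/-- The space of polynomials of degree at most `j` on the triangle `t`. Its elements are functions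
on `t`, extended by zero to the whole space. -/
def facePoly (t : Finset E3) (j : ℕ) : Set (E3 → ℝ) :=
  {g | ∃ p ∈ polyDeg j, g = (hull t).indicator (ev p)}

/-! ### Meshes -/

/-- A conforming partition of `Ω` into finitely many tetrahedra, each given by its vertices. -/
structure TetMesh (Ω : Set E3) where
  cells : Finset (Finset E3)
  card_eq : ∀ s ∈ cells, s.card = 4
  indep : ∀ s ∈ cells, AffineIndependent ℝ (fun v : {v : E3 // v ∈ s} => (v : E3))
  conforming : ∀ s ∈ cells, ∀ t ∈ cells,
    hull s ∩ hull t ⊆ convexHull ℝ ((s : Set E3) ∩ (t : Set E3))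
  covers : (⋃ s ∈ cells, hull s) = closure Ω

open scoped Classical in
/-- The faces of all tetrahedra of the mesh. -/
def TetMesh.faces {Ω : Set E3} (M : TetMesh Ω) : Finset (Finset E3) :=
  M.cells.biUnion (fun s => s.powersetCard 3)

/-- The tetrahedra of the mesh, as a type. -/
abbrev TetMesh.Cell {Ω : Set E3} (M : TetMesh Ω) : Type := {s : Finset E3 // s ∈ M.cells}

/-- The faces of the mesh, as a type. -/
abbrev TetMesh.Face {Ω : Set E3} (M : TetMesh Ω) : Type := {t : Finset E3 // t ∈ M.faces}

/-- Faces that lie on the boundary of `Ω`; all other faces are interior. -/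
def TetMesh.IsBoundary {Ω : Set E3} (M : TetMesh Ω) (F : M.Face) : Prop :=
  hull F.1 ⊆ frontier Ω

/-- Shape regularity with constant `κ`: each tetrahedron `T` contains a ball of radius `h_T / κ`. -/
def TetMesh.ShapeRegular {Ω : Set E3} (M : TetMesh Ω) (κ : ℝ) : Prop :=
  ∀ s ∈ M.cells, ∃ c : E3, Metric.closedBall c (size s / κ) ⊆ hull s

section Sums

variable {Ω : Set E3} (M : TetMesh Ω)

/-- `∑_T ∫_T f_T`. -/
def volSum (f : M.Cell → E3 → ℝ) : ℝ := ∑ T : M.Cell, cellInt T.1 (f T)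

open scoped Classical in
/-- `∑_T ∫_{∂T} f`, where the integrand may depend on the tetrahedron and on its face. -/
def bdrySum (f : M.Cell → M.Face → E3 → ℝ) : ℝ :=
  ∑ T : M.Cell, ∑ F : M.Face with F.1 ⊆ T.1, faceInt F.1 (f T F)

open scoped Classical in
/-- The jump `⟦n · v⟧` on a face: the sum of the outward normal components from all adjacent
tetrahedra (two of them at an interior face). -/
def normalJump (v : M.Cell → VPoly) (F : M.Face) (x : E3) : ℝ :=
  ∑ T : M.Cell with F.1 ⊆ T.1, outerNormal T.1 F.1 ⬝ᵥ evV (v T) x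

open scoped Classical in
/-- The sum over the interior faces. -/
def interiorFaceSum (f : M.Face → E3 → ℝ) : ℝ :=
  ∑ F : M.Face with ¬ M.IsBoundary F, faceInt F.1 (f F)

end Sums

/-! ### The discrete unknowns -/

/-- Tuples `(r, u, û, ĉ, p, p̂)`: piecewise polynomials on the mesh, functions on its faces. -/
@[ext]
structure Tuple {Ω : Set E3} (M : TetMesh Ω) where
  r : M.Cell → VPoly
  u : M.Cell → VPoly
  uhat : M.Face → E3 → Vec
  chat : M.Face → E3 → Vec
  p : M.Cell → Poly
  phat : M.Face → E3 → ℝ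

instance {Ω : Set E3} (M : TetMesh Ω) : Zero (Tuple M) := ⟨⟨0, 0, 0, 0, 0, 0⟩⟩

/-- Tangential vector fields on the faces, polynomial of degree at most `j` on each face, whose
tangential trace vanishes on the boundary of `Ω`. -/
structure IsTraceField {Ω : Set E3} (M : TetMesh Ω) (j : ℕ) (w : M.Face → E3 → Vec) : Prop where
  poly : ∀ F : M.Face, ∀ i, (fun x => w F x i) ∈ facePoly F.1 j
  tangential : ∀ F : M.Face, ∀ n, IsUnitNormal F.1 n → ∀ x ∈ hull F.1, n ⬝ᵥ w F x = 0
  boundary : ∀ F : M.Face, M.IsBoundary F → ∀ n, IsUnitNormal F.1 n →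
    ∀ x ∈ hull F.1, n ⨯₃ w F x = 0

/-- The space `Σ_h^0 = R_h × U_h × Û_h^0 × Ĉ_h^0 × P_h × P̂_h^0` of order `k`. -/
structure MemSigmaZero {Ω : Set E3} (M : TetMesh Ω) (k : ℕ) (τ : Tuple M) : Prop where
  r_mem : ∀ T i, τ.r T i ∈ polyDeg (k - 1)
  u_mem : ∀ T i, τ.u T i ∈ polyDeg k
  uhat_mem : IsTraceField M k τ.uhat
  chat_mem : IsTraceField M (k - 1) τ.chat
  p_mem : ∀ T, τ.p T ∈ polyDeg k
  phat_mem : ∀ F : M.Face, τ.phat F ∈ facePoly F.1 k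
  phat_boundary : ∀ F : M.Face, M.IsBoundary F → ∀ x ∈ hull F.1, τ.phat F x = 0

/-- `Σ_h^0` as a set of tuples. -/
def sigmaZero {Ω : Set E3} (M : TetMesh Ω) (k : ℕ) : Set (Tuple M) := {τ | MemSigmaZero M k τ}

/-! ### The bilinear form -/

section Forms

variable {Ω : Set E3} (M : TetMesh Ω)

/-- `a_h(r, s) = (r, s)`. -/
def formA (r s : M.Cell → VPoly) : ℝ :=
  volSum M fun T x => evV (r T) x ⬝ᵥ evV (s T) x

/-- `b_h(u, û, ĉ; s) = -(u, ∇×∇×s) - ⟨n×û, ∇×s⟩ - ⟨n×ĉ, s⟩`. -/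
def formB (u : M.Cell → VPoly) (uhat chat : M.Face → E3 → Vec) (s : M.Cell → VPoly) : ℝ :=
  - volSum M (fun T x => evV (u T) x ⬝ᵥ evV (curl (curl (s T))) x)
  - bdrySum M (fun T F x => (outerNormal T.1 F.1 ⨯₃ uhat F x) ⬝ᵥ evV (curl (s T)) x)
  - bdrySum M (fun T F x => (outerNormal T.1 F.1 ⨯₃ chat F x) ⬝ᵥ evV (s T) x)

/-- `c_h(q, q̂; u) = (∇·u, q) - ⟨n·u, q̂⟩`. -/
def formC (q : M.Cell → Poly) (qhat : M.Face → E3 → ℝ) (u : M.Cell → VPoly) : ℝ :=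
  volSum M (fun T x => ev (divg (u T)) x * ev (q T) x)
  - bdrySum M (fun T F x => (outerNormal T.1 F.1 ⬝ᵥ evV (u T) x) * qhat F x)

/-- `s_h^u = ⟨h_F⁻³ n×(u-û), n×(v-v̂)⟩ + ⟨h_F⁻¹ n×(∇×u-ĉ), n×(∇×v-d̂)⟩`. -/
def formSU (u : M.Cell → VPoly) (uhat chat : M.Face → E3 → Vec)
    (v : M.Cell → VPoly) (vhat dhat : M.Face → E3 → Vec) : ℝ :=
  bdrySum M (fun T F x => ((size F.1)⁻¹) ^ 3 *
    ((outerNormal T.1 F.1 ⨯₃ (evV (u T) x - uhat F x)) ⬝ᵥ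
      (outerNormal T.1 F.1 ⨯₃ (evV (v T) x - vhat F x))))
  + bdrySum M (fun T F x => (size F.1)⁻¹ *
    ((outerNormal T.1 F.1 ⨯₃ (evV (curl (u T)) x - chat F x)) ⬝ᵥ
      (outerNormal T.1 F.1 ⨯₃ (evV (curl (v T)) x - dhat F x))))

/-- `s_h^p = ⟨h_F⁻¹ (p-p̂), q-q̂⟩`. -/
def formSP (p : M.Cell → Poly) (phat : M.Face → E3 → ℝ)
    (q : M.Cell → Poly) (qhat : M.Face → E3 → ℝ) : ℝ :=
  bdrySum M (fun T F x => (size F.1)⁻¹ *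
    ((ev (p T) x - phat F x) * (ev (q T) x - qhat F x)))

/-- The bilinear form `B_h`. -/
def Bh (σ τ : Tuple M) : ℝ :=
  formA M σ.r τ.r + formB M σ.u σ.uhat σ.chat τ.r
  + formB M τ.u τ.uhat τ.chat σ.r + formC M σ.p σ.phat τ.u
  - formSU M σ.u σ.uhat σ.chat τ.u τ.uhat τ.chat
  + formC M τ.p τ.phat σ.u + formSP M σ.p σ.phat τ.p τ.phat

/-! ### The mesh-dependent norm -/

/-- `‖(v, v̂, d̂)‖²_curl`. -/
def curlSq (v : M.Cell → VPoly) (vhat dhat : M.Face → E3 → Vec) : ℝ :=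
  volSum M (fun T x => sqLen (evV (curl (curl (v T))) x))
  + bdrySum M (fun T F x => ((size F.1)⁻¹) ^ 3 *
      sqLen (outerNormal T.1 F.1 ⨯₃ (evV (v T) x - vhat F x)))
  + bdrySum M (fun T F x => (size F.1)⁻¹ *
      sqLen (outerNormal T.1 F.1 ⨯₃ (evV (curl (v T)) x - dhat F x)))

/-- `‖v‖²_div = ‖h_T ∇·v‖² + ‖h_F^{1/2} ⟦n·v⟧‖²`, the jumps over the interior faces. -/
def divSq (v : M.Cell → VPoly) : ℝ :=
  volSum M (fun T x => (size T.1 * ev (divg (v T)) x) ^ 2)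
  + interiorFaceSum M (fun F x => size F.1 * normalJump M v F x ^ 2)

/-- `‖(v, v̂, d̂)‖²_U`. -/
def normUSq (v : M.Cell → VPoly) (vhat dhat : M.Face → E3 → Vec) : ℝ :=
  curlSq M v vhat dhat + divSq M v

/-- `‖(q, q̂)‖²_P = ‖h_T^α ∇q‖² + ‖h_F^{β-1/2} (q-q̂)‖²`, with the powers `α` and `β` of the mesh size
as parameters. -/
def normPSq (α β : ℕ) (q : M.Cell → Poly) (qhat : M.Face → E3 → ℝ) : ℝ :=
  volSum M (fun T x => (size T.1 ^ α) ^ 2 * sqLen (evV (grad (q T)) x))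
  + bdrySum M (fun T F x => (size F.1 ^ β) ^ 2 * (size F.1)⁻¹ * (ev (q T) x - qhat F x) ^ 2)

/-- The norm `‖·‖_{Σ_h}`. -/
def normSigma (α β : ℕ) (σ : Tuple M) : ℝ :=
  Real.sqrt (volSum M (fun T x => sqLen (evV (σ.r T) x))
    + normUSq M σ.u σ.uhat σ.chat + normPSq M α β σ.p σ.phat)

end Forms

end QuadCurlHDG

end

noncomputable section

namespace QuadCurlHDG

/-! ### Parametrization of simplices -/

/-! The form is symmetric (`Bh_comm`), so one of the two conditions suffices, and by duality it is
enough to prove stability: if `Bh M σ` is at most `m` times the norm on all test tuples, then the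
norm of `σ` is at most a constant times `m` (`exists_stability`).

Four test tuples control the parts of the norm. Changing the sign of the `u`-part of `σ` cancels all
coupling terms and leaves `‖r‖²` and the three stabilization terms (`exists_test_stabilization`).
The field `-∇×∇×u` in the first slot gives `‖∇×∇×u‖²` after two integrations by parts
(`exists_test_curlCurl`). The pair `h_T² ∇·u`, `-h_F ⟦n·u⟧` in the scalar slots gives the divergence
seminorm (`exists_test_div`). For `∇p` the test field is `-∇q`, where `q` is a conforming
approximation of `p` (`exists_test_grad`): it is curl free and has a single-valued tangential trace,
so `b_h` and the stabilization of `u` do not see it, while `c_h` pairs it with `∇p`. All remainders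
are absorbed by weighted Young inequalities, with inverse and trace inequalities, into stabilization
terms that are already controlled.

The conforming approximation (`exists_conforming`) lives on Bernstein coefficients. These are
indexed by multi-indices in vertices and do not depend on the simplex through which they are
computed. At each multi-index `α`, the cells around it are linked when they share a face containing
the support of `α`. On every connected component the coefficient is made constant: zero if the
component has a boundary face at `α`, the value of a representative otherwise. The error is a
telescoping sum of jumps `p - p̂` along a short path (`exists_nodal_error_le`). Paths are short
because at most `κ³` cells meet at a point (`TetMesh.ShapeRegular.card_cells_le`).

The inverse and trace inequalities follow from the equivalence of coefficient and integral norms on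
a reference simplex (`exists_sum_sq_le_integral_bary`) and from scaling by shape regularity. The
divergence theorem (`cellInt_divg`) comes from the fundamental theorem of calculus on that simplex.

Stability is proved for `α = β = 0`. The other powers cost a factor `L` that bounds the cell sizes
(`normSigma_le`). Tuples of norm zero, whose quotients are zero by convention, are reached by
perturbing `r` with a small constant field (`Bh_le_of_ratio_le`). -/

/-- The corner simplex, the domain of the parametrization of a simplex. -/
def corner (n : ℕ) : Set (Fin n → ℝ) := {y | (∀ i, 0 ≤ y i) ∧ ∑ i, y i ≤ 1}

/-- The barycentric coordinates of a point of the corner simplex. -/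
def bc {n : ℕ} (y : Fin n → ℝ) : Fin (n + 1) → ℝ := Fin.cons (1 - ∑ i, y i) y

/-- The affine parametrization of the simplex with vertices `a`. -/
def par {n : ℕ} (a : Fin (n + 1) → E3) (y : Fin n → ℝ) : E3 := ∑ i, bc y i • a i

/-- The linear part of the parametrization. -/
def edgeMap {n : ℕ} (a : Fin (n + 1) → E3) : EuclideanSpace ℝ (Fin n) →ₗ[ℝ] E3 :=
  ∑ i, (LinearMap.smulRight (EuclideanSpace.projₗ i : EuclideanSpace ℝ (Fin n) →ₗ[ℝ] ℝ)
    (a i.succ - a 0))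

/-- The volume factor of the parametrization. -/
def jac {n : ℕ} (a : Fin (n + 1) → E3) : ℝ := (edgeMap a).normDet

lemma edgeMap_apply {n : ℕ} (a : Fin (n + 1) → E3) (y : EuclideanSpace ℝ (Fin n)) :
    edgeMap a y = ∑ i, y i • (a i.succ - a 0) := by
  simp [edgeMap]

lemma sum_bc {n : ℕ} (y : Fin n → ℝ) : ∑ i, bc y i = 1 := by
  simp [bc, Fin.sum_univ_succ]

lemma bc_nonneg {n : ℕ} {y : Fin n → ℝ} (hy : y ∈ corner n) (i : Fin (n + 1)) : 0 ≤ bc y i := by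
  refine Fin.cases ?_ (fun j => ?_) i
  · simpa [bc] using hy.2
  · simpa [bc] using hy.1 j

lemma bc_le_one {n : ℕ} {y : Fin n → ℝ} (hy : y ∈ corner n) (i : Fin (n + 1)) : bc y i ≤ 1 := by
  rw [← sum_bc y]
  exact Finset.single_le_sum (fun j _ => bc_nonneg hy j) (Finset.mem_univ i)

lemma par_eq {n : ℕ} (a : Fin (n + 1) → E3) (y : Fin n → ℝ) :
    par a y = a 0 + edgeMap a (WithLp.toLp 2 y) := by
  simp only [par, edgeMap_apply, Fin.sum_univ_succ, bc, Fin.cons_zero, Fin.cons_succ, smul_sub,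
    Finset.sum_sub_distrib, sub_smul, one_smul, Finset.sum_smul]
  abel

lemma continuous_par {n : ℕ} (a : Fin (n + 1) → E3) : Continuous (par a) := by
  have : par a = fun y => a 0 + ∑ i, y i • (a i.succ - a 0) := by
    funext y
    rw [par_eq, edgeMap_apply]
  rw [this]
  fun_prop

lemma isClosed_corner (n : ℕ) : IsClosed (corner n) := by
  have : corner n = (⋂ i, {y | 0 ≤ y i}) ∩ {y | ∑ i, y i ≤ 1} := by
    ext y; simp [corner]
  rw [this]
  refine IsClosed.inter (isClosed_iInter fun i => isClosed_le ?_ ?_) (isClosed_le ?_ ?_) <;> fun_prop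

lemma corner_subset_Icc (n : ℕ) : corner n ⊆ Set.Icc 0 1 := by
  intro y hy
  refine ⟨fun i => hy.1 i, fun i => ?_⟩
  have := bc_le_one hy i.succ
  simpa [bc] using this

lemma isCompact_corner (n : ℕ) : IsCompact (corner n) :=
  isCompact_Icc.of_isClosed_subset (isClosed_corner n) (corner_subset_Icc n)

lemma measurableSet_corner (n : ℕ) : MeasurableSet (corner n) := (isClosed_corner n).measurableSet

/-- The hull is a linear image of the standard simplex, and eliminating the zeroth weight turns the
standard simplex into the corner simplex. -/
lemma convexHull_range_eq_image {n : ℕ} (a : Fin (n + 1) → E3) :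
    convexHull ℝ (Set.range a) = par a '' corner n := by
  apply Set.Subset.antisymm
  · have h := LinearMap.image_convexHull (Fintype.linearCombination ℝ a)
      (Set.range fun i : Fin (n + 1) => (Pi.single i (1 : ℝ) : Fin (n + 1) → ℝ))
    rw [convexHull_rangle_single_eq_stdSimplex, ← Set.range_comp] at h
    have h2 : (⇑(Fintype.linearCombination ℝ a) ∘ fun i => Pi.single i (1 : ℝ)) = a := by
      funext i
      simp [Fintype.linearCombination_apply_single]
    rw [h2] at h
    rw [← h]
    rintro _ ⟨w, hw, rfl⟩
    have h0 : w 0 = 1 - ∑ i : Fin n, w i.succ := by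
      have := hw.2
      rw [Fin.sum_univ_succ] at this
      linarith
    refine ⟨fun i => w i.succ, ⟨fun i => hw.1 _, ?_⟩, ?_⟩
    · have := hw.1 0
      linarith
    · rw [par, Fintype.linearCombination_apply]
      refine Finset.sum_congr rfl fun i _ => ?_
      congr 1
      refine Fin.cases ?_ (fun j => ?_) i <;> simp [bc, h0]
  · rintro _ ⟨y, hy, rfl⟩
    exact (convex_convexHull ℝ _).sum_mem (fun i _ => bc_nonneg hy i) (sum_bc y)
      (fun i _ => subset_convexHull ℝ _ (Set.mem_range_self i))

lemma edgeMap_injective {n : ℕ} {a : Fin (n + 1) → E3} (ha : AffineIndependent ℝ a) :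
    Function.Injective (edgeMap a) := by
  rw [affineIndependent_iff_linearIndependent_vsub ℝ a 0] at ha
  have hli : LinearIndependent ℝ (fun i : Fin n => a i.succ - a 0) :=
    ha.comp (fun i : Fin n => (⟨i.succ, Fin.succ_ne_zero i⟩ : {x : Fin (n + 1) // x ≠ 0}))
      (fun i j hij => by simpa using hij)
  rw [injective_iff_map_eq_zero]
  intro y hy
  rw [edgeMap_apply] at hy
  have := Fintype.linearIndependent_iff.1 hli (fun i => y i) hy
  ext i
  simpa using this i

lemma par_injective {n : ℕ} {a : Fin (n + 1) → E3} (ha : AffineIndependent ℝ a) :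
    Function.Injective (par a) := by
  intro y z h
  rw [par_eq, par_eq, add_right_inj] at h
  exact (WithLp.toLp_injective 2) (edgeMap_injective ha h)

lemma jac_pos {n : ℕ} {a : Fin (n + 1) → E3} (ha : AffineIndependent ℝ a) : 0 < jac a := by
  refine lt_of_le_of_ne (LinearMap.normDet_nonneg _) (Ne.symm ?_)
  exact ((LinearMap.normDet_ne_zero_tfae (edgeMap a)).out 0 4).2 (edgeMap_injective ha)

lemma measurableEmbedding_par {n : ℕ} {a : Fin (n + 1) → E3} (ha : AffineIndependent ℝ a) :
    MeasurableEmbedding (par a) :=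
  (continuous_par a).measurableEmbedding (par_injective ha)

-- Translations preserve the Hausdorff measure, and a linear map scales it by its `normDet` even
-- when the target has larger dimension. One formula therefore serves both volumes and face areas.
open scoped Pointwise in
lemma measure_par_image {n : ℕ} (a : Fin (n + 1) → E3) (A : Set (Fin n → ℝ)) :
    (μHE[n] : Measure E3) (par a '' A) = ENNReal.ofReal (jac a) * volume A := by
  have h1 : par a '' A = (a 0) +ᵥ (edgeMap a '' (WithLp.toLp 2 '' A)) := by
    ext x
    simp only [Set.mem_image, Set.mem_vadd_set, par_eq, vadd_eq_add, exists_exists_and_eq_and]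
  have h2 := LinearMap.euclideanHausdorffMeasure_image_eq_normDet_mul_volume (edgeMap a)
    (WithLp.toLp 2 '' A)
  rw [finrank_euclideanSpace_fin] at h2
  rw [h1, measure_vadd, h2, jac]
  congr 1
  have h3 := (EuclideanSpace.volume_preserving_symm_measurableEquiv_toLp (Fin n)).measure_preimage_equiv A
  rw [← h3]
  congr 1
  ext x
  constructor
  · rintro ⟨y, hy, rfl⟩
    exact hy
  · intro hx
    exact ⟨WithLp.ofLp x, hx, rfl⟩

/-- The change of variables formula for simplices of any dimension, for measures. -/
theorem restrict_convexHull_eq_map {n : ℕ} {a : Fin (n + 1) → E3} (ha : AffineIndependent ℝ a) :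
    (μHE[n] : Measure E3).restrict (convexHull ℝ (Set.range a)) =
      ENNReal.ofReal (jac a) • (volume.restrict (corner n)).map (par a) := by
  ext A hA
  rw [Measure.restrict_apply hA, Measure.smul_apply, (measurableEmbedding_par ha).map_apply,
    Measure.restrict_apply ((continuous_par a).measurable hA), smul_eq_mul, ← measure_par_image,
    convexHull_range_eq_image, Set.image_preimage_inter]

/-- The change of variables formula for simplices of any dimension. -/
theorem integral_convexHull {n : ℕ} {a : Fin (n + 1) → E3} (ha : AffineIndependent ℝ a)
    (f : E3 → ℝ) :
    ∫ x in convexHull ℝ (Set.range a), f x ∂μHE[n] = jac a * ∫ y in corner n, f (par a y) := by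
  rw [restrict_convexHull_eq_map ha, integral_smul_measure, (measurableEmbedding_par ha).integral_map,
    ENNReal.toReal_ofReal (jac_pos ha).le, smul_eq_mul]

lemma volume_eq_hausdorff : (volume : Measure E3) = μHE[3] :=
  (EuclideanSpace.euclideanHausdorffMeasure_eq_volume 3).symm

lemma jac_sq {n : ℕ} (a : Fin (n + 1) → E3) :
    jac a ^ 2 = (Matrix.gram ℝ (fun i : Fin n => a i.succ - a 0)).det := by
  have h := LinearMap.normDet_sq_eq_det_gram (edgeMap a) (EuclideanSpace.basisFun (Fin n) ℝ)
  rw [jac]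
  have h' : (fun i => edgeMap a ((EuclideanSpace.basisFun (Fin n) ℝ) i)) =
      fun i : Fin n => a i.succ - a 0 := by
    funext i
    simp [edgeMap_apply]
  rw [h'] at h
  simpa using h

/-- The factors of a tetrahedron and of the face opposite to its last vertex. -/
theorem jac_face {a : Fin 4 → E3} {g : Vec} (h1 : g ⬝ᵥ (fun i => a 1 i - a 0 i) = 0)
    (h2 : g ⬝ᵥ (fun i => a 2 i - a 0 i) = 0) (h3 : g ⬝ᵥ (fun i => a 3 i - a 0 i) = 1) :
    jac (a ∘ Fin.castSucc) = jac a * Real.sqrt (sqLen g) := by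
  have hn : 0 ≤ sqLen g := by
    simp only [sqLen, dotProduct, Fin.sum_univ_three]; nlinarith [sq_nonneg (g 0), sq_nonneg (g 1), sq_nonneg (g 2)]
  have key : jac (a ∘ Fin.castSucc) ^ 2 = (jac a * Real.sqrt (sqLen g)) ^ 2 := by
    rw [mul_pow, Real.sq_sqrt hn, jac_sq, jac_sq, Matrix.det_fin_three, Matrix.det_fin_two]
    simp only [Matrix.gram_apply, Function.comp, PiLp.inner_apply, Fin.sum_univ_three, sqLen,
      dotProduct, PiLp.sub_apply, RCLike.inner_apply, conj_trivial] at *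
    simp only [show (Fin.succ 0 : Fin 4) = 1 from rfl, show (Fin.succ 1 : Fin 4) = 2 from rfl,
      show (Fin.succ 2 : Fin 4) = 3 from rfl, show Fin.castSucc (Fin.succ 0 : Fin 3) = (1 : Fin 4) from rfl,
      show Fin.castSucc (Fin.succ 1 : Fin 3) = (2 : Fin 4) from rfl,
      show Fin.castSucc (0 : Fin 3) = (0 : Fin 4) from rfl]
    generalize a 1 0 - a 0 0 = x1 at *
    generalize a 1 1 - a 0 1 = x2 at *
    generalize a 1 2 - a 0 2 = x3 at *
    generalize a 2 0 - a 0 0 = y1 at *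
    generalize a 2 1 - a 0 1 = y2 at *
    generalize a 2 2 - a 0 2 = y3 at *
    generalize a 3 0 - a 0 0 = z1 at *
    generalize a 3 1 - a 0 1 = z2 at *
    generalize a 3 2 - a 0 2 = z3 at *
    -- Cramer's rule: the cross product of the two face edges is the triple product of all three
    -- edges times `g`. Comparing lengths gives the claim.
    have hc1 : (x2 * y3 - x3 * y2) = (x1*(y2*z3-y3*z2) - x2*(y1*z3-y3*z1)+x3*(y1*z2-y2*z1)) * g 0 := by
      linear_combination (-(y2*z3-y3*z2)) * h1 + (x2*z3-x3*z2) * h2 - (x2*y3-x3*y2) * h3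
    have hc2 : (x3 * y1 - x1 * y3) = (x1*(y2*z3-y3*z2) - x2*(y1*z3-y3*z1)+x3*(y1*z2-y2*z1)) * g 1 := by
      linear_combination (-(y3*z1-y1*z3)) * h1 + (x3*z1-x1*z3) * h2 - (x3*y1-x1*y3) * h3
    have hc3 : (x1 * y2 - x2 * y1) = (x1*(y2*z3-y3*z2) - x2*(y1*z3-y3*z1)+x3*(y1*z2-y2*z1)) * g 2 := by
      linear_combination (-(y1*z2-y2*z1)) * h1 + (x1*z2-x2*z1) * h2 - (x1*y2-x2*y1) * h3
    trans (x2 * y3 - x3 * y2)^2 + (x3 * y1 - x1 * y3)^2 + (x1 * y2 - x2 * y1)^2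
    · ring
    · rw [hc1, hc2, hc3]; ring
  exact (sq_eq_sq₀ (LinearMap.normDet_nonneg _)
    (mul_nonneg (LinearMap.normDet_nonneg _) (Real.sqrt_nonneg _))).1 key

/-! ### The fundamental theorem of calculus on the corner simplex -/

/-- The slices in the first coordinate are segments over the corner simplex of one dimension less,
which is the form that Fubini needs. -/
lemma mem_corner_succ {n : ℕ} (t : ℝ) (z : Fin n → ℝ) :
    (Fin.cons t z : Fin (n + 1) → ℝ) ∈ corner (n + 1) ↔
      z ∈ corner n ∧ t ∈ Set.Icc 0 (1 - ∑ i, z i) := by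
  change ((∀ i, 0 ≤ (Fin.cons t z : Fin (n + 1) → ℝ) i) ∧
    ∑ i, (Fin.cons t z : Fin (n + 1) → ℝ) i ≤ 1) ↔ ((∀ i, 0 ≤ z i) ∧ ∑ i, z i ≤ 1) ∧ _ ∧ _
  simp only [Fin.forall_fin_succ, Fin.cons_zero, Fin.cons_succ, Fin.sum_univ_succ]
  constructor
  · rintro ⟨⟨h1, h2⟩, h3⟩
    exact ⟨⟨h2, by linarith⟩, h1, by linarith⟩
  · rintro ⟨⟨h1, h2⟩, h3, h4⟩
    exact ⟨⟨h3, h1⟩, by linarith⟩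

lemma continuous_cons_comp {n : ℕ} {X : Type*} [TopologicalSpace X] {f : X → ℝ}
    {g : X → Fin n → ℝ} (hf : Continuous f) (hg : Continuous g) :
    Continuous fun x => (Fin.cons (f x) (g x) : Fin (n + 1) → ℝ) := by
  refine continuous_pi fun i => ?_
  refine Fin.cases ?_ (fun j => ?_) i
  · simpa using hf
  · exact (continuous_apply j).comp hg

/-- Fubini in the first coordinate, and the fundamental theorem of calculus on each slice. -/
theorem integral_corner_deriv {n : ℕ} {F F' : (Fin (n + 1) → ℝ) → ℝ}
    (hc : Continuous F') (hd : ∀ t z, HasDerivAt (fun t : ℝ => F (Fin.cons t z)) (F' (Fin.cons t z)) t) :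
    ∫ y in corner (n + 1), F' y =
      ∫ z in corner n, (F (Fin.cons (1 - ∑ i, z i) z) - F (Fin.cons 0 z)) := by
  rw [← integral_indicator (measurableSet_corner _), ← integral_indicator (measurableSet_corner _)]
  have e := (volume_preserving_piFinSuccAbove (fun _ : Fin (n + 1) => ℝ) 0).symm
  rw [← e.integral_comp' ]
  have hint : Integrable (fun q : ℝ × (Fin n → ℝ) =>
      (corner (n + 1)).indicator F' ((MeasurableEquiv.piFinSuccAbove (fun _ => ℝ) 0).symm q)) := by
    refine (e.integrable_comp_emb (g := (corner (n + 1)).indicator F')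
      (MeasurableEquiv.measurableEmbedding _)).2 ?_
    rw [integrable_indicator_iff (measurableSet_corner _)]
    exact hc.continuousOn.integrableOn_compact (isCompact_corner _)
  rw [Measure.volume_eq_prod] at hint ⊢
  rw [integral_prod_symm _ hint]
  congr 1
  funext z
  have hz : ∀ t : ℝ, (MeasurableEquiv.piFinSuccAbove (fun _ : Fin (n + 1) => ℝ) 0).symm (t, z) =
      Fin.cons t z := fun t => by
    funext i
    refine Fin.cases ?_ (fun j => ?_) i <;> simp [MeasurableEquiv.piFinSuccAbove]
  simp only [hz]
  by_cases hzc : z ∈ corner n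
  · rw [Set.indicator_of_mem hzc]
    have h0 : (0 : ℝ) ≤ 1 - ∑ i, z i := by linarith [hzc.2]
    have : (fun t : ℝ => (corner (n + 1)).indicator F' (Fin.cons t z)) =
        (Set.Icc 0 (1 - ∑ i, z i)).indicator (fun t => F' (Fin.cons t z)) := by
      funext t
      by_cases ht : t ∈ Set.Icc 0 (1 - ∑ i, z i)
      · rw [Set.indicator_of_mem ht, Set.indicator_of_mem ((mem_corner_succ t z).2 ⟨hzc, ht⟩)]
      · rw [Set.indicator_of_notMem ht, Set.indicator_of_notMem
          (fun h => ht ((mem_corner_succ t z).1 h).2)]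
    rw [this, integral_indicator measurableSet_Icc, integral_Icc_eq_integral_Ioc,
      ← intervalIntegral.integral_of_le h0]
    refine intervalIntegral.integral_eq_sub_of_hasDerivAt (fun t _ => hd t z) ?_
    exact (hc.comp (continuous_cons_comp continuous_id continuous_const)).intervalIntegrable _ _
  · rw [Set.indicator_of_notMem hzc]
    have : (fun t : ℝ => (corner (n + 1)).indicator F' (Fin.cons t z)) = 0 := by
      funext t
      exact Set.indicator_of_notMem (fun h => hzc ((mem_corner_succ t z).1 h).1) _
    rw [this]
    simp

/-! ### Evaluation of polynomials -/

lemma ev_add (p q : Poly) (x : E3) : ev (p + q) x = ev p x + ev q x := by simp [ev]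
lemma ev_sub (p q : Poly) (x : E3) : ev (p - q) x = ev p x - ev q x := by simp [ev]
lemma ev_neg (p : Poly) (x : E3) : ev (-p) x = -ev p x := by simp [ev]
lemma ev_mul (p q : Poly) (x : E3) : ev (p * q) x = ev p x * ev q x := by simp [ev]
lemma ev_smul (c : ℝ) (p : Poly) (x : E3) : ev (c • p) x = c * ev p x := by simp [ev]
lemma ev_C (c : ℝ) (x : E3) : ev (MvPolynomial.C c) x = c := by simp [ev]
lemma ev_X (i : Fin 3) (x : E3) : ev (MvPolynomial.X i) x = x i := by simp [ev]
lemma ev_zero (x : E3) : ev 0 x = 0 := by simp [ev]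
lemma ev_sum {ι : Type*} (s : Finset ι) (f : ι → Poly) (x : E3) :
    ev (∑ i ∈ s, f i) x = ∑ i ∈ s, ev (f i) x := by simp [ev]
lemma ev_pow (p : Poly) (n : ℕ) (x : E3) : ev (p ^ n) x = ev p x ^ n := by simp [ev]
lemma ev_prod {ι : Type*} (s : Finset ι) (f : ι → Poly) (x : E3) :
    ev (∏ i ∈ s, f i) x = ∏ i ∈ s, ev (f i) x := by simp [ev]

lemma poly_ext {p q : Poly} (h : ∀ x : E3, ev p x = ev q x) : p = q :=
  MvPolynomial.funext fun x => h (WithLp.toLp 2 x)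

@[fun_prop]
lemma continuous_ev (p : Poly) : Continuous (ev p) := by
  induction p using MvPolynomial.induction_on with
  | C c => simp only [funext (ev_C c)]; fun_prop
  | add p q hp hq => simp only [funext (ev_add p q)]; fun_prop
  | mul_X p i hp => simp only [funext (ev_mul p (MvPolynomial.X i)), ev_X]; fun_prop

@[fun_prop]
lemma continuous_evV_apply (v : VPoly) (i : Fin 3) : Continuous fun x => evV v x i :=
  continuous_ev (v i)

/-- The chain rule for polynomials along a curve. -/
lemma hasDerivAt_ev (p : Poly) {x : ℝ → E3} {x' : E3} {t : ℝ}
    (hx : ∀ i, HasDerivAt (fun s => x s i) (x' i) t) :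
    HasDerivAt (fun s => ev p (x s)) (∑ i, x' i * ev (MvPolynomial.pderiv i p) (x t)) t := by
  induction p using MvPolynomial.induction_on with
  | C c => simpa [ev_C, ev_zero] using hasDerivAt_const t c
  | add p q hp hq =>
    simp only [ev_add, mul_add, Finset.sum_add_distrib, map_add]
    exact hp.add hq
  | mul_X p j hp =>
    have h := hp.mul (hx j)
    simp only [ev_mul, ev_X]
    refine h.congr_deriv ?_
    simp only [Derivation.leibniz, MvPolynomial.pderiv_X, smul_eq_mul, ev_add, ev_mul, ev_X]
    simp only [mul_add, Finset.sum_add_distrib, Pi.single_apply]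
    rw [Finset.sum_mul, add_comm]
    congr 1
    · rw [Finset.sum_eq_single j]
      · simp [ev]; ring
      · intro b _ hb
        simp [hb.symm, ev]
      · simp
    · refine Finset.sum_congr rfl fun i _ => ?_
      ring

/-- The directional derivative. -/
def dirDeriv (w : E3) (p : Poly) : Poly := ∑ i, w i • MvPolynomial.pderiv i p

lemma ev_dirDeriv (w : E3) (p : Poly) (x : E3) :
    ev (dirDeriv w p) x = ∑ i, w i * ev (MvPolynomial.pderiv i p) x := by
  simp [dirDeriv, ev_sum, ev_smul]

lemma par_apply {n : ℕ} (a : Fin (n + 1) → E3) (y : Fin n → ℝ) (i : Fin 3) :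
    par a y i = a 0 i + ∑ j, y j * (a j.succ i - a 0 i) := by
  simp [par_eq, edgeMap_apply]

lemma integrableOn_corner {n : ℕ} {f : (Fin n → ℝ) → ℝ} (hf : Continuous f) :
    IntegrableOn f (corner n) :=
  hf.continuousOn.integrableOn_compact (isCompact_corner n)

/-- Moving the first corner coordinate moves the point along the edge from `a 0` to `a 1`. The two
ends of the slices sweep the faces opposite to `a 0` and to `a 1`. -/
theorem integral_corner_dirDeriv (p : Poly) (a : Fin 4 → E3) :
    ∫ y in corner 3, ev (dirDeriv (a 1 - a 0) p) (par a y) =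
      (∫ z in corner 2, ev p (par ![a 1, a 2, a 3] z)) -
        ∫ z in corner 2, ev p (par ![a 0, a 2, a 3] z) := by
  have h := integral_corner_deriv (n := 2) (F := fun y => ev p (par a y))
    (F' := fun y => ev (dirDeriv (a 1 - a 0) p) (par a y))
    ((continuous_ev _).comp (continuous_par a)) (fun t z => ?_)
  · rw [h]
    have e1 : ∀ z : Fin 2 → ℝ, par a (Fin.cons (1 - ∑ i, z i) z) = par ![a 1, a 2, a 3] z := by
      intro z
      ext i
      rw [par_apply, par_apply]
      simp only [Fin.sum_univ_two, Fin.sum_univ_three]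
      change _ + ((1 - (z 0 + z 1)) * (a 1 i - a 0 i) + z 0 * (a 2 i - a 0 i) +
        z 1 * (a 3 i - a 0 i)) = a 1 i + (z 0 * (a 2 i - a 1 i) + z 1 * (a 3 i - a 1 i))
      ring
    have e2 : ∀ z : Fin 2 → ℝ, par a (Fin.cons 0 z) = par ![a 0, a 2, a 3] z := by
      intro z
      ext i
      rw [par_apply, par_apply]
      simp only [Fin.sum_univ_two, Fin.sum_univ_three]
      change _ + (0 * (a 1 i - a 0 i) + z 0 * (a 2 i - a 0 i) +
        z 1 * (a 3 i - a 0 i)) = a 0 i + (z 0 * (a 2 i - a 0 i) + z 1 * (a 3 i - a 0 i))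
      ring
    simp only [e1, e2]
    exact integral_sub (integrableOn_corner ((continuous_ev _).comp (continuous_par _)))
      (integrableOn_corner ((continuous_ev _).comp (continuous_par _)))
  · rw [ev_dirDeriv]
    refine hasDerivAt_ev p (x := fun t => par a (Fin.cons t z)) fun i => ?_
    have : ∀ s : ℝ, (par a (Fin.cons s z)) i = (par a (Fin.cons 0 z)) i + s * (a 1 - a 0) i := by
      intro s
      rw [par_apply, par_apply]
      simp only [Fin.sum_univ_three]
      change _ + (s * (a 1 i - a 0 i) + z 0 * (a 2 i - a 0 i) + z 1 * (a 3 i - a 0 i)) =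
        _ + (0 * (a 1 i - a 0 i) + z 0 * (a 2 i - a 0 i) + z 1 * (a 3 i - a 0 i)) +
          s * (a 1 i - a 0 i)
      ring
    rw [show (fun s => (par a (Fin.cons s z)) i) = _ from funext this]
    simpa using ((hasDerivAt_id t).mul_const ((a 1 - a 0) i)).const_add (par a (Fin.cons 0 z) i)

/-! ### Simplices given by finite sets of vertices -/

/-- `s` is the set of vertices of a nondegenerate simplex of dimension `n`. -/
structure IsSimplex (n : ℕ) (s : Finset E3) : Prop where
  card : s.card = n + 1
  indep : AffineIndependent ℝ (fun v : {v : E3 // v ∈ s} => (v : E3))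

lemma IsSimplex.erase {n : ℕ} {s : Finset E3} [DecidableEq E3] (hs : IsSimplex (n + 1) s) {v : E3}
    (hv : v ∈ s) : IsSimplex n (s.erase v) where
  card := by rw [Finset.card_erase_of_mem hv, hs.card]; rfl
  indep := hs.indep.comp_embedding
    ⟨fun w : {w // w ∈ s.erase v} => (⟨w.1, Finset.mem_of_mem_erase w.2⟩ : {w // w ∈ s}),
      fun a b h => Subtype.ext (congrArg (fun x => x.1) h)⟩

/-- `a` enumerates the vertices `s`. -/
structure Enumerates {n : ℕ} (a : Fin (n + 1) → E3) (s : Finset E3) : Prop where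
  inj : Function.Injective a
  range : Set.range a = (s : Set E3)

lemma Enumerates.mem {n : ℕ} {a : Fin (n + 1) → E3} {s : Finset E3} (h : Enumerates a s)
    (i : Fin (n + 1)) : a i ∈ s := by
  have : a i ∈ (s : Set E3) := h.range ▸ Set.mem_range_self i
  simpa using this

lemma Enumerates.affineIndependent {n : ℕ} {a : Fin (n + 1) → E3} {s : Finset E3}
    (h : Enumerates a s) (hs : IsSimplex n s) : AffineIndependent ℝ a :=
  hs.indep.comp_embedding ⟨fun i => (⟨a i, h.mem i⟩ : {w // w ∈ s}), fun i j hij => by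
    simpa [h.inj.eq_iff] using hij⟩

lemma Enumerates.convexHull {n : ℕ} {a : Fin (n + 1) → E3} {s : Finset E3}
    (h : Enumerates a s) : convexHull ℝ (Set.range a) = hull s := by
  rw [h.range, hull]

lemma Enumerates.image_univ {n : ℕ} {a : Fin (n + 1) → E3} {s : Finset E3} [DecidableEq E3]
    (h : Enumerates a s) : Finset.univ.image a = s := by
  ext x
  have : x ∈ Set.range a ↔ x ∈ s := by rw [h.range]; simp
  simpa using this

lemma Enumerates.sum {n : ℕ} {a : Fin (n + 1) → E3} {s : Finset E3} (h : Enumerates a s)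
    {β : Type*} [AddCommMonoid β] (f : E3 → β) : ∑ v ∈ s, f v = ∑ i, f (a i) := by
  classical
  rw [← h.image_univ, Finset.sum_image fun i _ j _ hij => h.inj hij]

lemma IsSimplex.exists_enumerates {n : ℕ} {s : Finset E3} (hs : IsSimplex n s) :
    ∃ a : Fin (n + 1) → E3, Enumerates a s := by
  have e := s.equivFinOfCardEq hs.card
  refine ⟨fun i => (e.symm i).1, fun i j hij => by simpa [Subtype.ext_iff.symm] using hij, ?_⟩
  ext x
  constructor
  · rintro ⟨i, rfl⟩
    exact (e.symm i).2
  · intro hx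
    exact ⟨e ⟨x, hx⟩, by simp⟩

theorem integral_hull {n : ℕ} {s : Finset E3} (hs : IsSimplex n s) {a : Fin (n + 1) → E3}
    (h : Enumerates a s) (f : E3 → ℝ) :
    ∫ x in hull s, f x ∂μHE[n] = jac a * ∫ y in corner n, f (par a y) := by
  rw [← h.convexHull, integral_convexHull (h.affineIndependent hs)]

lemma cellInt_eq {s : Finset E3} (hs : IsSimplex 3 s) {a : Fin 4 → E3}
    (h : Enumerates a s) (f : E3 → ℝ) :
    cellInt s f = jac a * ∫ y in corner 3, f (par a y) := by
  rw [cellInt, volume_eq_hausdorff, integral_hull hs h]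

lemma faceInt_eq {s : Finset E3} (hs : IsSimplex 2 s) {a : Fin 3 → E3}
    (h : Enumerates a s) (f : E3 → ℝ) :
    faceInt s f = jac a * ∫ y in corner 2, f (par a y) := by
  rw [faceInt, integral_hull hs h]

lemma measureReal_corner_pos (n : ℕ) : 0 < volume.real (corner n) := by
  rw [measureReal_def, ENNReal.toReal_pos_iff]
  refine ⟨?_, (isCompact_corner n).measure_lt_top⟩
  have hsub : (Set.univ.pi fun _ : Fin n => Set.Ioo (0 : ℝ) (1 / (n + 1))) ⊆ corner n := by
    intro y hy
    simp only [Set.mem_pi, Set.mem_univ, true_imp_iff, Set.mem_Ioo] at hy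
    refine ⟨fun i => (hy i).1.le, ?_⟩
    calc ∑ i, y i ≤ ∑ i : Fin n, (1 / ((n : ℝ) + 1)) := Finset.sum_le_sum fun i _ => (hy i).2.le
      _ = n / (n + 1) := by simp; ring
      _ ≤ 1 := by rw [div_le_one (by positivity)]; linarith
  refine lt_of_lt_of_le (IsOpen.measure_pos _ (isOpen_set_pi Set.finite_univ fun _ _ => isOpen_Ioo)
    ?_) (measure_mono hsub)
  exact Set.univ_pi_nonempty_iff.2 fun _ => Set.nonempty_Ioo.2 (by positivity)

/-- The volume factor does not depend on the enumeration of the vertices. -/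
lemma jac_eq_of_enumerates {n : ℕ} {s : Finset E3} (hs : IsSimplex n s) {a b : Fin (n + 1) → E3}
    (ha : Enumerates a s) (hb : Enumerates b s) : jac a = jac b := by
  -- Either factor, times the volume of the corner simplex, is the measure of the same hull.
  have h1 := integral_hull hs ha (fun _ => 1)
  have h2 := integral_hull hs hb (fun _ => 1)
  rw [h1] at h2
  simp only [integral_const, smul_eq_mul, mul_one, MeasurableSet.univ, measureReal_restrict_apply,
    Set.univ_inter] at h2
  exact mul_right_cancel₀ (measureReal_corner_pos n).ne' h2

/-! ### Barycentric coordinates of a tetrahedron -/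

/-- The affine polynomial `c + g · x`. -/
def affPoly (c : ℝ) (g : Vec) : Poly := MvPolynomial.C c + ∑ j, MvPolynomial.C (g j) * MvPolynomial.X j

lemma ev_affPoly (c : ℝ) (g : Vec) (x : E3) : ev (affPoly c g) x = c + ∑ j, g j * x j := by
  simp [affPoly, ev]

lemma pderiv_affPoly (c : ℝ) (g : Vec) (j : Fin 3) :
    MvPolynomial.pderiv j (affPoly c g) = MvPolynomial.C (g j) := by
  simp [affPoly, Pi.single_apply]

/-- `c` and `g` are the coefficients of the barycentric coordinates of the tetrahedron `s`. -/
structure IsBary (s : Finset E3) (c : E3 → ℝ) (g : E3 → Vec) : Prop where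
  sum_eq_one : ∀ x : E3, ∑ v ∈ s, ev (affPoly (c v) (g v)) x = 1
  sum_smul : ∀ x : E3, ∑ v ∈ s, ev (affPoly (c v) (g v)) x • v = x
  self : ∀ v ∈ s, ev (affPoly (c v) (g v)) v = 1
  other : ∀ v ∈ s, ∀ w ∈ s, w ≠ v → ev (affPoly (c v) (g v)) w = 0

/-- Four affinely independent points form an affine basis of the space. The coefficients are read
off from the coordinate functions at the origin and from their linear parts. -/
theorem exists_isBary {s : Finset E3} (hs : IsSimplex 3 s) : ∃ c g, IsBary s c g := by
  classical
  have hspan : affineSpan ℝ (Set.range fun v : {v : E3 // v ∈ s} => (v : E3)) = ⊤ := by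
    rw [hs.indep.affineSpan_eq_top_iff_card_eq_finrank_add_one]
    simp [hs.card]
  let b : AffineBasis {v : E3 // v ∈ s} ℝ E3 := ⟨fun v => (v : E3), hs.indep, hspan⟩
  let c : E3 → ℝ := fun v => if h : v ∈ s then b.coord ⟨v, h⟩ 0 else 0
  let g : E3 → Vec := fun v j => if h : v ∈ s then (b.coord ⟨v, h⟩).linear
    (EuclideanSpace.single j 1) else 0
  have key : ∀ (v : E3) (h : v ∈ s) (x : E3), ev (affPoly (c v) (g v)) x = b.coord ⟨v, h⟩ x := by
    intro v h x
    rw [ev_affPoly]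
    have h1 : b.coord ⟨v, h⟩ x = (b.coord ⟨v, h⟩).linear x + b.coord ⟨v, h⟩ 0 := by
      conv_lhs => rw [AffineMap.decomp (b.coord ⟨v, h⟩)]
      simp
    have h2 : x = ∑ j, x j • EuclideanSpace.single j (1 : ℝ) := by
      ext i
      simp [Finset.sum_apply, Pi.single_apply]
    rw [h1]
    conv_rhs => rw [h2]
    simp only [map_sum, map_smul, smul_eq_mul, c, g, h, dif_pos]
    rw [add_comm]
    congr 1
    exact Finset.sum_congr rfl fun j _ => mul_comm _ _
  refine ⟨c, g, ⟨fun x => ?_, fun x => ?_, fun v hv => ?_, fun v hv w hw hwv => ?_⟩⟩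
  · rw [← Finset.sum_attach, ← b.sum_coord_apply_eq_one x]
    exact Finset.sum_congr (by ext; simp) fun v _ => key v.1 v.2 x
  · rw [← Finset.sum_attach]
    conv_rhs => rw [← b.linear_combination_coord_eq_self x]
    exact Finset.sum_congr (by ext; simp) fun v _ => by rw [key v.1 v.2 x]; rfl
  · rw [key v hv]
    exact b.coord_apply_eq ⟨v, hv⟩
  · rw [key v hv]
    exact b.coord_apply_ne (i := ⟨v, hv⟩) (j := ⟨w, hw⟩) (by simpa using hwv.symm)

namespace IsBary

variable {s : Finset E3} {c : E3 → ℝ} {g : E3 → Vec}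

lemma dot_sub (c : ℝ) (g : Vec) (x y : E3) :
    g ⬝ᵥ (fun i => y i - x i) = ev (affPoly c g) y - ev (affPoly c g) x := by
  simp only [ev_affPoly, dotProduct, Fin.sum_univ_three]
  ring

/-- The derivative of the partition of unity, taken as the difference of its values at a unit vector
and at the origin. -/
lemma sum_grad (h : IsBary s c g) (j : Fin 3) : ∑ v ∈ s, g v j = 0 := by
  have h1 := h.sum_eq_one (EuclideanSpace.single j 1)
  have h2 := h.sum_eq_one 0
  simp only [ev_affPoly, Finset.sum_add_distrib] at h1 h2
  simp at h1 h2
  linarith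

/-- The derivative of the reproduction of `x`. Together with `sum_grad` it expands every unit vector
in the differences `v - u`, for any fixed vertex `u`; the divergence theorem rests on this. -/
lemma sum_grad_mul (h : IsBary s c g) (j i : Fin 3) :
    ∑ v ∈ s, g v j * v i = if i = j then 1 else 0 := by
  have h1 := congrArg (fun x : E3 => x i) (h.sum_smul (EuclideanSpace.single j 1))
  have h2 := congrArg (fun x : E3 => x i) (h.sum_smul 0)
  simp only [ev_affPoly] at h1 h2
  simp [Finset.sum_apply, add_mul, Finset.sum_add_distrib] at h1 h2
  rw [h2, zero_add] at h1
  exact h1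

lemma grad_ne_zero (h : IsBary s c g) {u v : E3} (hu : u ∈ s) (hv : v ∈ s) (huv : u ≠ v) :
    0 < sqLen (g u) := by
  have h1 := dot_sub (c u) (g u) v u
  rw [h.self u hu, h.other u hu v hv huv.symm] at h1
  have h2 : 0 ≤ sqLen (g u) := by
    simp only [sqLen, dotProduct, Fin.sum_univ_three]
    nlinarith [sq_nonneg (g u 0), sq_nonneg (g u 1), sq_nonneg (g u 2)]
  refine lt_of_le_of_ne h2 fun h3 => ?_
  have h4 : g u = 0 := dotProduct_self_eq_zero.1 h3.symm
  rw [h4] at h1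
  simp at h1

/-- A vector that is normal to a face is a multiple of the gradient of the opposite barycentric
coordinate. -/
lemma eq_smul_grad [DecidableEq E3] (h : IsBary s c g) {u v : E3} (hv : v ∈ s)
    {n : Vec} (hn : ∀ w ∈ s.erase v, n ⬝ᵥ (fun i => w i - u i) = 0) :
    n = (n ⬝ᵥ fun i => v i - u i) • g v := by
  funext j
  -- The matrix `∑ g w (w - u)ᵀ` is the identity. Applied to `n`, only the vertex off the face
  -- contributes.
  have h1 : n j = ∑ w ∈ s, g w j * (n ⬝ᵥ (fun i => w i - u i)) := by
    have e : ∀ w : E3, g w j * (n ⬝ᵥ (fun i => w i - u i)) =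
        (∑ i, n i * (g w j * w i)) - g w j * ∑ i, n i * u i := by
      intro w
      simp only [dotProduct, Fin.sum_univ_three]
      ring
    simp only [e, Finset.sum_sub_distrib]
    rw [Finset.sum_comm, ← Finset.sum_mul, h.sum_grad, zero_mul, sub_zero]
    simp only [← Finset.mul_sum, h.sum_grad_mul]
    simp
  rw [Finset.sum_eq_single_of_mem v hv fun w hw hwv => by
    rw [hn w (Finset.mem_erase.2 ⟨hwv, hw⟩), mul_zero]] at h1
  rw [Pi.smul_apply, smul_eq_mul, mul_comm, ← h1]

end IsBary

/-- The factors of a tetrahedron and of one of its faces. -/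
theorem jac_erase [DecidableEq E3] {s : Finset E3} (hs : IsSimplex 3 s) {c : E3 → ℝ} {g : E3 → Vec}
    (hb : IsBary s c g) {a : Fin 4 → E3} (ha : Enumerates a s) {v : E3} (hv : v ∈ s)
    {b : Fin 3 → E3} (hbe : Enumerates b (s.erase v)) :
    jac b = jac a * Real.sqrt (sqLen (g v)) := by
  -- The vertex `v` is put last so that `jac_face` applies; the factor does not depend on the order.
  have hd : Enumerates (Fin.snoc b v : Fin 4 → E3) s := by
    constructor
    · refine Fin.snoc_injective_iff.2 ⟨hbe.inj, ?_⟩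
      rw [hbe.range]
      simp
    · rw [Fin.range_snoc, hbe.range]
      simp [hv]
  have hmem := fun i => Finset.mem_of_mem_erase (hbe.mem i)
  have hne := fun i => Finset.ne_of_mem_erase (hbe.mem i)
  have h := jac_face (a := (Fin.snoc b v : Fin 4 → E3)) (g := g v) ?_ ?_ ?_
  · rw [jac_eq_of_enumerates hs ha hd, ← h]
    congr 1
    funext i
    simp
  · have := IsBary.dot_sub (c v) (g v) (b 0) (b 1)
    rw [hb.other v hv _ (hmem 0) (hne 0), hb.other v hv _ (hmem 1) (hne 1), sub_zero] at this
    exact this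
  · have := IsBary.dot_sub (c v) (g v) (b 0) (b 2)
    rw [hb.other v hv _ (hmem 0) (hne 0), hb.other v hv _ (hmem 2) (hne 2), sub_zero] at this
    exact this
  · have := IsBary.dot_sub (c v) (g v) (b 0) v
    rw [hb.other v hv _ (hmem 0) (hne 0), hb.self v hv, sub_zero] at this
    exact this

/-! ### Outer normals -/

/-- The coordinate of `v` falls from one at `v` to zero on the opposite face, so its negative
gradient points out of the tetrahedron. -/
lemma isOuterNormal_neg_grad [DecidableEq E3] {s : Finset E3} {c : E3 → ℝ} {g : E3 → Vec}
    (hs : IsSimplex 3 s) (hb : IsBary s c g) {v : E3} (hv : v ∈ s) :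
    IsOuterNormal s (s.erase v) (-(Real.sqrt (sqLen (g v)))⁻¹ • g v) := by
  have hcard : (s.erase v).card = 3 := (hs.erase hv).card
  obtain ⟨u, hu⟩ : (s.erase v).Nonempty := Finset.card_pos.1 (by omega)
  have hus := Finset.mem_of_mem_erase hu
  have huv := Finset.ne_of_mem_erase hu
  have hg : 0 < sqLen (g v) := hb.grad_ne_zero hv hus huv.symm
  have hsq := Real.sq_sqrt hg.le
  have hpos := Real.sqrt_pos.2 hg
  refine ⟨⟨?_, fun a ha b hb' => ?_⟩, fun a ha b hb' hbn => ?_⟩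
  · rw [sqLen, smul_dotProduct, dotProduct_smul, ← sqLen]
    simp only [smul_eq_mul]
    rw [← hsq]
    field_simp
    rw [Real.sqrt_sq hpos.le]
  · rw [smul_dotProduct, IsBary.dot_sub (c v),
      hb.other v hv _ (Finset.mem_of_mem_erase ha) (Finset.ne_of_mem_erase ha),
      hb.other v hv _ (Finset.mem_of_mem_erase hb') (Finset.ne_of_mem_erase hb')]
    simp
  · have : b = v := by
      by_contra hne
      exact hbn (Finset.mem_erase.2 ⟨hne, hb'⟩)
    subst this
    rw [smul_dotProduct, IsBary.dot_sub (c b),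
      hb.other b hv _ (Finset.mem_of_mem_erase ha) (Finset.ne_of_mem_erase ha), hb.self b hv]
    simp [hpos]
lemma isOuterNormal_outerNormal [DecidableEq E3] {s : Finset E3} (hs : IsSimplex 3 s) {v : E3}
    (hv : v ∈ s) : IsOuterNormal s (s.erase v) (outerNormal s (s.erase v)) := by
  obtain ⟨c, g, hb⟩ := exists_isBary hs
  exact Classical.epsilon_spec ⟨_, isOuterNormal_neg_grad hs hb hv⟩

/-- A choice by `Classical.epsilon` is only known through uniqueness: a normal vector is a multiple
of the gradient, unit length fixes the modulus of the factor, and the outward direction fixes its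
sign. -/
lemma outerNormal_eq [DecidableEq E3] {s : Finset E3} {c : E3 → ℝ} {g : E3 → Vec}
    (hs : IsSimplex 3 s) (hb : IsBary s c g) {v : E3} (hv : v ∈ s) :
    outerNormal s (s.erase v) = -(Real.sqrt (sqLen (g v)))⁻¹ • g v := by
  have hcard : (s.erase v).card = 3 := (hs.erase hv).card
  obtain ⟨u, hu⟩ : (s.erase v).Nonempty := Finset.card_pos.1 (by omega)
  have hus := Finset.mem_of_mem_erase hu
  have huv := Finset.ne_of_mem_erase hu
  have hg : 0 < sqLen (g v) := hb.grad_ne_zero hv hus huv.symm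
  have hsq := Real.sq_sqrt hg.le
  have hpos := Real.sqrt_pos.2 hg
  have hsp := isOuterNormal_outerNormal hs hv
  generalize outerNormal s (s.erase v) = n at *
  set m := n ⬝ᵥ (fun i => v i - u i) with hm
  have hmneg : m < 0 := hsp.2 u hu v hv (by simp)
  have hn : n = m • g v := hb.eq_smul_grad hv fun w hw => hsp.1.2 u hu w hw
  have hlen := hsp.1.1
  rw [hn, sqLen, smul_dotProduct, dotProduct_smul, ← sqLen] at hlen
  simp only [smul_eq_mul] at hlen
  have h3 : (-m * Real.sqrt (sqLen (g v))) = 1 := by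
    have h4 : (-m * Real.sqrt (sqLen (g v))) ^ 2 = 1 := by
      rw [mul_pow, hsq]; linarith
    have h5 : 0 < -m * Real.sqrt (sqLen (g v)) := mul_pos (by linarith) hpos
    nlinarith
  rw [hn]
  congr 1
  rw [← eq_neg_iff_add_eq_zero.2 (show m + (Real.sqrt (sqLen (g v)))⁻¹ = 0 by
    field_simp; linarith)]

/-! ### Integrability -/

lemma isCompact_hull (s : Finset E3) : IsCompact (hull s) :=
  s.finite_toSet.isCompact_convexHull (𝕜 := ℝ)

lemma measurableSet_hull (s : Finset E3) : MeasurableSet (hull s) :=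
  (isCompact_hull s).isClosed.measurableSet

/-- Finiteness gives integrability on faces. For triangles it also shows that they are null sets for
the volume. -/
lemma hausdorff_hull_lt_top {n : ℕ} {s : Finset E3} (hs : IsSimplex n s) :
    (μHE[n] : Measure E3) (hull s) < ⊤ := by
  obtain ⟨a, ha⟩ := hs.exists_enumerates
  rw [← ha.convexHull, convexHull_range_eq_image, measure_par_image]
  exact ENNReal.mul_lt_top ENNReal.ofReal_lt_top (isCompact_corner n).measure_lt_top

lemma integrableOn_hull {n : ℕ} {s : Finset E3} (hs : IsSimplex n s) {f : E3 → ℝ}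
    (hf : ContinuousOn f (hull s)) : IntegrableOn f (hull s) μHE[n] := by
  obtain ⟨C, hC⟩ := (isCompact_hull s).exists_bound_of_continuousOn hf
  refine IntegrableOn.of_bound (hausdorff_hull_lt_top hs)
    (hf.aestronglyMeasurable (measurableSet_hull s)) C ?_
  exact (ae_restrict_iff' (measurableSet_hull s)).2 (ae_of_all _ hC)

lemma integrableOn_cell (s : Finset E3) {f : E3 → ℝ} (hf : ContinuousOn f (hull s)) :
    IntegrableOn f (hull s) :=
  hf.integrableOn_compact (isCompact_hull s)

/-! ### The divergence theorem on a tetrahedron -/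

/-- The factor of a face is the volume factor times the length of the gradient of the opposite
coordinate; this is why inverse lengths appear when the reference faces are mapped back. -/
lemma cellInt_dirDeriv [DecidableEq E3] {s : Finset E3} (hs : IsSimplex 3 s) {c : E3 → ℝ}
    {g : E3 → Vec} (hb : IsBary s c g) (p : Poly) {u v : E3} (hu : u ∈ s) (hv : v ∈ s) :
    cellInt s (ev (dirDeriv (v - u) p)) =
      (Real.sqrt (sqLen (g u)))⁻¹ * faceInt (s.erase u) (ev p) -
        (Real.sqrt (sqLen (g v)))⁻¹ * faceInt (s.erase v) (ev p) := by
  rcases eq_or_ne u v with rfl | huv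
  · have : dirDeriv (u - u) p = 0 := by simp [dirDeriv]
    rw [this, sub_self]
    simp [cellInt, ev]
  have h2 : ((s.erase u).erase v).card = 2 := by
    rw [Finset.card_erase_of_mem (Finset.mem_erase.2 ⟨huv.symm, hv⟩), (hs.erase hu).card]
  obtain ⟨p1, p2, hp12, hp⟩ := Finset.card_eq_two.1 h2
  have hp1 : p1 ≠ v ∧ p1 ≠ u ∧ p1 ∈ s := by
    have : p1 ∈ (s.erase u).erase v := by rw [hp]; simp
    simpa [Finset.mem_erase] using this
  have hp2 : p2 ≠ v ∧ p2 ≠ u ∧ p2 ∈ s := by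
    have : p2 ∈ (s.erase u).erase v := by rw [hp]; simp
    simpa [Finset.mem_erase] using this
  have hall : ∀ x, x ∈ s ↔ x = u ∨ x = v ∨ x = p1 ∨ x = p2 := by
    intro x
    have : x ∈ (s.erase u).erase v ↔ x = p1 ∨ x = p2 := by rw [hp]; simp
    rw [Finset.mem_erase, Finset.mem_erase] at this
    constructor
    · intro hx
      by_cases h1 : x = u
      · exact Or.inl h1
      by_cases h2 : x = v
      · exact Or.inr (Or.inl h2)
      exact Or.inr (Or.inr (this.1 ⟨h2, h1, hx⟩))
    · rintro (rfl | rfl | rfl | rfl)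
      exacts [hu, hv, hp1.2.2, hp2.2.2]
  have hinj4 : Function.Injective ![u, v, p1, p2] := by
    intro i j hij
    fin_cases i <;> fin_cases j <;> simp_all
  have ha : Enumerates ![u, v, p1, p2] s := by
    refine ⟨hinj4, ?_⟩
    ext x
    simp [hall x, eq_comm]
    grind
  have hau : Enumerates ![v, p1, p2] (s.erase u) := by
    constructor
    · intro i j hij
      fin_cases i <;> fin_cases j <;> simp_all
    · ext x
      simp only [Set.mem_range, Fin.exists_fin_succ, Finset.coe_erase, Set.mem_sdiff,
        Finset.mem_coe, hall x, Set.mem_singleton_iff]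
      simp [eq_comm]
      grind
  have hav : Enumerates ![u, p1, p2] (s.erase v) := by
    constructor
    · intro i j hij
      fin_cases i <;> fin_cases j <;> simp_all
    · ext x
      simp only [Set.mem_range, Fin.exists_fin_succ, Finset.coe_erase, Set.mem_sdiff,
        Finset.mem_coe, hall x, Set.mem_singleton_iff]
      simp [eq_comm]
      grind
  have hgu := Real.sqrt_pos.2 (hb.grad_ne_zero hu hv huv)
  have hgv := Real.sqrt_pos.2 (hb.grad_ne_zero hv hu huv.symm)
  rw [cellInt_eq hs ha, faceInt_eq (hs.erase hu) hau, faceInt_eq (hs.erase hv) hav,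
    jac_erase hs hb ha hu hau, jac_erase hs hb ha hv hav]
  have h := integral_corner_dirDeriv p ![u, v, p1, p2]
  simp only [Matrix.cons_val_one, Matrix.cons_val_zero, Matrix.cons_val] at h
  rw [h]
  field_simp

theorem cellInt_pderiv [DecidableEq E3] {s : Finset E3} (hs : IsSimplex 3 s) (p : Poly)
    (j : Fin 3) :
    cellInt s (ev (MvPolynomial.pderiv j p)) =
      ∑ v ∈ s, outerNormal s (s.erase v) j * faceInt (s.erase v) (ev p) := by
  obtain ⟨c, g, hb⟩ := exists_isBary hs
  obtain ⟨u, hu⟩ : s.Nonempty := Finset.card_pos.1 (by rw [hs.card]; omega)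
  -- The `j`-th unit vector is `∑ g v j (v - u)`, so a partial derivative is a combination of
  -- derivatives along edges from `u`.
  have h1 : ev (MvPolynomial.pderiv j p) = fun x => ∑ v ∈ s, g v j * ev (dirDeriv (v - u) p) x := by
    funext x
    have e : ∀ v : E3, g v j * ev (dirDeriv (v - u) p) x =
        (∑ i, (g v j * v i) * ev (MvPolynomial.pderiv i p) x) -
          g v j * ∑ i, u i * ev (MvPolynomial.pderiv i p) x := by
      intro v
      simp only [ev_dirDeriv, Fin.sum_univ_three, PiLp.sub_apply]
      ring
    simp only [e, Finset.sum_sub_distrib]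
    rw [Finset.sum_comm, ← Finset.sum_mul, hb.sum_grad, zero_mul, sub_zero]
    simp only [← Finset.sum_mul, hb.sum_grad_mul]
    simp
  have h2 : cellInt s (ev (MvPolynomial.pderiv j p)) =
      ∑ v ∈ s, g v j * cellInt s (ev (dirDeriv (v - u) p)) := by
    rw [cellInt, h1, integral_finsetSum]
    · exact Finset.sum_congr rfl fun v _ => integral_const_mul _ _
    · exact fun v _ => integrableOn_cell s (by fun_prop)
  rw [h2]
  have h3 : ∀ v ∈ s, g v j * cellInt s (ev (dirDeriv (v - u) p)) =
      g v j * ((Real.sqrt (sqLen (g u)))⁻¹ * faceInt (s.erase u) (ev p)) +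
        outerNormal s (s.erase v) j * faceInt (s.erase v) (ev p) := by
    intro v hv
    rw [cellInt_dirDeriv hs hb p hu hv, outerNormal_eq hs hb hv]
    simp only [Pi.smul_apply, smul_eq_mul]
    ring
  -- The integrals over the face opposite to `u` enter with the total weight `∑ g v j = 0`.
  rw [Finset.sum_congr rfl h3, Finset.sum_add_distrib, ← Finset.sum_mul, hb.sum_grad, zero_mul,
    zero_add]

lemma dot_eq (v w : Vec) : v ⬝ᵥ w = v 0 * w 0 + v 1 * w 1 + v 2 * w 2 := by
  simp [dotProduct, Fin.sum_univ_three]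

/-- The divergence theorem. -/
theorem cellInt_divg [DecidableEq E3] {s : Finset E3} (hs : IsSimplex 3 s) (V : VPoly) :
    cellInt s (ev (divg V)) =
      ∑ v ∈ s, faceInt (s.erase v) (fun x => outerNormal s (s.erase v) ⬝ᵥ evV V x) := by
  have h1 : cellInt s (ev (divg V)) = ∑ j, cellInt s (ev (MvPolynomial.pderiv j (V j))) := by
    simp only [cellInt]
    rw [← integral_finsetSum]
    · simp only [divg, ev_sum]
    · exact fun j _ => integrableOn_cell s (by fun_prop)
  have h2 : ∀ v ∈ s, faceInt (s.erase v) (fun x => outerNormal s (s.erase v) ⬝ᵥ evV V x) =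
      ∑ j, outerNormal s (s.erase v) j * faceInt (s.erase v) (ev (V j)) := by
    intro v hv
    simp only [faceInt, dotProduct, evV]
    rw [integral_finsetSum]
    · exact Finset.sum_congr rfl fun j _ => integral_const_mul _ _
    · exact fun j _ => integrableOn_hull (hs.erase hv) (by fun_prop)
  rw [h1, Finset.sum_congr rfl h2, Finset.sum_comm]
  exact Finset.sum_congr rfl fun j _ => cellInt_pderiv hs (V j) j

/-! ### Equivalence of norms for homogeneous polynomials in barycentric coordinates -/

/-- The multi-indices of order `k` in `n + 1` variables. -/
abbrev multi (n k : ℕ) : Finset (Fin (n + 1) →₀ ℕ) := Finset.finsuppAntidiag Finset.univ k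

/-- The homogeneous polynomial with coefficients `d`, in barycentric coordinates. -/
def bary (n k : ℕ) (d : (Fin (n + 1) →₀ ℕ) → ℝ) (y : Fin n → ℝ) : ℝ :=
  ∑ β ∈ multi n k, d β * ∏ i, bc y i ^ β i

lemma continuous_bc {n : ℕ} (i : Fin (n + 1)) : Continuous fun y : Fin n → ℝ => bc y i := by
  refine Fin.cases ?_ (fun j => ?_) i
  · simp only [bc, Fin.cons_zero]; fun_prop
  · simp only [bc, Fin.cons_succ]; fun_prop

lemma continuous_prod_bc {n : ℕ} (β : Fin (n + 1) →₀ ℕ) :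
    Continuous fun y : Fin n → ℝ => ∏ i, bc y i ^ β i :=
  continuous_finsetProd _ fun i _ => (continuous_bc i).pow _

lemma continuous_bary (n k : ℕ) (d : (Fin (n + 1) →₀ ℕ) → ℝ) : Continuous (bary n k d) :=
  continuous_finsetSum _ fun β _ => continuous_const.mul (continuous_prod_bc β)

/-- The polynomial vanishes on the interior of the simplex. By homogeneity it then vanishes on the
whole open positive orthant, a product of infinite sets, and so all coefficients are zero. -/
lemma eq_zero_of_integral_bary_eq_zero {n k : ℕ} {d : (Fin (n + 1) →₀ ℕ) → ℝ}
    (h : ∫ y in corner n, bary n k d y ^ 2 = 0) : ∀ β ∈ multi n k, d β = 0 := by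
  set U : Set (Fin n → ℝ) := (⋂ i, {y | 0 < y i}) ∩ {y | ∑ i, y i < 1} with hU
  have hUo : IsOpen U :=
    (isOpen_iInter_of_finite fun i => isOpen_lt (by fun_prop) (by fun_prop)).inter
      (isOpen_lt (by fun_prop) (by fun_prop))
  have hUc : U ⊆ corner n := fun y hy => ⟨fun i => (Set.mem_iInter.1 hy.1 i).le, hy.2.le⟩
  have h1 : (fun y => bary n k d y ^ 2) =ᵐ[volume.restrict (corner n)] 0 :=
    (setIntegral_eq_zero_iff_of_nonneg_ae (ae_of_all _ fun y => sq_nonneg _)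
      (integrableOn_corner ((continuous_bary n k d).pow 2))).1 h
  have h2 : Set.EqOn (fun y => bary n k d y ^ 2) 0 U :=
    Measure.eqOn_open_of_ae_eq (ae_restrict_of_ae_restrict_of_subset hUc h1) hUo
      ((continuous_bary n k d).pow 2).continuousOn continuousOn_const
  have hQ : ∑ β ∈ multi n k, MvPolynomial.monomial β (d β) = (0 : MvPolynomial (Fin (n + 1)) ℝ) := by
    refine MvPolynomial.funext_set (fun _ => Set.Ioi (0 : ℝ)) (fun _ => Set.Ioi_infinite 0) ?_
    intro z hz
    have hz' : ∀ i, 0 < z i := fun i => hz i (Set.mem_univ i)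
    set S := ∑ i, z i with hS
    have hSpos : 0 < S := Finset.sum_pos (fun i _ => hz' i) Finset.univ_nonempty
    -- Dividing a positive vector by its sum gives the barycentric coordinates of an interior point;
    -- homogeneity restores the factor `S ^ k`.
    set y : Fin n → ℝ := fun i => z i.succ / S with hy
    have hsum : ∑ i, y i = 1 - z 0 / S := by
      rw [hy, ← Finset.sum_div, eq_sub_iff_add_eq, ← add_div, add_comm, ← Fin.sum_univ_succ,
        div_self hSpos.ne']
    have hbc : ∀ i, z i = S * bc y i := by
      intro i
      refine Fin.cases ?_ (fun j => ?_) i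
      · simp only [bc, Fin.cons_zero, hsum]; field_simp; ring
      · simp only [bc, Fin.cons_succ, hy]; field_simp
    have hyU : y ∈ U := by
      refine ⟨Set.mem_iInter.2 fun i => div_pos (hz' _) hSpos, ?_⟩
      change ∑ i, y i < 1
      rw [hsum]
      linarith [div_pos (hz' 0) hSpos]
    have h3 : bary n k d y = 0 := by simpa using h2 hyU
    rw [map_zero, map_sum]
    have h4 : ∀ β ∈ multi n k, MvPolynomial.eval z (MvPolynomial.monomial β (d β)) =
        S ^ k * (d β * ∏ i, bc y i ^ β i) := by
      intro β hβ
      rw [MvPolynomial.eval_monomial, Finsupp.prod_fintype _ _ (fun i => pow_zero _)]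
      rw [Finset.mem_finsuppAntidiag] at hβ
      rw [← hβ.1, ← Finset.prod_pow_eq_pow_sum]
      simp only [hbc, mul_pow, Finset.prod_mul_distrib]
      ring
    rw [Finset.sum_congr rfl h4, ← Finset.mul_sum]
    change S ^ k * bary n k d y = 0
    rw [h3, mul_zero]
  intro β hβ
  have := congrArg (MvPolynomial.coeff β) hQ
  simpa [MvPolynomial.coeff_sum, MvPolynomial.coeff_monomial, hβ] using this

/-- The integral is a positive definite quadratic form in finitely many coefficients, so it has a
positive minimum on the unit sphere. -/
theorem exists_sum_sq_le_integral_bary (n k : ℕ) : ∃ C : ℝ, 0 < C ∧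
    ∀ d : (Fin (n + 1) →₀ ℕ) → ℝ,
      ∑ β ∈ multi n k, d β ^ 2 ≤ C * ∫ y in corner n, bary n k d y ^ 2 := by
  classical
  let N : (multi n k → ℝ) → ℝ := fun x =>
    ∫ y in corner n, (∑ β : multi n k, x β * ∏ i, bc y i ^ β.1 i) ^ 2
  have hN : ∀ d, N (fun β => d β.1) = ∫ y in corner n, bary n k d y ^ 2 := by
    intro d
    simp only [N, bary]
    refine integral_congr_ae (ae_of_all _ fun y => ?_)
    exact congrArg (· ^ 2) (Finset.sum_coe_sort (multi n k) fun β => d β * ∏ i, bc y i ^ β i)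
  have hNc : Continuous N := by
    have : N = fun x => ∑ β : multi n k, ∑ γ : multi n k, x β * x γ *
        ∫ y in corner n, (∏ i, bc y i ^ β.1 i) * ∏ i, bc y i ^ γ.1 i := by
      funext x
      simp only [N, sq, Finset.sum_mul_sum]
      rw [integral_finsetSum]
      · refine Finset.sum_congr rfl fun β _ => ?_
        rw [integral_finsetSum]
        · refine Finset.sum_congr rfl fun γ _ => ?_
          rw [← integral_const_mul]
          refine integral_congr_ae (ae_of_all _ fun y => ?_)
          simp only
          ring
        · intro γ _
          exact integrableOn_corner ((continuous_const.mul (continuous_prod_bc _)).mul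
            (continuous_const.mul (continuous_prod_bc _)))
      · intro β _
        exact integrableOn_corner (continuous_finsetSum _ fun γ _ =>
          (continuous_const.mul (continuous_prod_bc _)).mul
            (continuous_const.mul (continuous_prod_bc _)))
    rw [this]
    fun_prop
  have hNs : ∀ (t : ℝ) x, N (t • x) = t ^ 2 * N x := by
    intro t x
    simp only [N]
    rw [← integral_const_mul]
    refine integral_congr_ae (ae_of_all _ fun y => ?_)
    simp only [Pi.smul_apply, smul_eq_mul, mul_assoc, ← Finset.mul_sum, mul_pow]
  have hNp : ∀ x, x ≠ 0 → 0 < N x := by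
    intro x hx
    have h0 : 0 ≤ N x := integral_nonneg fun y => sq_nonneg _
    refine lt_of_le_of_ne h0 fun h => hx ?_
    let d : (Fin (n + 1) →₀ ℕ) → ℝ := fun β => if h : β ∈ multi n k then x ⟨β, h⟩ else 0
    have hd : (fun β : multi n k => d β.1) = x := by
      funext β
      simp only [d]
      rw [dif_pos β.2]
    have := eq_zero_of_integral_bary_eq_zero (d := d) (by rw [← hN, hd, ← h])
    rw [← hd]
    funext β
    exact this β.1 β.2
  have hcard : ∀ x : multi n k → ℝ, ∑ β, x β ^ 2 ≤ (multi n k).card * ‖x‖ ^ 2 := by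
    intro x
    calc ∑ β, x β ^ 2 ≤ ∑ _β : multi n k, ‖x‖ ^ 2 := Finset.sum_le_sum fun β _ => by
          rw [← sq_abs]
          exact pow_le_pow_left₀ (abs_nonneg _) (norm_le_pi_norm x β) 2
      _ = _ := by simp
  obtain ⟨c, hc, hcN⟩ : ∃ c : ℝ, 0 < c ∧ ∀ x, c * ‖x‖ ^ 2 ≤ N x := by
    -- An empty sphere leaves only the zero vector, for which any constant works. This avoids
    -- showing that multi-indices exist.
    rcases (Metric.sphere (0 : multi n k → ℝ) 1).eq_empty_or_nonempty with he | hne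
    · refine ⟨1, one_pos, fun x => ?_⟩
      have : x = 0 := by
        by_contra hx
        have : ‖x‖⁻¹ • x ∈ Metric.sphere (0 : multi n k → ℝ) 1 := by
          simp [norm_smul, norm_ne_zero_iff.2 hx]
        rw [he] at this
        exact this
      subst this
      simpa using integral_nonneg fun y => sq_nonneg _
    · obtain ⟨x0, hx0, hmin⟩ := (isCompact_sphere (0 : multi n k → ℝ) 1).exists_isMinOn hne
        hNc.continuousOn
      have hx00 : x0 ≠ 0 := by
        rintro rfl
        simp at hx0
      refine ⟨N x0, hNp x0 hx00, fun x => ?_⟩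
      rcases eq_or_ne x 0 with rfl | hx
      · simpa using integral_nonneg fun y => sq_nonneg _
      have hxn := norm_pos_iff.2 hx
      have hm : ‖x‖⁻¹ • x ∈ Metric.sphere (0 : multi n k → ℝ) 1 := by
        simp [norm_smul, hxn.ne']
      have := isMinOn_iff.1 hmin _ hm
      rw [hNs] at this
      calc N x0 * ‖x‖ ^ 2 ≤ (‖x‖⁻¹ ^ 2 * N x) * ‖x‖ ^ 2 :=
            mul_le_mul_of_nonneg_right this (sq_nonneg _)
        _ = N x := by field_simp
  -- The summand one makes the constant positive without any knowledge of the cardinality.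
  refine ⟨((multi n k).card + 1) / c, by positivity, fun d => ?_⟩
  have h1 := hcard (fun β => d β.1)
  have h2 := hcN (fun β => d β.1)
  rw [hN] at h2
  rw [← Finset.sum_coe_sort (multi n k) fun β => d β ^ 2]
  refine h1.trans ?_
  rw [div_mul_eq_mul_div, le_div_iff₀ hc]
  nlinarith [sq_nonneg ‖fun β : multi n k => d β.1‖, (Nat.cast_nonneg (multi n k).card : (0:ℝ) ≤ _)]

/-! ### Bernstein coefficients -/

/-- The homogenization of order `k` of a polynomial with respect to the vertices `s`. -/
def bern (k : ℕ) (s : Finset E3) : Poly →ₗ[ℝ] MvPolynomial E3 ℝ :=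
  (MvPolynomial.basisMonomials (Fin 3) ℝ).constr ℝ fun m =>
    (∏ j, (∑ v ∈ s, MvPolynomial.C (v j) * MvPolynomial.X v) ^ m j) *
      (∑ v ∈ s, MvPolynomial.X v) ^ (k - ∑ j, m j)

lemma bern_monomial (k : ℕ) (s : Finset E3) (m : Fin 3 →₀ ℕ) :
    bern k s (MvPolynomial.monomial m 1) =
      (∏ j, (∑ v ∈ s, MvPolynomial.C (v j) * MvPolynomial.X v) ^ m j) *
      (∑ v ∈ s, MvPolynomial.X v) ^ (k - ∑ j, m j) := by
  have h := (MvPolynomial.basisMonomials (Fin 3) ℝ).constr_basis ℝ (fun m : Fin 3 →₀ ℕ =>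
    (∏ j, (∑ v ∈ s, MvPolynomial.C (v j) * MvPolynomial.X v : MvPolynomial E3 ℝ) ^ m j) *
      (∑ v ∈ s, MvPolynomial.X v) ^ (k - ∑ j, m j)) m
  rwa [MvPolynomial.coe_basisMonomials] at h

/-- When the weights sum to one, the homogenizing factor is one. The identity thus holds on all
monomials, even where the subtraction `k - ∑ j, m j` truncates, and extends by linearity. -/
lemma eval_bern (k : ℕ) (s : Finset E3) (p : Poly) (μ : E3 → ℝ) (hμ : ∑ v ∈ s, μ v = 1) :
    MvPolynomial.eval μ (bern k s p) = ev p (∑ v ∈ s, μ v • v) := by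
  have : (MvPolynomial.aeval μ : MvPolynomial E3 ℝ →ₐ[ℝ] ℝ).toLinearMap ∘ₗ bern k s =
      (MvPolynomial.aeval (fun i => (∑ v ∈ s, μ v • v : E3) i) : Poly →ₐ[ℝ] ℝ).toLinearMap := by
    refine (MvPolynomial.basisMonomials (Fin 3) ℝ).ext fun m => ?_
    simp only [MvPolynomial.coe_basisMonomials, LinearMap.comp_apply, bern_monomial,
      AlgHom.toLinearMap_apply, map_mul, map_prod, map_pow, map_sum, MvPolynomial.aeval_X, hμ,
      one_pow, mul_one, MvPolynomial.aeval_C, MvPolynomial.aeval_monomial, map_one, one_mul]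
    rw [Finsupp.prod_fintype _ _ (fun i => pow_zero _)]
    refine Finset.prod_congr rfl fun j _ => ?_
    simp [mul_comm]
  exact LinearMap.congr_fun this p

/-- The degree bound makes the subtraction in the exponent exact, so that every monomial is filled
up to order `k`. -/
lemma bern_isHomogeneous {k : ℕ} (s : Finset E3) {p : Poly} (hp : p ∈ polyDeg k) :
    (bern k s p).IsHomogeneous k := by
  rw [MvPolynomial.mem_restrictTotalDegree] at hp
  rw [← MvPolynomial.support_sum_monomial_coeff p, map_sum]
  refine MvPolynomial.IsHomogeneous.sum _ _ _ fun m hm => ?_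
  have hdeg : ∑ j, m j ≤ k := by
    have := (MvPolynomial.le_totalDegree hm).trans hp
    rwa [Finsupp.sum_fintype _ _ (fun _ => rfl)] at this
  rw [← mul_one (MvPolynomial.coeff m p), ← smul_eq_mul, ← MvPolynomial.smul_monomial, map_smul,
    bern_monomial, MvPolynomial.smul_eq_C_mul]
  have h1 : ∀ j, (∑ v ∈ s, MvPolynomial.C (v j) * MvPolynomial.X v : MvPolynomial E3 ℝ).IsHomogeneous 1 :=
    fun j => MvPolynomial.IsHomogeneous.sum _ _ _ fun v _ =>
      (MvPolynomial.isHomogeneous_X ℝ v).C_mul _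
  have h2 : (∑ v ∈ s, MvPolynomial.X v : MvPolynomial E3 ℝ).IsHomogeneous 1 :=
    MvPolynomial.IsHomogeneous.sum _ _ _ fun v _ => MvPolynomial.isHomogeneous_X ℝ v
  have h3 := (MvPolynomial.IsHomogeneous.prod Finset.univ (fun j =>
    (∑ v ∈ s, MvPolynomial.C (v j) * MvPolynomial.X v : MvPolynomial E3 ℝ) ^ m j) (fun j => 1 * m j)
    fun j _ => (h1 j).pow (m j)).mul (h2.pow (k - ∑ j, m j))
  have h4 : ∑ j, 1 * m j + 1 * (k - ∑ j, m j) = k := by simp only [one_mul]; omega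
  rw [h4] at h3
  exact h3.C_mul _

/-- The restriction to the variables in `t`. -/
def restrictVars (t : Finset E3) : MvPolynomial E3 ℝ →ₐ[ℝ] MvPolynomial E3 ℝ :=
  open scoped Classical in MvPolynomial.aeval fun v => if v ∈ t then MvPolynomial.X v else 0

/-- Setting the variables outside `t` to zero removes exactly the vertices outside `t` from the sums
in the homogenization. -/
lemma restrictVars_bern (k : ℕ) {s t : Finset E3} (hts : t ⊆ s) (p : Poly) :
    restrictVars t (bern k s p) = bern k t p := by
  classical
  have : (restrictVars t).toLinearMap ∘ₗ bern k s = bern k t := by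
    refine (MvPolynomial.basisMonomials (Fin 3) ℝ).ext fun m => ?_
    have hC : ∀ c : ℝ, restrictVars t (MvPolynomial.C c) = MvPolynomial.C c := fun c => by
      simp [restrictVars, MvPolynomial.algebraMap_eq]
    have hX : ∀ v, restrictVars t (MvPolynomial.X v) = if v ∈ t then MvPolynomial.X v else 0 :=
      fun v => by simp [restrictVars]
    simp only [MvPolynomial.coe_basisMonomials, LinearMap.comp_apply, bern_monomial,
      AlgHom.toLinearMap_apply, map_mul, map_prod, map_pow, map_sum, hC, hX]
    have e1 : ∑ v ∈ s, (if v ∈ t then MvPolynomial.X v else 0 : MvPolynomial E3 ℝ) =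
        ∑ v ∈ t, MvPolynomial.X v := by
      rw [← Finset.sum_filter, Finset.filter_mem_eq_inter, Finset.inter_eq_right.2 hts]
    have e2 : ∀ j, ∑ v ∈ s, MvPolynomial.C (v j) *
        (if v ∈ t then MvPolynomial.X v else 0 : MvPolynomial E3 ℝ) =
        ∑ v ∈ t, MvPolynomial.C (v j) * MvPolynomial.X v := by
      intro j
      simp only [mul_ite, mul_zero]
      rw [← Finset.sum_filter, Finset.filter_mem_eq_inter, Finset.inter_eq_right.2 hts]
    simp only [e1, e2]
  exact LinearMap.congr_fun this p

lemma coeff_restrictVars (t : Finset E3) (Q : MvPolynomial E3 ℝ) (α : E3 →₀ ℕ) :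
    (α.support ⊆ t → MvPolynomial.coeff α (restrictVars t Q) = MvPolynomial.coeff α Q) ∧
      (¬ α.support ⊆ t → MvPolynomial.coeff α (restrictVars t Q) = 0) := by
  classical
  induction Q using MvPolynomial.induction_on' with
  | add p q hp hq =>
    simp only [map_add, MvPolynomial.coeff_add]
    refine ⟨fun h => by rw [hp.1 h, hq.1 h], fun h => by rw [hp.2 h, hq.2 h, add_zero]⟩
  | monomial β c =>
    have hrest : restrictVars t (MvPolynomial.monomial β c) =
        if β.support ⊆ t then MvPolynomial.monomial β c else 0 := by
      rw [restrictVars, MvPolynomial.aeval_monomial]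
      split_ifs with h
      · rw [MvPolynomial.monomial_eq, MvPolynomial.algebraMap_eq]
        congr 1
        refine Finset.prod_congr rfl fun v hv => ?_
        simp only [if_pos (h hv)]
      · obtain ⟨v, hv, hvt⟩ := Finset.not_subset.1 h
        rw [Finsupp.prod, Finset.prod_eq_zero hv, mul_zero]
        rw [if_neg hvt, zero_pow (Finsupp.mem_support_iff.1 hv)]
    rw [hrest]
    split_ifs with h
    · refine ⟨fun _ => rfl, fun hα => ?_⟩
      rw [MvPolynomial.coeff_monomial, if_neg]
      rintro rfl
      exact hα h
    · refine ⟨fun hα => ?_, fun _ => by simp⟩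
      rw [MvPolynomial.coeff_monomial, if_neg, MvPolynomial.coeff_zero]
      rintro rfl
      exact h hα

/-- The Bernstein coefficient of a polynomial of degree at most `k`. It belongs to a multi-index in
vertices, and it is the same for all simplices with these vertices. -/
def bcoef (k : ℕ) (p : Poly) (α : E3 →₀ ℕ) : ℝ := MvPolynomial.coeff α (bern k α.support p)

/-- Restriction to the variables of the support keeps the coefficient. This makes coefficients
computed on different cells and faces comparable. -/
lemma bcoef_eq {k : ℕ} {s : Finset E3} {α : E3 →₀ ℕ} (h : α.support ⊆ s) (p : Poly) :
    MvPolynomial.coeff α (bern k s p) = bcoef k p α := by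
  rw [bcoef, ← restrictVars_bern k h, (coeff_restrictVars _ _ _).1 subset_rfl]

lemma bcoef_sub (k : ℕ) (p q : Poly) (α : E3 →₀ ℕ) :
    bcoef k (p - q) α = bcoef k p α - bcoef k q α := by
  simp [bcoef]

/-- The expansion of a polynomial in barycentric coordinates. -/
theorem ev_eq_sum_bcoef [DecidableEq E3] {k : ℕ} {p : Poly} (hp : p ∈ polyDeg k) {s : Finset E3}
    {μ : E3 → ℝ} (hμ : ∑ v ∈ s, μ v = 1) :
    ev p (∑ v ∈ s, μ v • v) =
      ∑ α ∈ s.finsuppAntidiag k, bcoef k p α * ∏ v ∈ s, μ v ^ α v := by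
  rw [← eval_bern k s p μ hμ, MvPolynomial.eval_eq]
  -- Only vertices of `s` occur because restriction to `s` changes nothing, and the order is `k` by
  -- homogeneity.
  have hsub : (bern k s p).support ⊆ s.finsuppAntidiag k := by
    intro α hα
    have hαs : α.support ⊆ s := by
      by_contra h
      rw [MvPolynomial.mem_support_iff, ← restrictVars_bern k subset_rfl,
        (coeff_restrictVars s _ α).2 h] at hα
      exact hα rfl
    rw [Finset.mem_finsuppAntidiag]
    refine ⟨?_, hαs⟩
    have := bern_isHomogeneous s hp (MvPolynomial.mem_support_iff.1 hα)
    rw [Finsupp.weight_apply, Finsupp.sum] at this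
    rw [← this]
    simp only [Pi.one_apply, smul_eq_mul, mul_one]
    exact (Finset.sum_subset hαs fun v _ hv => by simpa using hv).symm
  rw [Finset.sum_subset hsub]
  · refine Finset.sum_congr rfl fun α hα => ?_
    have hαs := (Finset.mem_finsuppAntidiag.1 hα).2
    rw [bcoef_eq hαs]
    congr 1
    exact Finset.prod_subset hαs fun v _ hv => by
      rw [Finsupp.notMem_support_iff.1 hv, pow_zero]
  · intro α _ hα
    rw [MvPolynomial.notMem_support_iff.1 hα, zero_mul]

/-! ### Lengths -/

lemma sqLen_nonneg (w : Vec) : 0 ≤ sqLen w := by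
  rw [sqLen, dot_eq]
  nlinarith [sq_nonneg (w 0), sq_nonneg (w 1), sq_nonneg (w 2)]

lemma dot_sq_le (v w : Vec) : (v ⬝ᵥ w) ^ 2 ≤ sqLen v * sqLen w := by
  simp only [sqLen, dot_eq]
  nlinarith [sq_nonneg (v 0 * w 1 - v 1 * w 0), sq_nonneg (v 0 * w 2 - v 2 * w 0),
    sq_nonneg (v 1 * w 2 - v 2 * w 1)]

lemma sqLen_sub_eq_dist_sq (x y : E3) : sqLen (fun i => y i - x i) = dist x y ^ 2 := by
  rw [EuclideanSpace.dist_eq, Real.sq_sqrt (Finset.sum_nonneg fun _ _ => sq_nonneg _), sqLen, dot_eq,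
    Fin.sum_univ_three]
  simp only [Real.dist_eq, sq_abs]
  ring

/-! ### The size of a simplex -/

lemma size_set_nonempty (s : Finset E3) :
    {d : ℝ | ∃ c : E3, hull s ⊆ Metric.closedBall c (d / 2)}.Nonempty := by
  obtain ⟨r, hr⟩ := (isCompact_hull s).isBounded.subset_closedBall (0 : E3)
  exact ⟨2 * r, 0, by simpa using hr⟩

lemma size_set_nonneg {s : Finset E3} (hs : s.Nonempty) {d : ℝ}
    (hd : ∃ c : E3, hull s ⊆ Metric.closedBall c (d / 2)) : 0 ≤ d := by
  obtain ⟨c, hc⟩ := hd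
  obtain ⟨v, hv⟩ := hs
  have := hc (subset_convexHull ℝ _ hv)
  have := dist_nonneg.trans (Metric.mem_closedBall.1 this)
  linarith

lemma size_le {s : Finset E3} (hs : s.Nonempty) {d : ℝ} {c : E3}
    (h : hull s ⊆ Metric.closedBall c (d / 2)) : size s ≤ d :=
  csInf_le ⟨0, fun _ he => size_set_nonneg hs he⟩ ⟨c, h⟩

/-- Both points are within half the diameter of the centre of any enclosing ball. -/
lemma dist_le_size {s : Finset E3} {x y : E3} (hx : x ∈ hull s) (hy : y ∈ hull s) :
    dist x y ≤ size s := by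
  refine le_csInf (size_set_nonempty s) ?_
  rintro d ⟨c, hc⟩
  have h1 := Metric.mem_closedBall.1 (hc hx)
  have h2 := Metric.mem_closedBall.1 (hc hy)
  linarith [dist_triangle_right x y c]

lemma mem_hull {s : Finset E3} {v : E3} (hv : v ∈ s) : v ∈ hull s :=
  subset_convexHull ℝ _ hv

lemma hull_mono {s t : Finset E3} (h : t ⊆ s) : hull t ⊆ hull s :=
  convexHull_mono (by exact_mod_cast h)

lemma size_mono {s t : Finset E3} (ht : t.Nonempty) (h : t ⊆ s) : size t ≤ size s := by
  refine le_csInf (size_set_nonempty s) ?_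
  rintro d ⟨c, hc⟩
  exact size_le ht ((hull_mono h).trans hc)

lemma hull_subset_closedBall {s : Finset E3} {x : E3} (hx : x ∈ hull s) :
    hull s ⊆ Metric.closedBall x (size s) := fun _ hy => Metric.mem_closedBall.2 (dist_le_size hy hx)

lemma IsSimplex.nonempty {n : ℕ} {s : Finset E3} (hs : IsSimplex n s) : s.Nonempty :=
  Finset.card_pos.1 (by rw [hs.card]; omega)

lemma IsSimplex.exists_ne {n : ℕ} {s : Finset E3} (hs : IsSimplex (n + 1) s) (v : E3) :
    ∃ u ∈ s, u ≠ v :=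
  Finset.exists_mem_ne (by rw [hs.card]; omega) v

lemma IsSimplex.size_pos {n : ℕ} {s : Finset E3} (hs : IsSimplex (n + 1) s) : 0 < size s := by
  obtain ⟨v, hv⟩ := hs.nonempty
  obtain ⟨u, hu, huv⟩ := hs.exists_ne v
  exact (dist_pos.2 huv).trans_le (dist_le_size (mem_hull hu) (mem_hull hv))

/-! ### Barycentric coordinates on the simplex -/

lemma mem_hull_iff {s : Finset E3} {x : E3} : x ∈ hull s ↔
    ∃ μ : E3 → ℝ, (∀ v ∈ s, 0 ≤ μ v) ∧ ∑ v ∈ s, μ v = 1 ∧ ∑ v ∈ s, μ v • v = x :=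
  Finset.mem_convexHull'

lemma ev_affPoly_sum (c : ℝ) (g : Vec) {s : Finset E3} {μ : E3 → ℝ} (hμ : ∑ v ∈ s, μ v = 1) :
    ev (affPoly c g) (∑ v ∈ s, μ v • v) = ∑ v ∈ s, μ v * ev (affPoly c g) v := by
  simp only [ev_affPoly, mul_add, Finset.sum_add_distrib, ← Finset.sum_mul, hμ, one_mul,
    Finset.mul_sum]
  congr 1
  rw [Finset.sum_comm]
  refine Finset.sum_congr rfl fun j _ => ?_
  simp only [WithLp.ofLp_sum, WithLp.ofLp_smul, Finset.sum_apply, Pi.smul_apply, smul_eq_mul,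
    Finset.mul_sum]
  exact Finset.sum_congr rfl fun v _ => by ring

namespace IsBary

variable {s : Finset E3} {c : E3 → ℝ} {g : E3 → Vec}

lemma ev_sum (h : IsBary s c g) {μ : E3 → ℝ} (hμ : ∑ v ∈ s, μ v = 1) {v : E3} (hv : v ∈ s) :
    ev (affPoly (c v) (g v)) (∑ w ∈ s, μ w • w) = μ v := by
  rw [ev_affPoly_sum _ _ hμ, Finset.sum_eq_single_of_mem v hv, h.self v hv, mul_one]
  intro w hw hwv
  rw [h.other v hv w hw hwv, mul_zero]

lemma mem_Icc (h : IsBary s c g) {x : E3} (hx : x ∈ hull s) {v : E3} (hv : v ∈ s) :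
    ev (affPoly (c v) (g v)) x ∈ Set.Icc (0 : ℝ) 1 := by
  obtain ⟨μ, h0, h1, rfl⟩ := mem_hull_iff.1 hx
  rw [h.ev_sum h1 hv]
  refine ⟨h0 v hv, ?_⟩
  rw [← h1]
  exact Finset.single_le_sum h0 hv

/-- The coordinate of `v` rises from zero to one along the edge; Cauchy–Schwarz bounds the rise by
slope times length. -/
lemma one_le_grad_mul_dist (h : IsBary s c g) {u v : E3} (hu : u ∈ s) (hv : v ∈ s) (huv : u ≠ v) :
    1 ≤ sqLen (g v) * dist u v ^ 2 := by
  have h1 := dot_sub (c v) (g v) u v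
  rw [h.self v hv, h.other v hv u hu huv, sub_zero] at h1
  have h2 := dot_sq_le (g v) (fun i => v i - u i)
  rwa [h1, sqLen_sub_eq_dist_sq, one_pow] at h2

/-- The coordinate stays between zero and one on the ball, yet along the diameter in the direction
of its gradient it changes by `2 r |g v|`. -/
lemma grad_le (h : IsBary s c g) {v : E3} (hv : v ∈ s) {x : E3} {r : ℝ} (hr : 0 ≤ r)
    (hb : Metric.closedBall x r ⊆ hull s) : 4 * r ^ 2 * sqLen (g v) ≤ 1 := by
  rcases eq_or_lt_of_le (sqLen_nonneg (g v)) with h0 | hpos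
  · rw [← h0]; simp
  set l := Real.sqrt (sqLen (g v)) with hl
  have hlpos : 0 < l := Real.sqrt_pos.2 hpos
  have hlsq : l ^ 2 = sqLen (g v) := Real.sq_sqrt hpos.le
  have hmem : ∀ ε : ℝ, |ε| ≤ r / l → x + ε • (WithLp.toLp 2 (g v) : E3) ∈ hull s := by
    intro ε hε
    refine hb ?_
    rw [Metric.mem_closedBall, dist_eq_norm, add_sub_cancel_left, norm_smul, Real.norm_eq_abs]
    have : ‖(WithLp.toLp 2 (g v) : E3)‖ = l := by
      rw [EuclideanSpace.norm_eq, hl, sqLen, dot_eq, Fin.sum_univ_three]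
      simp only [Real.norm_eq_abs, sq_abs]
      simp only [sq]
    rw [this]
    calc |ε| * l ≤ r / l * l := mul_le_mul_of_nonneg_right hε hlpos.le
      _ = r := by field_simp
  have hrl : 0 ≤ r / l := by positivity
  have h1 := (h.mem_Icc (hmem (r / l) (by rw [abs_of_nonneg hrl])) hv).2
  have h2 := (h.mem_Icc (hmem (-(r / l)) (by rw [abs_neg, abs_of_nonneg hrl])) hv).1
  have h3 : ∀ ε : ℝ, ev (affPoly (c v) (g v)) (x + ε • (WithLp.toLp 2 (g v) : E3)) =
      ev (affPoly (c v) (g v)) x + ε * sqLen (g v) := by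
    intro ε
    simp only [ev_affPoly, sqLen, dot_eq, Fin.sum_univ_three, PiLp.add_apply, PiLp.smul_apply,
      smul_eq_mul]
    ring
  rw [h3] at h1 h2
  have h4 : 2 * (r / l * sqLen (g v)) ≤ 1 := by linarith
  have h5 : r / l * sqLen (g v) = r * l := by rw [← hlsq]; field_simp
  rw [h5] at h4
  rw [← hlsq]
  have h6 : 0 ≤ r * l := by positivity
  nlinarith

end IsBary

/-! ### Shape regular tetrahedra -/

/-- A nondegenerate tetrahedron that contains a ball of radius `size s / κ`. -/
structure IsRegular (κ : ℝ) (s : Finset E3) : Prop extends IsSimplex 3 s where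
  ball : ∃ c : E3, Metric.closedBall c (size s / κ) ⊆ hull s

namespace IsRegular

variable {κ : ℝ} {s : Finset E3}

lemma grad_le (hκ : 0 < κ) (hs : IsRegular κ s) {c : E3 → ℝ} {g : E3 → Vec} (hb : IsBary s c g)
    {v : E3} (hv : v ∈ s) : 4 * size s ^ 2 * sqLen (g v) ≤ κ ^ 2 := by
  obtain ⟨x, hx⟩ := hs.ball
  have h1 := hb.grad_le hv (div_nonneg hs.size_pos.le hκ.le) hx
  rw [div_pow] at h1
  have h2 : 4 * (size s ^ 2 / κ ^ 2) * sqLen (g v) = 4 * size s ^ 2 * sqLen (g v) / κ ^ 2 := by ring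
  rw [h2, div_le_one (by positivity)] at h1
  exact h1

/-- Gradients are bounded above by the inscribed ball and below by the reciprocal edge length. Hence
every edge, not only the longest, is comparable with the size. -/
lemma size_le_dist (hκ : 0 < κ) (hs : IsRegular κ s) {u v : E3} (hu : u ∈ s) (hv : v ∈ s)
    (huv : u ≠ v) : 2 * size s ≤ κ * dist u v := by
  obtain ⟨c, g, hb⟩ := exists_isBary hs.toIsSimplex
  have h1 := hs.grad_le hκ hb hv
  have h2 := hb.one_le_grad_mul_dist hu hv huv
  have h3 : (2 * size s) ^ 2 ≤ (κ * dist u v) ^ 2 := by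
    calc (2 * size s) ^ 2 ≤ (2 * size s) ^ 2 * (sqLen (g v) * dist u v ^ 2) :=
          le_mul_of_one_le_right (sq_nonneg _) h2
      _ = (4 * size s ^ 2 * sqLen (g v)) * dist u v ^ 2 := by ring
      _ ≤ κ ^ 2 * dist u v ^ 2 := mul_le_mul_of_nonneg_right h1 (sq_nonneg _)
      _ = _ := by ring
  exact le_of_sq_le_sq h3 (by positivity)

/-- The size of a tetrahedron is bounded by the size of any simplex that shares an edge. -/
lemma size_le_size (hκ : 0 < κ) (hs : IsRegular κ s) {u v : E3} (hu : u ∈ s) (hv : v ∈ s)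
    (huv : u ≠ v) {t : Finset E3} (hut : u ∈ t) (hvt : v ∈ t) : 2 * size s ≤ κ * size t :=
  (hs.size_le_dist hκ hu hv huv).trans
    (mul_le_mul_of_nonneg_left (dist_le_size (mem_hull hut) (mem_hull hvt)) hκ.le)

end IsRegular

/-- The volume of the unit ball. -/
def ballVol : ℝ := volume.real (Metric.ball (0 : E3) 1)

lemma ballVol_pos : 0 < ballVol :=
  ENNReal.toReal_pos (Metric.measure_ball_pos _ _ one_pos).ne' measure_ball_lt_top.ne

lemma volume_closedBall (x : E3) {r : ℝ} (hr : 0 ≤ r) :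
    volume.real (Metric.closedBall x r) = r ^ 3 * ballVol := by
  rw [measureReal_def, Measure.addHaar_closedBall volume x hr, ENNReal.toReal_mul,
    ENNReal.toReal_ofReal (by positivity), ballVol, measureReal_def]
  simp

lemma volume_hull_le {s : Finset E3} (hs : s.Nonempty) :
    volume.real (hull s) ≤ size s ^ 3 * ballVol := by
  obtain ⟨v, hv⟩ := hs
  have h0 : 0 ≤ size s := dist_nonneg.trans (dist_le_size (mem_hull hv) (mem_hull hv))
  rw [← volume_closedBall v h0]
  exact measureReal_mono (hull_subset_closedBall (mem_hull hv)) measure_closedBall_lt_top.ne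

lemma IsRegular.volume_hull_ge {κ : ℝ} {s : Finset E3} (hκ : 0 < κ) (hs : IsRegular κ s) :
    (size s / κ) ^ 3 * ballVol ≤ volume.real (hull s) := by
  obtain ⟨x, hx⟩ := hs.ball
  rw [← volume_closedBall x (div_nonneg hs.size_pos.le hκ.le)]
  exact measureReal_mono hx (isCompact_hull s).measure_lt_top.ne

lemma volume_hull_eq {s : Finset E3} (hs : IsSimplex 3 s) {a : Fin 4 → E3} (ha : Enumerates a s) :
    volume.real (hull s) = jac a * volume.real (corner 3) := by
  have := cellInt_eq hs ha (fun _ => 1)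
  simpa [cellInt] using this

/-! ### Norms and Bernstein coefficients -/

/-- An enumeration of the vertices transports multi-indices, so that estimates on the reference
simplex apply to coefficients attached to vertices. -/
lemma sum_finsuppAntidiag [DecidableEq E3] {n : ℕ} {s : Finset E3} {a : Fin (n + 1) → E3}
    (ha : Enumerates a s) (k : ℕ) {β : Type*} [AddCommMonoid β] (f : (E3 →₀ ℕ) → β) :
    ∑ α ∈ s.finsuppAntidiag k, f α = ∑ β ∈ multi n k, f (β.mapDomain a) := by
  symm
  refine Finset.sum_bij (fun β _ => β.mapDomain a) (fun β hβ => ?_) (fun β _ γ _ h => ?_)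
    (fun α hα => ?_) (fun _ _ => rfl)
  · rw [Finset.mem_finsuppAntidiag] at hβ ⊢
    refine ⟨?_, fun v hv => ?_⟩
    · rw [ha.sum, ← hβ.1]
      exact Finset.sum_congr rfl fun i _ => Finsupp.mapDomain_apply ha.inj _ _
    · have := Finsupp.mapDomain_support hv
      obtain ⟨i, _, rfl⟩ := Finset.mem_image.1 this
      exact ha.mem i
  · exact Finsupp.mapDomain_injective ha.inj h
  · rw [Finset.mem_finsuppAntidiag] at hα
    have hr : (α.support : Set E3) ⊆ Set.range a := by
      rw [ha.range]; exact_mod_cast hα.2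
    refine ⟨α.comapDomain a ha.inj.injOn, ?_, Finsupp.mapDomain_comapDomain a ha.inj α hr⟩
    rw [Finset.mem_finsuppAntidiag]
    refine ⟨?_, Finset.subset_univ _⟩
    rw [← hα.1, ha.sum]
    rfl

lemma ev_par [DecidableEq E3] {n k : ℕ} {s : Finset E3} {a : Fin (n + 1) → E3}
    (ha : Enumerates a s) {p : Poly} (hp : p ∈ polyDeg k) (y : Fin n → ℝ) :
    ev p (par a y) = bary n k (fun β => bcoef k p (β.mapDomain a)) y := by
  set μ : E3 → ℝ := Function.extend a (bc y) 0 with hμ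
  have hμa : ∀ i, μ (a i) = bc y i := fun i => ha.inj.extend_apply _ _ _
  have h1 : ∑ v ∈ s, μ v = 1 := by
    rw [ha.sum]
    simp only [hμa, sum_bc]
  have h2 : ∑ v ∈ s, μ v • v = par a y := by
    rw [ha.sum (fun v => μ v • v)]
    simp only [hμa, par]
  rw [← h2, ev_eq_sum_bcoef hp h1, sum_finsuppAntidiag ha, bary]
  refine Finset.sum_congr rfl fun β _ => ?_
  congr 1
  rw [← ha.image_univ, Finset.prod_image fun i _ j _ hij => ha.inj hij]
  exact Finset.prod_congr rfl fun i _ => by rw [hμa, Finsupp.mapDomain_apply ha.inj]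

/-- The sum of the squares of the Bernstein coefficients on a simplex. -/
def coefSq (k : ℕ) (s : Finset E3) (p : Poly) : ℝ :=
  ∑ α ∈ s.finsuppAntidiag k, bcoef k p α ^ 2

lemma coefSq_nonneg (k : ℕ) (s : Finset E3) (p : Poly) : 0 ≤ coefSq k s p :=
  Finset.sum_nonneg fun _ _ => sq_nonneg _

/-- The norm equivalence pulled back by the parametrization; the constant does not depend on the
shape of the simplex. -/
lemma exists_coefSq_le (n k : ℕ) : ∃ C : ℝ, 0 < C ∧ ∀ (s : Finset E3) (a : Fin (n + 1) → E3),
    Enumerates a s → ∀ p ∈ polyDeg k,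
      coefSq k s p ≤ C * ∫ y in corner n, ev p (par a y) ^ 2 := by
  classical
  obtain ⟨C, hC, h⟩ := exists_sum_sq_le_integral_bary n k
  refine ⟨C, hC, fun s a ha p hp => ?_⟩
  simp only [ev_par ha hp]
  convert h _
  rw [coefSq, ← sum_finsuppAntidiag ha k (fun α => bcoef k p α ^ 2)]

lemma card_finsuppAntidiag_eq [DecidableEq E3] {n : ℕ} (k : ℕ) {s : Finset E3}
    (hs : IsSimplex n s) : (s.finsuppAntidiag k).card = (multi n k).card := by
  obtain ⟨a, ha⟩ := hs.exists_enumerates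
  have := sum_finsuppAntidiag ha k (fun _ => 1)
  simpa using this

/-- Products of barycentric coordinates are at most one, and the rest is Cauchy–Schwarz over the
multi-indices. -/
lemma ev_sq_le {n k : ℕ} {s : Finset E3} (hs : IsSimplex n s) {p : Poly} (hp : p ∈ polyDeg k)
    {x : E3} (hx : x ∈ hull s) : ev p x ^ 2 ≤ (multi n k).card * coefSq k s p := by
  classical
  obtain ⟨μ, h0, h1, rfl⟩ := mem_hull_iff.1 hx
  rw [ev_eq_sum_bcoef hp h1, ← card_finsuppAntidiag_eq k hs]
  refine sq_sum_le_card_mul_sum_sq.trans ?_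
  rw [coefSq]
  refine mul_le_mul_of_nonneg_left ?_ (Nat.cast_nonneg _)
  have hle : ∀ v ∈ s, μ v ≤ 1 := fun v hv => by
    rw [← h1]
    exact Finset.single_le_sum h0 hv
  have hsum : coefSq k s p = ∑ α ∈ s.finsuppAntidiag k, bcoef k p α ^ 2 := by
    rw [coefSq]
  rw [← coefSq, hsum]
  refine Finset.sum_le_sum fun α _ => ?_
  rw [mul_pow]
  refine mul_le_of_le_one_right (sq_nonneg _) (pow_le_one₀ (Finset.prod_nonneg fun v hv =>
    pow_nonneg (h0 v hv) _) (Finset.prod_le_one (fun v hv => pow_nonneg (h0 v hv) _)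
      fun v hv => pow_le_one₀ (h0 v hv) (hle v hv)))

/-! ### Derivatives of polynomials in Bernstein form. -/

/-- A polynomial that is bounded by one, with a derivative bounded by `D`. -/
def DerivBound (s : Finset E3) (j : Fin 3) (D : ℝ) (p : Poly) : Prop :=
  ∀ x ∈ hull s, |ev p x| ≤ 1 ∧ |ev (MvPolynomial.pderiv j p) x| ≤ D

lemma DerivBound.one (s : Finset E3) (j : Fin 3) : DerivBound s j 0 1 := fun x _ => by
  simp [ev]

lemma DerivBound.mul {s : Finset E3} {j : Fin 3} {D E : ℝ} {p q : Poly} (hp : DerivBound s j D p)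
    (hq : DerivBound s j E q) : DerivBound s j (D + E) (p * q) := fun x hx => by
  obtain ⟨h1, h2⟩ := hp x hx
  obtain ⟨h3, h4⟩ := hq x hx
  constructor
  · rw [ev_mul, abs_mul]
    exact mul_le_one₀ h1 (abs_nonneg _) h3
  · rw [MvPolynomial.pderiv_mul, ev_add, ev_mul, ev_mul]
    refine (abs_add_le _ _).trans ?_
    rw [abs_mul, abs_mul]
    nlinarith [abs_nonneg (ev p x), abs_nonneg (ev q x), abs_nonneg (ev (MvPolynomial.pderiv j p) x),
      abs_nonneg (ev (MvPolynomial.pderiv j q) x)]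

lemma DerivBound.pow {s : Finset E3} {j : Fin 3} {D : ℝ} {p : Poly} (hp : DerivBound s j D p)
    (m : ℕ) : DerivBound s j (m * D) (p ^ m) := by
  induction m with
  | zero => simpa using DerivBound.one s j
  | succ m ih =>
    rw [pow_succ]
    convert ih.mul hp using 1
    push_cast
    ring

lemma DerivBound.prod {s : Finset E3} {j : Fin 3} {ι : Type*} (t : Finset ι) {D : ι → ℝ}
    {p : ι → Poly} (hp : ∀ i ∈ t, DerivBound s j (D i) (p i)) :
    DerivBound s j (∑ i ∈ t, D i) (∏ i ∈ t, p i) := by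
  classical
  induction t using Finset.induction_on with
  | empty => simpa using DerivBound.one s j
  | insert i t hi ih =>
    rw [Finset.sum_insert hi, Finset.prod_insert hi]
    exact (hp i (Finset.mem_insert_self _ _)).mul
      (ih fun i' hi' => hp i' (Finset.mem_insert_of_mem hi'))

/-- The polynomial with Bernstein coefficients `d` on a tetrahedron. -/
def bernPoly (k : ℕ) (s : Finset E3) (c : E3 → ℝ) (g : E3 → Vec) (d : (E3 →₀ ℕ) → ℝ) : Poly :=
  ∑ α ∈ s.finsuppAntidiag k, d α • ∏ v ∈ s, affPoly (c v) (g v) ^ α v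

/-- By shape regularity each coordinate has derivatives at most `κ / h`. A product of `k`
coordinates, all at most one, then has derivatives at most `k κ / h` by the product rule. -/
lemma ev_pderiv_bernPoly_sq_le {κ : ℝ} (hκ : 0 < κ) (k : ℕ) {s : Finset E3} (hs : IsRegular κ s)
    {c : E3 → ℝ} {g : E3 → Vec} (hb : IsBary s c g) (d : (E3 →₀ ℕ) → ℝ) (j : Fin 3) {x : E3}
    (hx : x ∈ hull s) :
    size s ^ 2 * ev (MvPolynomial.pderiv j (bernPoly k s c g d)) x ^ 2 ≤
      (k * κ) ^ 2 * (multi 3 k).card * ∑ α ∈ s.finsuppAntidiag k, d α ^ 2 := by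
  set D := κ / size s with hD
  have hsz := hs.size_pos
  have hDpos : 0 < D := div_pos hκ hsz
  have h1 : ∀ v ∈ s, DerivBound s j D (affPoly (c v) (g v)) := by
    intro v hv x hx
    have h := hb.mem_Icc hx hv
    refine ⟨abs_le.2 ⟨by linarith [h.1], h.2⟩, ?_⟩
    rw [pderiv_affPoly, ev_C]
    refine abs_le_of_sq_le_sq ?_ hDpos.le
    have h2 := hs.grad_le hκ hb hv
    rw [hD, div_pow, le_div_iff₀ (by positivity)]
    have h3 : g v j ^ 2 ≤ sqLen (g v) := by
      rw [sqLen, dot_eq]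
      fin_cases j <;> simp <;> nlinarith [sq_nonneg (g v 0), sq_nonneg (g v 1), sq_nonneg (g v 2)]
    have h4 := mul_le_mul_of_nonneg_right h3 (sq_nonneg (size s))
    have h5 := mul_nonneg (sqLen_nonneg (g v)) (sq_nonneg (size s))
    linarith
  have h2 : ∀ α ∈ s.finsuppAntidiag k,
      |ev (MvPolynomial.pderiv j (∏ v ∈ s, affPoly (c v) (g v) ^ α v)) x| ≤ k * D := by
    intro α hα
    have := (DerivBound.prod s fun v hv => (h1 v hv).pow (α v)) x hx
    refine this.2.trans_eq ?_
    rw [← Finset.sum_mul, ← (Finset.mem_finsuppAntidiag.1 hα).1]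
    push_cast
    rfl
  have h3 : |ev (MvPolynomial.pderiv j (bernPoly k s c g d)) x| ≤
      ∑ α ∈ s.finsuppAntidiag k, |d α| * (k * D) := by
    conv_lhs => rw [bernPoly, map_sum, ev_sum]
    refine (Finset.abs_sum_le_sum_abs _ _).trans (Finset.sum_le_sum fun α hα => ?_)
    rw [Derivation.map_smul, ev_smul, abs_mul]
    exact mul_le_mul_of_nonneg_left (h2 α hα) (abs_nonneg _)
  rw [← Finset.sum_mul] at h3
  have h4 : ev (MvPolynomial.pderiv j (bernPoly k s c g d)) x ^ 2 ≤
      ((∑ α ∈ s.finsuppAntidiag k, |d α|) * (k * D)) ^ 2 := by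
    rw [← sq_abs (ev _ x)]
    exact pow_le_pow_left₀ (abs_nonneg _) h3 2
  have h5 : (∑ α ∈ s.finsuppAntidiag k, |d α|) ^ 2 ≤
      (multi 3 k).card * ∑ α ∈ s.finsuppAntidiag k, d α ^ 2 := by
    refine sq_sum_le_card_mul_sum_sq.trans ?_
    rw [card_finsuppAntidiag_eq k hs.toIsSimplex]
    simp only [sq_abs]
    exact le_rfl
  calc size s ^ 2 * ev (MvPolynomial.pderiv j (bernPoly k s c g d)) x ^ 2
      ≤ size s ^ 2 * ((∑ α ∈ s.finsuppAntidiag k, |d α|) * (k * D)) ^ 2 :=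
        mul_le_mul_of_nonneg_left h4 (sq_nonneg _)
    _ = (k * κ) ^ 2 * (∑ α ∈ s.finsuppAntidiag k, |d α|) ^ 2 := by
        rw [hD]; field_simp
    _ ≤ (k * κ) ^ 2 * ((multi 3 k).card * ∑ α ∈ s.finsuppAntidiag k, d α ^ 2) :=
        mul_le_mul_of_nonneg_left h5 (sq_nonneg _)
    _ = _ := by ring

lemma eq_bernPoly {k : ℕ} {s : Finset E3} {c : E3 → ℝ} {g : E3 → Vec}
    (hb : IsBary s c g) {p : Poly} (hp : p ∈ polyDeg k) : p = bernPoly k s c g (bcoef k p) := by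
  refine poly_ext fun x => ?_
  conv_lhs => rw [← hb.sum_smul x]
  rw [ev_eq_sum_bcoef hp (hb.sum_eq_one x), bernPoly, QuadCurlHDG.ev_sum]
  exact Finset.sum_congr rfl fun α _ => by simp only [ev_smul, ev_prod, ev_pow]

/-! ### Inverse inequalities -/

lemma cellInt_le {s : Finset E3} {f : E3 → ℝ} {b : ℝ} (hf : ContinuousOn f (hull s))
    (h : ∀ x ∈ hull s, f x ≤ b) : cellInt s f ≤ b * volume.real (hull s) := by
  have h1 : cellInt s f ≤ ∫ _x in hull s, b := setIntegral_mono_on (integrableOn_cell s hf)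
    (integrableOn_cell s continuousOn_const) (measurableSet_hull s) h
  simpa [mul_comm] using h1

/-- The pointwise bound of order `h⁻²` meets a volume of order `h³`. Arbitrary coefficients are
allowed because the error of the conforming approximation is given by its coefficients. -/
lemma exists_gradient_le (k : ℕ) {κ : ℝ} (hκ : 0 < κ) : ∃ C : ℝ, 0 < C ∧ ∀ s, IsRegular κ s →
    ∀ c g, IsBary s c g → ∀ d j,
      cellInt s (fun x => ev (MvPolynomial.pderiv j (bernPoly k s c g d)) x ^ 2) ≤
        C * size s * ∑ α ∈ s.finsuppAntidiag k, d α ^ 2 := by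
  -- The summand one keeps the constant positive for `k = 0`.
  refine ⟨((k * κ) ^ 2 * (multi 3 k).card + 1) * ballVol,
    mul_pos (by positivity) ballVol_pos, fun s hs c g hb d j => ?_⟩
  have hsz := hs.size_pos
  set K := (k * κ) ^ 2 * ((multi 3 k).card : ℝ) with hK
  have hK0 : 0 ≤ K := by positivity
  set Q := ∑ α ∈ s.finsuppAntidiag k, d α ^ 2 with hQ
  have hc : 0 ≤ Q := Finset.sum_nonneg fun _ _ => sq_nonneg _
  have h1 : cellInt s (fun x => ev (MvPolynomial.pderiv j (bernPoly k s c g d)) x ^ 2) ≤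
      (K * Q / size s ^ 2) * volume.real (hull s) := by
    refine cellInt_le (by fun_prop) fun x hx => ?_
    rw [le_div_iff₀ (by positivity), mul_comm]
    exact ev_pderiv_bernPoly_sq_le hκ k hs hb d j hx
  refine h1.trans ?_
  calc (K * Q / size s ^ 2) * volume.real (hull s)
      ≤ (K * Q / size s ^ 2) * (size s ^ 3 * ballVol) :=
        mul_le_mul_of_nonneg_left (volume_hull_le hs.nonempty) (by positivity)
    _ = K * (ballVol * size s * Q) := by field_simp
    _ ≤ (K + 1) * (ballVol * size s * Q) := by
        have : 0 ≤ ballVol * size s * Q :=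
          mul_nonneg (mul_nonneg ballVol_pos.le hsz.le) hc
        linarith
    _ = _ := by ring

/-- The inscribed ball bounds the volume factor from below by a multiple of `h³`. -/
lemma exists_coefSq_le_cellInt (k : ℕ) {κ : ℝ} (hκ : 0 < κ) : ∃ C : ℝ, 0 < C ∧
    ∀ s, IsRegular κ s → ∀ p ∈ polyDeg k,
      size s ^ 3 * coefSq k s p ≤ C * cellInt s (fun x => ev p x ^ 2) := by
  obtain ⟨C, hC, h⟩ := exists_coefSq_le 3 k
  have hv := measureReal_corner_pos 3
  refine ⟨C * (κ ^ 3 * volume.real (corner 3) / ballVol), mul_pos hC (div_pos (by positivity)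
    ballVol_pos), fun s hs p hp => ?_⟩
  obtain ⟨a, ha⟩ := hs.exists_enumerates
  have h1 := h s a ha p hp
  have h2 := hs.volume_hull_ge hκ
  rw [volume_hull_eq hs.toIsSimplex ha] at h2
  rw [cellInt_eq hs.toIsSimplex ha]
  set I := ∫ y in corner 3, ev p (par a y) ^ 2
  have hI : 0 ≤ I := integral_nonneg fun y => sq_nonneg _
  have hsz := hs.size_pos
  have hb := ballVol_pos
  have h3 : size s ^ 3 ≤ κ ^ 3 * volume.real (corner 3) / ballVol * jac a := by
    rw [div_pow, div_mul_eq_mul_div, div_le_iff₀ (by positivity)] at h2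
    rw [div_mul_eq_mul_div, le_div_iff₀ hb]
    linarith
  calc size s ^ 3 * coefSq k s p ≤ size s ^ 3 * (C * I) :=
        mul_le_mul_of_nonneg_left h1 (by positivity)
    _ ≤ (κ ^ 3 * volume.real (corner 3) / ballVol * jac a) * (C * I) :=
        mul_le_mul_of_nonneg_right h3 (by positivity)
    _ = _ := by ring

/-- The inverse inequality. -/
theorem exists_inverse (k : ℕ) {κ : ℝ} (hκ : 0 < κ) : ∃ C : ℝ, 0 < C ∧ ∀ s, IsRegular κ s →
    ∀ p ∈ polyDeg k, ∀ j, size s ^ 2 * cellInt s (fun x => ev (MvPolynomial.pderiv j p) x ^ 2) ≤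
      C * cellInt s (fun x => ev p x ^ 2) := by
  obtain ⟨C1, hC1, h1⟩ := exists_gradient_le k hκ
  obtain ⟨C2, hC2, h2⟩ := exists_coefSq_le_cellInt k hκ
  refine ⟨C1 * C2, by positivity, fun s hs p hp j => ?_⟩
  obtain ⟨c, g, hb⟩ := exists_isBary hs.toIsSimplex
  have h3 := h1 s hs c g hb (bcoef k p) j
  rw [← eq_bernPoly hb hp] at h3
  calc size s ^ 2 * cellInt s (fun x => ev (MvPolynomial.pderiv j p) x ^ 2)
      ≤ size s ^ 2 * (C1 * size s * coefSq k s p) := mul_le_mul_of_nonneg_left h3 (sq_nonneg _)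
    _ = C1 * (size s ^ 3 * coefSq k s p) := by ring
    _ ≤ C1 * (C2 * cellInt s (fun x => ev p x ^ 2)) :=
        mul_le_mul_of_nonneg_left (h2 s hs p hp) hC1.le
    _ = _ := by ring

/-- The factor of a face of a shape regular tetrahedron. -/
lemma exists_jac_face_bounds {κ : ℝ} (hκ : 0 < κ) : ∃ c C : ℝ, 0 < c ∧ 0 < C ∧
    ∀ [DecidableEq E3] (s : Finset E3), IsRegular κ s → ∀ v ∈ s, ∀ b : Fin 3 → E3,
      Enumerates b (s.erase v) → c * size s ^ 2 ≤ jac b ∧ jac b ≤ C * size s ^ 2 := by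
  have hv := measureReal_corner_pos 3
  have hw := ballVol_pos
  refine ⟨ballVol / volume.real (corner 3) / κ ^ 3, ballVol / volume.real (corner 3) * κ,
    by positivity, by positivity, fun s hs v hvs b hb => ?_⟩
  obtain ⟨a, ha⟩ := hs.exists_enumerates
  obtain ⟨c, g, hbary⟩ := exists_isBary hs.toIsSimplex
  rw [jac_erase hs.toIsSimplex hbary ha hvs hb]
  have h1 := hs.volume_hull_ge hκ
  have h2 := volume_hull_le hs.nonempty
  rw [volume_hull_eq hs.toIsSimplex ha] at h1 h2
  have hsz := hs.size_pos
  obtain ⟨u, hu, huv⟩ := hs.exists_ne v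
  have h3 := hbary.one_le_grad_mul_dist hu hvs huv
  have h4 := dist_le_size (mem_hull hu) (mem_hull hvs)
  have h5 := hs.grad_le hκ hbary hvs
  set l := Real.sqrt (sqLen (g v)) with hl
  have hl0 : 0 ≤ l := Real.sqrt_nonneg _
  have hlsq : l ^ 2 = sqLen (g v) := Real.sq_sqrt (sqLen_nonneg _)
  rw [← hlsq] at h3 h5
  -- The number `l` is the reciprocal of the height of `v` over the face. This height is at most the
  -- size, and by `h7` at least the size divided by `κ`.
  have h6 : 1 ≤ l * size s := by
    have : 1 ^ 2 ≤ (l * size s) ^ 2 := by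
      rw [one_pow, mul_pow]
      exact h3.trans (mul_le_mul_of_nonneg_left (pow_le_pow_left₀ dist_nonneg h4 2) (sq_nonneg _))
    exact le_of_sq_le_sq this (by positivity)
  have h7 : l * size s ≤ κ := by
    refine le_of_sq_le_sq ?_ hκ.le
    nlinarith [sq_nonneg (l * size s)]
  have hj : 0 < jac a := jac_pos (ha.affineIndependent hs.toIsSimplex)
  constructor
  · rw [div_pow, div_mul_eq_mul_div, div_le_iff₀ (by positivity)] at h1
    rw [div_div, div_mul_eq_mul_div, div_le_iff₀ (by positivity)]
    refine le_of_mul_le_mul_right ?_ hsz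
    calc ballVol * size s ^ 2 * size s = size s ^ 3 * ballVol := by ring
      _ ≤ jac a * volume.real (corner 3) * κ ^ 3 := h1
      _ ≤ jac a * volume.real (corner 3) * κ ^ 3 * (l * size s) :=
          le_mul_of_one_le_right (by positivity) h6
      _ = _ := by ring
  · refine le_of_mul_le_mul_right ?_ (mul_pos hsz hv)
    calc jac a * l * (size s * volume.real (corner 3)) =
          (jac a * volume.real (corner 3)) * (l * size s) := by ring
      _ ≤ (size s ^ 3 * ballVol) * κ := mul_le_mul h2 h7 (by positivity) (by positivity)
      _ = _ := by field_simp

/-- The norm equivalence on the reference triangle, scaled by a face factor of order `h_T²`. -/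
lemma exists_coefSq_le_faceInt (k : ℕ) {κ : ℝ} (hκ : 0 < κ) : ∃ C : ℝ, 0 < C ∧
    ∀ [DecidableEq E3] (s : Finset E3), IsRegular κ s → ∀ v ∈ s, ∀ p ∈ polyDeg k,
      size s ^ 2 * coefSq k (s.erase v) p ≤ C * faceInt (s.erase v) (fun x => ev p x ^ 2) := by
  obtain ⟨C, hC, h⟩ := exists_coefSq_le 2 k
  obtain ⟨c, C', hc, -, hj⟩ := exists_jac_face_bounds hκ
  refine ⟨C / c, by positivity, fun s hs v hv p hp => ?_⟩
  have hf := hs.toIsSimplex.erase hv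
  obtain ⟨b, hb⟩ := hf.exists_enumerates
  have h1 := h _ b hb p hp
  have h2 := (hj s hs v hv b hb).1
  rw [faceInt_eq hf hb]
  set I := ∫ y in corner 2, ev p (par b y) ^ 2
  have hI : 0 ≤ I := integral_nonneg fun y => sq_nonneg _
  calc size s ^ 2 * coefSq k (s.erase v) p ≤ size s ^ 2 * (C * I) :=
        mul_le_mul_of_nonneg_left h1 (by positivity)
    _ = (c * size s ^ 2) * (C / c * I) := by field_simp
    _ ≤ jac b * (C / c * I) := mul_le_mul_of_nonneg_right h2 (by positivity)
    _ = _ := by ring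

/-- The discrete trace inequality. -/
theorem exists_trace (k : ℕ) {κ : ℝ} (hκ : 0 < κ) : ∃ C : ℝ, 0 < C ∧
    ∀ [DecidableEq E3] (s : Finset E3), IsRegular κ s → ∀ v ∈ s, ∀ p ∈ polyDeg k,
      size s * faceInt (s.erase v) (fun x => ev p x ^ 2) ≤ C * cellInt s (fun x => ev p x ^ 2) := by
  obtain ⟨C1, hC1, h1⟩ := exists_coefSq_le_cellInt k hκ
  obtain ⟨c, C2, -, hC2, hj⟩ := exists_jac_face_bounds hκ
  have hv2 := measureReal_corner_pos 2
  refine ⟨C2 * ((multi 3 k).card + 1) * volume.real (corner 2) * C1, by positivity,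
    fun s hs v hv p hp => ?_⟩
  have hf := hs.toIsSimplex.erase hv
  obtain ⟨b, hb⟩ := hf.exists_enumerates
  have h2 := (hj s hs v hv b hb).2
  have h3 := h1 s hs p hp
  have hsz := hs.size_pos
  have hcs := coefSq_nonneg k s p
  rw [faceInt_eq hf hb]
  -- On the face the polynomial is bounded by its coefficients on the whole tetrahedron, and these
  -- are controlled by the volume integral.
  have h4 : ∫ y in corner 2, ev p (par b y) ^ 2 ≤
      ((multi 3 k).card + 1) * coefSq k s p * volume.real (corner 2) := by
    have : ∫ y in corner 2, ev p (par b y) ^ 2 ≤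
        ∫ _y in corner 2, (((multi 3 k).card + 1) * coefSq k s p : ℝ) := by
      refine setIntegral_mono_on (integrableOn_corner
        (((continuous_ev p).comp (continuous_par b)).pow 2)) (integrableOn_corner continuous_const)
        (measurableSet_corner 2) fun y hy => ?_
      have hmem : par b y ∈ hull s := by
        refine hull_mono (s.erase_subset v) ?_
        rw [← hb.convexHull, convexHull_range_eq_image]
        exact Set.mem_image_of_mem _ hy
      refine (ev_sq_le hs.toIsSimplex hp hmem).trans ?_
      nlinarith
    refine this.trans_eq ?_
    simp [mul_comm]
  have hI : 0 ≤ ∫ y in corner 2, ev p (par b y) ^ 2 := integral_nonneg fun y => sq_nonneg _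
  calc size s * (jac b * ∫ y in corner 2, ev p (par b y) ^ 2)
      ≤ size s * ((C2 * size s ^ 2) * (((multi 3 k).card + 1) * coefSq k s p *
          volume.real (corner 2))) := by
        refine mul_le_mul_of_nonneg_left (mul_le_mul h2 h4 hI (by positivity)) hsz.le
    _ = C2 * ((multi 3 k).card + 1) * volume.real (corner 2) * (size s ^ 3 * coefSq k s p) := by
        ring
    _ ≤ C2 * ((multi 3 k).card + 1) * volume.real (corner 2) *
          (C1 * cellInt s (fun x => ev p x ^ 2)) := mul_le_mul_of_nonneg_left h3 (by positivity)
    _ = _ := by ring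

/-! ### Faces and cells of a mesh -/

section Mesh

variable {Ω : Set E3} (M : TetMesh Ω)

namespace TetMesh

variable {M}

lemma cell_isSimplex (T : M.Cell) : IsSimplex 3 T.1 := ⟨M.card_eq _ T.2, M.indep _ T.2⟩

lemma ShapeRegular.isRegular {κ : ℝ} (h : M.ShapeRegular κ) (T : M.Cell) : IsRegular κ T.1 :=
  ⟨cell_isSimplex T, h _ T.2⟩

lemma face_card (F : M.Face) : F.1.card = 3 := by
  obtain ⟨s, _, h⟩ := Finset.mem_biUnion.1 F.2
  exact (Finset.mem_powersetCard.1 h).2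

lemma exists_cell (F : M.Face) : ∃ T : M.Cell, F.1 ⊆ T.1 := by
  obtain ⟨s, hs, h⟩ := Finset.mem_biUnion.1 F.2
  exact ⟨⟨s, hs⟩, (Finset.mem_powersetCard.1 h).1⟩

lemma exists_eq_erase {F : M.Face} {T : M.Cell} (h : F.1 ⊆ T.1) :
    ∃ v ∈ T.1, F.1 = T.1.erase v := by
  obtain ⟨v, hv⟩ := Finset.card_eq_one.1 (show (T.1 \ F.1).card = 1 by
    rw [Finset.card_sdiff_of_subset h, (cell_isSimplex T).card, face_card])
  have hvT : v ∈ T.1 \ F.1 := by rw [hv]; simp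
  refine ⟨v, (Finset.mem_sdiff.1 hvT).1, ?_⟩
  rw [← Finset.sdiff_singleton_eq_erase, ← hv, Finset.sdiff_sdiff_eq_self h]

lemma face_isSimplex (F : M.Face) : IsSimplex 2 F.1 := by
  classical
  obtain ⟨T, hT⟩ := exists_cell F
  obtain ⟨v, hv, h⟩ := exists_eq_erase hT
  rw [h]
  exact (cell_isSimplex T).erase hv

/-- Deleting a vertex is a bijection from the vertices of a cell to its faces. It converts the sums
in the forms into those of the divergence theorem. -/
lemma sum_faces (T : M.Cell) [DecidablePred fun F : M.Face => F.1 ⊆ T.1]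
    {β : Type*} [AddCommMonoid β] (φ : Finset E3 → β) :
    ∑ F : M.Face with F.1 ⊆ T.1, φ F.1 = ∑ v ∈ T.1, φ (T.1.erase v) := by
  classical
  symm
  have hmem : ∀ v ∈ T.1, T.1.erase v ∈ M.faces := fun v hv => by
    refine Finset.mem_biUnion.2 ⟨T.1, T.2, Finset.mem_powersetCard.2 ⟨Finset.erase_subset _ _, ?_⟩⟩
    rw [Finset.card_erase_of_mem hv, (cell_isSimplex T).card]
  refine Finset.sum_bij (fun v hv => (⟨T.1.erase v, hmem v hv⟩ : M.Face)) (fun v hv => ?_)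
    (fun v hv w hw h => ?_) (fun F hF => ?_) (fun v hv => rfl)
  · simpa using Finset.erase_subset _ _
  · exact Finset.erase_injOn T.1 hv hw (congrArg Subtype.val h)
  · obtain ⟨v, hv, h⟩ := exists_eq_erase (Finset.mem_filter.1 hF).2
    exact ⟨v, hv, Subtype.ext h.symm⟩

lemma face_size_pos (F : M.Face) : 0 < size F.1 := (face_isSimplex F).size_pos

lemma cell_size_pos (T : M.Cell) : 0 < size T.1 := (cell_isSimplex T).size_pos

lemma face_size_le {F : M.Face} {T : M.Cell} (h : F.1 ⊆ T.1) : size F.1 ≤ size T.1 :=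
  size_mono (face_isSimplex F).nonempty h

/-- A face contains an edge of the cell, and every edge is comparable with the size of the cell. -/
lemma ShapeRegular.cell_size_le {κ : ℝ} (hκ : 0 < κ) (hM : M.ShapeRegular κ) {F : M.Face}
    {T : M.Cell} (h : F.1 ⊆ T.1) : 2 * size T.1 ≤ κ * size F.1 := by
  obtain ⟨u, hu⟩ := (face_isSimplex F).nonempty
  obtain ⟨v, hv, hvu⟩ := (face_isSimplex F).exists_ne u
  exact (hM.isRegular T).size_le_size hκ (h hu) (h hv) hvu.symm hu hv

lemma isOuterNormal {F : M.Face} {T : M.Cell} (h : F.1 ⊆ T.1) :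
    IsOuterNormal T.1 F.1 (outerNormal T.1 F.1) := by
  classical
  obtain ⟨v, hv, he⟩ := exists_eq_erase h
  rw [he]
  exact isOuterNormal_outerNormal (cell_isSimplex T) hv

/-! ### The number of cells at a point -/

/-- By conformity the intersection lies in the face of `S` opposite to a vertex that `T` lacks. This
face has finite area, hence no volume. -/
lemma volume_inter_hull_eq_zero {S T : M.Cell} (h : S ≠ T) :
    volume (hull S.1 ∩ hull T.1) = 0 := by
  classical
  obtain ⟨v, hvS, hvT⟩ : ∃ v ∈ S.1, v ∉ T.1 := by
    by_contra! hc
    exact h (Subtype.ext (Finset.eq_of_subset_of_card_le hc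
      (by rw [(cell_isSimplex S).card, (cell_isSimplex T).card])))
  have h1 : hull S.1 ∩ hull T.1 ⊆ hull (S.1.erase v) := by
    refine (M.conforming _ S.2 _ T.2).trans (convexHull_mono ?_)
    rintro x ⟨hxS, hxT⟩
    have : x ≠ v := by
      rintro rfl
      exact hvT hxT
    simpa [this] using hxS
  refine measure_mono_null h1 ?_
  rw [volume_eq_hausdorff]
  exact (Measure.euclideanHausdorffMeasure_zero_or_top (by norm_num : 2 < 3) _).resolve_right
    (hausdorff_hull_lt_top ((cell_isSimplex S).erase hvS)).ne

-- A packing argument: near `x`, every cell is cut down to the scale of the smallest one. The pieces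
-- overlap in null sets, lie in a common ball, and each fills at least the fraction `κ⁻³` of it.
open scoped Classical in
theorem ShapeRegular.card_cells_le {κ : ℝ} (hκ : 0 < κ) (hM : M.ShapeRegular κ) (x : E3) :
    ((Finset.univ.filter fun T : M.Cell => x ∈ hull T.1).card : ℝ) ≤ κ ^ 3 := by
  set S := Finset.univ.filter fun T : M.Cell => x ∈ hull T.1 with hS
  rcases S.eq_empty_or_nonempty with he | hne
  · rw [he]; simp; positivity
  obtain ⟨T0, -, hmin⟩ := S.exists_min_image (fun T => size T.1) hne
  set t := size T0.1 with ht
  have htpos : 0 < t := cell_size_pos T0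
  have hpiece : ∀ T ∈ S, t ^ 3 * ballVol ≤
      κ ^ 3 * volume.real (hull T.1 ∩ Metric.closedBall x t) := by
    intro T hT
    have hx : x ∈ hull T.1 := (Finset.mem_filter.1 hT).2
    have hsz := cell_size_pos T
    have hr1 : t / size T.1 ≤ 1 := (div_le_one hsz).2 (hmin T hT)
    have hr0 : 0 < t / size T.1 := by positivity
    -- Shrinking towards `x` with ratio `t / size T.1` stays in the convex cell and brings it into
    -- the ball of radius `t`.
    have hsub : AffineMap.homothety x (t / size T.1) '' hull T.1 ⊆
        hull T.1 ∩ Metric.closedBall x t := by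
      rintro _ ⟨y, hy, rfl⟩
      constructor
      · have hconv : Convex ℝ (hull T.1) := convex_convexHull ℝ _
        rw [AffineMap.homothety_apply, vsub_eq_sub, vadd_eq_add, add_comm]
        exact hconv.add_smul_sub_mem hx hy ⟨hr0.le, hr1⟩
      · rw [Metric.mem_closedBall, dist_homothety_center, Real.norm_eq_abs, abs_of_pos hr0]
        calc t / size T.1 * dist x y ≤ t / size T.1 * size T.1 :=
              mul_le_mul_of_nonneg_left (dist_le_size hx hy) hr0.le
          _ = t := by field_simp
    have hvol : volume.real (AffineMap.homothety x (t / size T.1) '' hull T.1) =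
        (t / size T.1) ^ 3 * volume.real (hull T.1) := by
      rw [measureReal_def, Measure.addHaar_image_homothety, ENNReal.toReal_mul,
        ENNReal.toReal_ofReal (abs_nonneg _), measureReal_def, abs_of_nonneg (by positivity)]
      simp
    have hmono := measureReal_mono hsub
      (measure_ne_top_of_subset Set.inter_subset_left (isCompact_hull T.1).measure_lt_top.ne)
      (μ := volume)
    rw [hvol] at hmono
    have h1 := (hM.isRegular T).volume_hull_ge hκ
    calc t ^ 3 * ballVol = κ ^ 3 * ((t / size T.1) ^ 3 * ((size T.1 / κ) ^ 3 * ballVol)) := by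
          field_simp
      _ ≤ κ ^ 3 * ((t / size T.1) ^ 3 * volume.real (hull T.1)) := by gcongr
      _ ≤ _ := by gcongr
  have hunion : ∑ T ∈ S, volume.real (hull T.1 ∩ Metric.closedBall x t) ≤
      volume.real (Metric.closedBall x t) := by
    have h1 : volume (⋃ T ∈ S, hull T.1 ∩ Metric.closedBall x t) =
        ∑ T ∈ S, volume (hull T.1 ∩ Metric.closedBall x t) := by
      refine measure_biUnion_finset₀ (fun A _ B _ hAB => ?_) (fun T _ => ?_)
      · refine measure_mono_null ?_ (volume_inter_hull_eq_zero hAB)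
        exact Set.inter_subset_inter Set.inter_subset_left Set.inter_subset_left
      · exact ((measurableSet_hull T.1).inter measurableSet_closedBall).nullMeasurableSet
    have h2 : ∑ T ∈ S, volume.real (hull T.1 ∩ Metric.closedBall x t) =
        volume.real (⋃ T ∈ S, hull T.1 ∩ Metric.closedBall x t) := by
      simp only [measureReal_def]
      rw [h1, ENNReal.toReal_sum]
      exact fun T _ => measure_ne_top_of_subset Set.inter_subset_left
        (isCompact_hull T.1).measure_lt_top.ne
    rw [h2]
    exact measureReal_mono (Set.iUnion₂_subset fun T _ => Set.inter_subset_right)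
      measure_closedBall_lt_top.ne
  rw [volume_closedBall x htpos.le] at hunion
  have h3 := Finset.sum_le_sum hpiece
  rw [Finset.sum_const, nsmul_eq_mul, ← Finset.mul_sum] at h3
  have h4 : (S.card : ℝ) * (t ^ 3 * ballVol) ≤ κ ^ 3 * (t ^ 3 * ballVol) :=
    h3.trans (mul_le_mul_of_nonneg_left hunion (by positivity))
  exact le_of_mul_le_mul_right h4 (mul_pos (by positivity) ballVol_pos)

-- All these cells meet at a common vertex. For a face, this bound stands in for the exact count of
-- adjacent cells.
open scoped Classical in
lemma ShapeRegular.card_cells_superset_le {κ : ℝ} (hκ : 0 < κ) (hM : M.ShapeRegular κ)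
    {t : Finset E3} (ht : t.Nonempty) :
    ((Finset.univ.filter fun T : M.Cell => t ⊆ T.1).card : ℝ) ≤ κ ^ 3 := by
  obtain ⟨v, hv⟩ := ht
  refine le_trans ?_ (hM.card_cells_le hκ v)
  exact_mod_cast Finset.card_le_card fun T hT => by
    simp only [Finset.mem_filter, Finset.mem_univ, true_and] at hT ⊢
    exact mem_hull (hT hv)

end TetMesh

/-! ### Sums of integrals -/

variable {M}

lemma volSum_congr {f g : M.Cell → E3 → ℝ} (h : ∀ T, ∀ x ∈ hull T.1, f T x = g T x) :
    volSum M f = volSum M g :=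
  Finset.sum_congr rfl fun T _ => setIntegral_congr_fun (measurableSet_hull _) (h T)

lemma volSum_add {f g : M.Cell → E3 → ℝ} (hf : ∀ T, ContinuousOn (f T) (hull T.1))
    (hg : ∀ T, ContinuousOn (g T) (hull T.1)) :
    volSum M (fun T x => f T x + g T x) = volSum M f + volSum M g := by
  simp only [volSum, cellInt, ← Finset.sum_add_distrib]
  exact Finset.sum_congr rfl fun T _ => integral_add (integrableOn_cell _ (hf T))
    (integrableOn_cell _ (hg T))

lemma volSum_const_mul (c : ℝ) (f : M.Cell → E3 → ℝ) :
    volSum M (fun T x => c * f T x) = c * volSum M f := by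
  simp only [volSum, cellInt, Finset.mul_sum, integral_const_mul]

lemma volSum_mono {f g : M.Cell → E3 → ℝ} (hf : ∀ T, ContinuousOn (f T) (hull T.1))
    (hg : ∀ T, ContinuousOn (g T) (hull T.1)) (h : ∀ T, ∀ x ∈ hull T.1, f T x ≤ g T x) :
    volSum M f ≤ volSum M g :=
  Finset.sum_le_sum fun T _ => setIntegral_mono_on (integrableOn_cell _ (hf T))
    (integrableOn_cell _ (hg T)) (measurableSet_hull _) (h T)

lemma volSum_nonneg {f : M.Cell → E3 → ℝ} (h : ∀ T, ∀ x ∈ hull T.1, 0 ≤ f T x) :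
    0 ≤ volSum M f :=
  Finset.sum_nonneg fun T _ => setIntegral_nonneg (measurableSet_hull _) (h T)

lemma bdrySum_congr {f g : M.Cell → M.Face → E3 → ℝ}
    (h : ∀ T F, F.1 ⊆ T.1 → ∀ x ∈ hull F.1, f T F x = g T F x) : bdrySum M f = bdrySum M g :=
  Finset.sum_congr rfl fun T _ => Finset.sum_congr rfl fun F hF =>
    setIntegral_congr_fun (measurableSet_hull _) (h T F (Finset.mem_filter.1 hF).2)

lemma integrableOn_face (F : M.Face) {f : E3 → ℝ} (hf : ContinuousOn f (hull F.1)) :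
    IntegrableOn f (hull F.1) μHE[2] := integrableOn_hull (TetMesh.face_isSimplex F) hf

lemma bdrySum_add {f g : M.Cell → M.Face → E3 → ℝ}
    (hf : ∀ T F, F.1 ⊆ T.1 → ContinuousOn (f T F) (hull F.1))
    (hg : ∀ T F, F.1 ⊆ T.1 → ContinuousOn (g T F) (hull F.1)) :
    bdrySum M (fun T F x => f T F x + g T F x) = bdrySum M f + bdrySum M g := by
  simp only [bdrySum, faceInt, ← Finset.sum_add_distrib]
  exact Finset.sum_congr rfl fun T _ => Finset.sum_congr rfl fun F hF =>
    integral_add (integrableOn_face F (hf T F (Finset.mem_filter.1 hF).2))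
      (integrableOn_face F (hg T F (Finset.mem_filter.1 hF).2))

lemma bdrySum_const_mul (c : ℝ) (f : M.Cell → M.Face → E3 → ℝ) :
    bdrySum M (fun T F x => c * f T F x) = c * bdrySum M f := by
  simp only [bdrySum, faceInt, Finset.mul_sum, integral_const_mul]

lemma bdrySum_mono {f g : M.Cell → M.Face → E3 → ℝ}
    (hf : ∀ T F, F.1 ⊆ T.1 → ContinuousOn (f T F) (hull F.1))
    (hg : ∀ T F, F.1 ⊆ T.1 → ContinuousOn (g T F) (hull F.1))
    (h : ∀ T F, F.1 ⊆ T.1 → ∀ x ∈ hull F.1, f T F x ≤ g T F x) : bdrySum M f ≤ bdrySum M g :=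
  Finset.sum_le_sum fun T _ => Finset.sum_le_sum fun F hF =>
    setIntegral_mono_on (integrableOn_face F (hf T F (Finset.mem_filter.1 hF).2))
      (integrableOn_face F (hg T F (Finset.mem_filter.1 hF).2)) (measurableSet_hull _)
      (h T F (Finset.mem_filter.1 hF).2)

lemma bdrySum_nonneg {f : M.Cell → M.Face → E3 → ℝ}
    (h : ∀ T F, F.1 ⊆ T.1 → ∀ x ∈ hull F.1, 0 ≤ f T F x) : 0 ≤ bdrySum M f :=
  Finset.sum_nonneg fun T _ => Finset.sum_nonneg fun F hF =>
    setIntegral_nonneg (measurableSet_hull _) (h T F (Finset.mem_filter.1 hF).2)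

lemma bdrySum_zero : bdrySum M (fun _ _ _ => 0) = 0 := by simp [bdrySum, faceInt]

lemma volSum_zero : volSum M (fun _ _ => 0) = 0 := by simp [volSum, cellInt]

open scoped Classical in
lemma bdrySum_comm (f : M.Cell → M.Face → E3 → ℝ) :
    bdrySum M f = ∑ F : M.Face, ∑ T : M.Cell with F.1 ⊆ T.1, faceInt F.1 (f T F) := by
  simp only [bdrySum, Finset.sum_filter]
  rw [Finset.sum_comm]

theorem volSum_divg (V : M.Cell → VPoly) : volSum M (fun T => ev (divg (V T))) =
    bdrySum M fun T F x => outerNormal T.1 F.1 ⬝ᵥ evV (V T) x := by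
  classical
  refine Finset.sum_congr rfl fun T _ => ?_
  rw [cellInt_divg (TetMesh.cell_isSimplex T), TetMesh.sum_faces T (fun F => faceInt F fun x =>
    outerNormal T.1 F ⬝ᵥ evV (V T) x)]

end Mesh

/-! ### Continuity of vector expressions -/

lemma continuousOn_dot {s : Set E3} {v w : E3 → Vec} (hv : ∀ i, ContinuousOn (fun x => v x i) s)
    (hw : ∀ i, ContinuousOn (fun x => w x i) s) : ContinuousOn (fun x => v x ⬝ᵥ w x) s := by
  simp only [dot_eq]
  exact (((hv 0).mul (hw 0)).add ((hv 1).mul (hw 1))).add ((hv 2).mul (hw 2))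

lemma continuousOn_sqLen {s : Set E3} {v : E3 → Vec} (hv : ∀ i, ContinuousOn (fun x => v x i) s) :
    ContinuousOn (fun x => sqLen (v x)) s := continuousOn_dot hv hv

lemma continuousOn_cross {s : Set E3} (n : Vec) {v : E3 → Vec}
    (hv : ∀ i, ContinuousOn (fun x => v x i) s) (i : Fin 3) :
    ContinuousOn (fun x => (n ⨯₃ v x) i) s := by
  have h0 := hv 0
  have h1 := hv 1
  have h2 := hv 2
  simp only [cross_apply]
  fin_cases i
  · exact (continuousOn_const.mul h2).sub (continuousOn_const.mul h1)
  · exact (continuousOn_const.mul h0).sub (continuousOn_const.mul h2)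
  · exact (continuousOn_const.mul h1).sub (continuousOn_const.mul h0)

lemma continuousOn_evV (v : VPoly) (s : Set E3) (i : Fin 3) :
    ContinuousOn (fun x => evV v x i) s := (continuous_evV_apply v i).continuousOn

lemma continuousOn_vsub {s : Set E3} {v w : E3 → Vec} (hv : ∀ i, ContinuousOn (fun x => v x i) s)
    (hw : ∀ i, ContinuousOn (fun x => w x i) s) (i : Fin 3) :
    ContinuousOn (fun x => (v x - w x) i) s := (hv i).sub (hw i)

/-! ### Vector calculus for polynomial fields -/

lemma pderiv_comm (i j : Fin 3) (p : Poly) :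
    MvPolynomial.pderiv i (MvPolynomial.pderiv j p) =
      MvPolynomial.pderiv j (MvPolynomial.pderiv i p) := by
  ext m
  simp only [MvPolynomial.coeff_pderiv, Finsupp.add_apply, Finsupp.single_apply]
  rw [add_right_comm]
  push_cast
  split_ifs with h1 h2 h2
  · subst h1; ring
  · exact absurd h1.symm h2
  · exact absurd h2.symm h1
  · ring

lemma pderiv_mem {k : ℕ} {p : Poly} (hp : p ∈ polyDeg k) (j : Fin 3) :
    MvPolynomial.pderiv j p ∈ polyDeg (k - 1) := by
  rw [MvPolynomial.mem_restrictTotalDegree] at hp ⊢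
  refine Finset.sup_le fun m hm => ?_
  rw [MvPolynomial.mem_support_iff, MvPolynomial.coeff_pderiv] at hm
  have h1 := (MvPolynomial.le_totalDegree (MvPolynomial.mem_support_iff.2
    (left_ne_zero_of_mul hm))).trans hp
  rw [Finsupp.sum_fintype _ _ (fun _ => rfl)] at h1 ⊢
  simp only [Finsupp.add_apply, Finset.sum_add_distrib] at h1
  have : ∑ i, (Finsupp.single j 1 : Fin 3 →₀ ℕ) i = 1 := by simp [Finsupp.single_apply]
  omega

lemma polyDeg_mono {j k : ℕ} (h : j ≤ k) : polyDeg j ≤ polyDeg k := fun p hp => by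
  rw [MvPolynomial.mem_restrictTotalDegree] at hp ⊢
  exact hp.trans h

lemma grad_mem {k : ℕ} {p : Poly} (hp : p ∈ polyDeg k) (i : Fin 3) : grad p i ∈ polyDeg (k - 1) :=
  pderiv_mem hp i

lemma divg_mem {k : ℕ} {v : VPoly} (hv : ∀ i, v i ∈ polyDeg k) : divg v ∈ polyDeg (k - 1) :=
  Submodule.sum_mem _ fun i _ => pderiv_mem (hv i) i

lemma curl_mem {k : ℕ} {v : VPoly} (hv : ∀ i, v i ∈ polyDeg k) (i : Fin 3) :
    curl v i ∈ polyDeg (k - 1) := by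
  fin_cases i <;> exact Submodule.sub_mem _ (pderiv_mem (hv _) _) (pderiv_mem (hv _) _)

lemma curl_grad (p : Poly) : curl (grad p) = 0 := by
  funext i
  fin_cases i <;> simp [curl, grad, pderiv_comm]

lemma curl_neg (v : VPoly) : curl (-v) = -curl v := by
  funext i
  fin_cases i <;> simp [curl] <;> ring

lemma curl_zero : curl 0 = 0 := by
  funext i
  fin_cases i <;> simp [curl]

lemma evV_zero (x : E3) : evV 0 x = 0 := funext fun _ => ev_zero x

lemma evV_neg (v : VPoly) (x : E3) : evV (-v) x = -evV v x := funext fun i => ev_neg (v i) x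

lemma evV_cross (u w : VPoly) (x : E3) : evV (u ⨯₃ w) x = evV u x ⨯₃ evV w x := by
  funext i
  fin_cases i <;> simp [evV, cross_apply, ev_sub, ev_mul]

lemma ev_divg_smul (q : Poly) (u : VPoly) (x : E3) :
    ev (divg fun i => q * u i) x = ev (divg u) x * ev q x + evV u x ⬝ᵥ evV (grad q) x := by
  simp only [divg, Fin.sum_univ_three, MvPolynomial.pderiv_mul, ev_add, ev_mul, dot_eq, evV,
    grad]
  ring

lemma ev_divg_cross (u w : VPoly) (x : E3) :
    ev (divg (u ⨯₃ w)) x = evV (curl u) x ⬝ᵥ evV w x - evV u x ⬝ᵥ evV (curl w) x := by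
  simp only [divg, Fin.sum_univ_three, cross_apply, dot_eq, evV, curl, Matrix.cons_val_zero,
    Matrix.cons_val_one, Matrix.cons_val, map_sub, MvPolynomial.pderiv_mul, ev_add, ev_sub, ev_mul]
  ring

lemma cross_dot_eq (n v w : Vec) : n ⬝ᵥ (v ⨯₃ w) = (n ⨯₃ v) ⬝ᵥ w := by
  simp only [cross_apply, dot_eq, Matrix.cons_val_zero, Matrix.cons_val_one, Matrix.cons_val]
  ring

/-! ### Integration by parts -/

section Mesh

variable {Ω : Set E3} {M : TetMesh Ω}

/-- The divergence theorem for the cross product of the two fields. -/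
lemma volSum_curl (u w : M.Cell → VPoly) :
    volSum M (fun T x => evV (u T) x ⬝ᵥ evV (curl (w T)) x) =
      volSum M (fun T x => evV (curl (u T)) x ⬝ᵥ evV (w T) x) -
        bdrySum M fun T F x => (outerNormal T.1 F.1 ⨯₃ evV (u T) x) ⬝ᵥ evV (w T) x := by
  have h := volSum_divg (M := M) fun T => u T ⨯₃ w T
  have h1 : volSum M (fun T => ev (divg (u T ⨯₃ w T))) =
      volSum M (fun T x => evV (curl (u T)) x ⬝ᵥ evV (w T) x) -
        volSum M (fun T x => evV (u T) x ⬝ᵥ evV (curl (w T)) x) := by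
    rw [sub_eq_add_neg, neg_eq_neg_one_mul, ← volSum_const_mul, ← volSum_add]
    · refine volSum_congr fun T x _ => ?_
      rw [ev_divg_cross]; ring
    · exact fun T => continuousOn_dot (continuousOn_evV _ _) (continuousOn_evV _ _)
    · exact fun T => continuousOn_const.mul
        (continuousOn_dot (continuousOn_evV _ _) (continuousOn_evV _ _))
  have h2 : bdrySum M (fun T F x => outerNormal T.1 F.1 ⬝ᵥ evV (u T ⨯₃ w T) x) =
      bdrySum M fun T F x => (outerNormal T.1 F.1 ⨯₃ evV (u T) x) ⬝ᵥ evV (w T) x :=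
    bdrySum_congr fun T F _ x _ => by rw [evV_cross, cross_dot_eq]
  rw [h1, h2] at h
  linarith

/-- The fields on the faces are continuous on the faces. -/
def FaceContinuous (w : M.Face → E3 → Vec) : Prop :=
  ∀ F i, ContinuousOn (fun x => w F x i) (hull F.1)

lemma facePoly_continuousOn {t : Finset E3} {j : ℕ} {g : E3 → ℝ} (hg : g ∈ facePoly t j) :
    ContinuousOn g (hull t) := by
  obtain ⟨p, _, rfl⟩ := hg
  exact (continuous_ev p).continuousOn.congr fun x hx => Set.indicator_of_mem hx _

lemma IsTraceField.faceContinuous {j : ℕ} {w : M.Face → E3 → Vec} (h : IsTraceField M j w) :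
    FaceContinuous w := fun F i => facePoly_continuousOn (h.poly F i)

/-- Integration by parts on each cell, after which `q̂` enters only through `q - q̂`, a quantity
that the norm measures. -/
lemma formC_eq (q : M.Cell → Poly) {qhat : M.Face → E3 → ℝ}
    (hq : ∀ F, ContinuousOn (qhat F) (hull F.1)) (u : M.Cell → VPoly) :
    formC M q qhat u = -volSum M (fun T x => evV (u T) x ⬝ᵥ evV (grad (q T)) x) +
      bdrySum M fun T F x =>
        (outerNormal T.1 F.1 ⬝ᵥ evV (u T) x) * (ev (q T) x - qhat F x) := by
  have hn : ∀ (T : M.Cell) (F : M.Face) (s : Set E3),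
      ContinuousOn (fun x => outerNormal T.1 F.1 ⬝ᵥ evV (u T) x) s := fun T F s =>
    continuousOn_dot (fun i => continuousOn_const) (continuousOn_evV _ _)
  have hev : ∀ (p : Poly) (s : Set E3), ContinuousOn (ev p) s :=
    fun p s => (continuous_ev p).continuousOn
  have h := volSum_divg (M := M) fun T i => q T * u T i
  have h1 : volSum M (fun T => ev (divg fun i => q T * u T i)) =
      volSum M (fun T x => ev (divg (u T)) x * ev (q T) x) +
        volSum M (fun T x => evV (u T) x ⬝ᵥ evV (grad (q T)) x) := by
    rw [← volSum_add]
    · exact volSum_congr fun T x _ => ev_divg_smul _ _ _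
    · exact fun T => (hev _ _).mul (hev _ _)
    · exact fun T => continuousOn_dot (continuousOn_evV _ _) (continuousOn_evV _ _)
  have h2 : bdrySum M (fun T F x => outerNormal T.1 F.1 ⬝ᵥ evV (fun i => q T * u T i) x) =
      bdrySum M (fun T F x => (outerNormal T.1 F.1 ⬝ᵥ evV (u T) x) * (ev (q T) x - qhat F x)) +
        bdrySum M (fun T F x => (outerNormal T.1 F.1 ⬝ᵥ evV (u T) x) * qhat F x) := by
    rw [← bdrySum_add]
    · refine bdrySum_congr fun T F _ x _ => ?_
      simp only [dot_eq, evV, ev_mul]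
      ring
    · exact fun T F _ => (hn T F _).mul ((hev _ _).sub (hq F))
    · exact fun T F _ => (hn T F _).mul (hq F)
  rw [h1, h2] at h
  rw [formC]
  linarith

/-- Two integrations by parts move both curls onto `u`. The face unknowns then enter only through
the differences that the stabilization measures. -/
lemma formB_eq (u : M.Cell → VPoly) {uhat chat : M.Face → E3 → Vec} (hu : FaceContinuous uhat)
    (hc : FaceContinuous chat) (s : M.Cell → VPoly) :
    formB M u uhat chat s = -volSum M (fun T x => evV (curl (curl (u T))) x ⬝ᵥ evV (s T) x) +
      bdrySum M (fun T F x => (outerNormal T.1 F.1 ⨯₃ (evV (u T) x - uhat F x)) ⬝ᵥ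
        evV (curl (s T)) x) +
      bdrySum M (fun T F x => (outerNormal T.1 F.1 ⨯₃ (evV (curl (u T)) x - chat F x)) ⬝ᵥ
        evV (s T) x) := by
  have key : ∀ (z w : M.Cell → VPoly) (zhat : M.Face → E3 → Vec), FaceContinuous zhat →
      bdrySum M (fun T F x => (outerNormal T.1 F.1 ⨯₃ evV (z T) x) ⬝ᵥ evV (w T) x) =
        bdrySum M (fun T F x => (outerNormal T.1 F.1 ⨯₃ (evV (z T) x - zhat F x)) ⬝ᵥ evV (w T) x) +
        bdrySum M (fun T F x => (outerNormal T.1 F.1 ⨯₃ zhat F x) ⬝ᵥ evV (w T) x) := by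
    intro z w zhat hz
    rw [← bdrySum_add]
    · refine bdrySum_congr fun T F _ x _ => ?_
      rw [← add_dotProduct, ← map_add, sub_add_cancel]
    · exact fun T F _ => continuousOn_dot (continuousOn_cross _
        (continuousOn_vsub (continuousOn_evV _ _) (hz F))) (continuousOn_evV _ _)
    · exact fun T F _ => continuousOn_dot (continuousOn_cross _ (hz F)) (continuousOn_evV _ _)
  have h1 := volSum_curl u fun T => curl (s T)
  have h2 := volSum_curl (fun T => curl (u T)) s
  rw [key u (fun T => curl (s T)) uhat hu] at h1
  rw [key (fun T => curl (u T)) s chat hc] at h2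
  rw [formB]
  linarith

/-! ### Inverse and trace inequalities for piecewise polynomials -/

lemma sqLen_evV (v : VPoly) (x : E3) : sqLen (evV v x) = ∑ i, ev (v i) x ^ 2 := by
  rw [sqLen, dot_eq, Fin.sum_univ_three]
  simp only [evV]
  ring

lemma volSum_finset_sum {ι : Type*} (s : Finset ι) {f : ι → M.Cell → E3 → ℝ}
    (hf : ∀ i T, ContinuousOn (f i T) (hull T.1)) :
    volSum M (fun T x => ∑ i ∈ s, f i T x) = ∑ i ∈ s, volSum M (f i) := by
  classical
  induction s using Finset.induction_on with
  | empty => simpa using volSum_zero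
  | insert i s hi ih =>
    simp only [Finset.sum_insert hi]
    rw [volSum_add (hf i) (fun T => continuousOn_finsetSum _ fun j _ => hf j T), ih]

lemma bdrySum_finset_sum {ι : Type*} (s : Finset ι) {f : ι → M.Cell → M.Face → E3 → ℝ}
    (hf : ∀ i T F, F.1 ⊆ T.1 → ContinuousOn (f i T F) (hull F.1)) :
    bdrySum M (fun T F x => ∑ i ∈ s, f i T F x) = ∑ i ∈ s, bdrySum M (f i) := by
  classical
  induction s using Finset.induction_on with
  | empty => simpa using bdrySum_zero
  | insert i s hi ih =>
    simp only [Finset.sum_insert hi]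
    rw [bdrySum_add (hf i) (fun T F h => continuousOn_finsetSum _ fun j _ => hf j T F h), ih]

/-- The weights are left free so that a single inequality serves different powers of the mesh size.
-/
lemma exists_bdrySum_le (k : ℕ) {κ : ℝ} (hκ : 0 < κ) : ∃ C : ℝ, 0 < C ∧
    ∀ {Ω : Set E3} (M : TetMesh Ω), M.ShapeRegular κ → ∀ w : M.Cell → ℝ, (∀ T, 0 ≤ w T) →
      ∀ p : M.Cell → Poly, (∀ T, p T ∈ polyDeg k) →
        bdrySum M (fun T _ x => w T * size T.1 * ev (p T) x ^ 2) ≤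
          C * volSum M (fun T x => w T * ev (p T) x ^ 2) := by
  obtain ⟨C, hC, h⟩ := exists_trace k hκ
  -- The factor four counts the faces of a tetrahedron.
  refine ⟨4 * C, by positivity, fun M hM w hw p hp => ?_⟩
  rw [bdrySum, volSum, Finset.mul_sum]
  refine Finset.sum_le_sum fun T _ => ?_
  rw [TetMesh.sum_faces T fun F => faceInt F fun x => w T * size T.1 * ev (p T) x ^ 2]
  have h1 : ∀ v ∈ T.1, faceInt (T.1.erase v) (fun x => w T * size T.1 * ev (p T) x ^ 2) ≤
      w T * (C * cellInt T.1 (fun x => ev (p T) x ^ 2)) := by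
    intro v hv
    rw [faceInt, integral_const_mul, mul_assoc]
    exact mul_le_mul_of_nonneg_left (h T.1 (hM.isRegular T) v hv (p T) (hp T)) (hw T)
  refine (Finset.sum_le_sum h1).trans_eq ?_
  rw [Finset.sum_const, (TetMesh.cell_isSimplex T).card, cellInt, cellInt, integral_const_mul,
    nsmul_eq_mul]
  push_cast
  ring

lemma exists_bdrySum_sqLen_le (k : ℕ) {κ : ℝ} (hκ : 0 < κ) : ∃ C : ℝ, 0 < C ∧
    ∀ {Ω : Set E3} (M : TetMesh Ω), M.ShapeRegular κ → ∀ w : M.Cell → ℝ, (∀ T, 0 ≤ w T) →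
      ∀ v : M.Cell → VPoly, (∀ T i, v T i ∈ polyDeg k) →
        bdrySum M (fun T _ x => w T * size T.1 * sqLen (evV (v T) x)) ≤
          C * volSum M (fun T x => w T * sqLen (evV (v T) x)) := by
  obtain ⟨C, hC, h⟩ := exists_bdrySum_le k hκ
  refine ⟨C, hC, fun M hM w hw v hv => ?_⟩
  simp only [sqLen_evV, Finset.mul_sum]
  rw [bdrySum_finset_sum, volSum_finset_sum, Finset.mul_sum]
  · exact Finset.sum_le_sum fun i _ => h M hM w hw (fun T => v T i) fun T => hv T i
  · exact fun i T => by fun_prop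
  · exact fun i T F _ => by fun_prop

/-! ### First derivatives of piecewise polynomials. -/

/-- The sum of the squares of all first derivatives. -/
def jacSq (v : VPoly) (x : E3) : ℝ := ∑ i, ∑ j, ev (MvPolynomial.pderiv j (v i)) x ^ 2

lemma sqLen_curl_le (v : VPoly) (x : E3) : sqLen (evV (curl v) x) ≤ 2 * jacSq v x := by
  simp only [sqLen, dot_eq, evV, curl, jacSq, Fin.sum_univ_three, Matrix.cons_val_zero,
    Matrix.cons_val_one, Matrix.cons_val, ev_sub]
  nlinarith [sq_nonneg (ev (MvPolynomial.pderiv 1 (v 2)) x + ev (MvPolynomial.pderiv 2 (v 1)) x),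
    sq_nonneg (ev (MvPolynomial.pderiv 2 (v 0)) x + ev (MvPolynomial.pderiv 0 (v 2)) x),
    sq_nonneg (ev (MvPolynomial.pderiv 0 (v 1)) x + ev (MvPolynomial.pderiv 1 (v 0)) x),
    sq_nonneg (ev (MvPolynomial.pderiv 0 (v 0)) x), sq_nonneg (ev (MvPolynomial.pderiv 1 (v 1)) x),
    sq_nonneg (ev (MvPolynomial.pderiv 2 (v 2)) x)]

lemma ev_divg_sq_le (v : VPoly) (x : E3) : ev (divg v) x ^ 2 ≤ 3 * jacSq v x := by
  have h : ev (divg v) x ^ 2 ≤ 3 * ∑ i, ev (MvPolynomial.pderiv i (v i)) x ^ 2 := by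
    rw [divg, ev_sum]
    simpa using sq_sum_le_card_mul_sum_sq (s := (Finset.univ : Finset (Fin 3)))
      (f := fun i => ev (MvPolynomial.pderiv i (v i)) x)
  refine h.trans (mul_le_mul_of_nonneg_left (Finset.sum_le_sum fun i _ => ?_) (by norm_num))
  exact Finset.single_le_sum (f := fun j => ev (MvPolynomial.pderiv j (v i)) x ^ 2)
    (fun j _ => sq_nonneg _) (Finset.mem_univ i)

@[fun_prop]
lemma continuous_jacSq (v : VPoly) : Continuous (jacSq v) := by
  unfold jacSq
  fun_prop

lemma exists_volSum_grad_le (k : ℕ) {κ : ℝ} (hκ : 0 < κ) : ∃ C : ℝ, 0 < C ∧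
    ∀ {Ω : Set E3} (M : TetMesh Ω), M.ShapeRegular κ → ∀ w : M.Cell → ℝ, (∀ T, 0 ≤ w T) →
      ∀ p : M.Cell → Poly, (∀ T, p T ∈ polyDeg k) →
        volSum M (fun T x => w T * size T.1 ^ 2 * sqLen (evV (grad (p T)) x)) ≤
          C * volSum M (fun T x => w T * ev (p T) x ^ 2) := by
  obtain ⟨C, hC, h⟩ := exists_inverse k hκ
  refine ⟨3 * C, by positivity, fun M hM w hw p hp => ?_⟩
  simp only [sqLen_evV, Finset.mul_sum, grad]
  rw [volSum_finset_sum _ fun i T => by fun_prop]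
  have : ∀ j : Fin 3, volSum M (fun T x => w T * size T.1 ^ 2 *
      ev (MvPolynomial.pderiv j (p T)) x ^ 2) ≤ C * volSum M (fun T x => w T * ev (p T) x ^ 2) := by
    intro j
    rw [volSum, volSum, Finset.mul_sum]
    refine Finset.sum_le_sum fun T _ => ?_
    rw [cellInt, cellInt, integral_const_mul, integral_const_mul, mul_assoc]
    calc _ ≤ w T * (C * cellInt T.1 fun x => ev (p T) x ^ 2) :=
          mul_le_mul_of_nonneg_left (h T.1 (hM.isRegular T) (p T) (hp T) j) (hw T)
      _ = _ := by rw [cellInt]; ring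
  refine (Finset.sum_le_sum fun j _ => this j).trans_eq ?_
  simp
  ring

lemma exists_volSum_jacSq_le (k : ℕ) {κ : ℝ} (hκ : 0 < κ) : ∃ C : ℝ, 0 < C ∧
    ∀ {Ω : Set E3} (M : TetMesh Ω), M.ShapeRegular κ → ∀ w : M.Cell → ℝ, (∀ T, 0 ≤ w T) →
      ∀ v : M.Cell → VPoly, (∀ T i, v T i ∈ polyDeg k) →
        volSum M (fun T x => w T * size T.1 ^ 2 * jacSq (v T) x) ≤
          C * volSum M (fun T x => w T * sqLen (evV (v T) x)) := by
  obtain ⟨C, hC, h⟩ := exists_volSum_grad_le k hκ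
  refine ⟨C, hC, fun M hM w hw v hv => ?_⟩
  have e : ∀ (v : VPoly) x, jacSq v x = ∑ i, sqLen (evV (grad (v i)) x) := fun v x => by
    simp only [jacSq, sqLen_evV, grad]
  simp only [e, sqLen_evV (v _), Finset.mul_sum]
  rw [volSum_finset_sum, volSum_finset_sum, Finset.mul_sum]
  · exact Finset.sum_le_sum fun i _ => h M hM w hw (fun T => v T i) fun T => hv T i
  · exact fun i T => by fun_prop
  · exact fun i T => continuousOn_const.mul (continuousOn_sqLen (continuousOn_evV _ _))

end Mesh

/-! ### Polynomials in Bernstein form -/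

lemma affPoly_mem (c : ℝ) (g : Vec) : affPoly c g ∈ polyDeg 1 := by
  refine Submodule.add_mem _ ?_ (Submodule.sum_mem _ fun j _ => ?_)
  · rw [MvPolynomial.mem_restrictTotalDegree, MvPolynomial.totalDegree_C]
    exact Nat.zero_le _
  · rw [MvPolynomial.mem_restrictTotalDegree]
    refine (MvPolynomial.totalDegree_mul _ _).trans ?_
    rw [MvPolynomial.totalDegree_C, MvPolynomial.totalDegree_X]

lemma bernPoly_mem (k : ℕ) (s : Finset E3) (c : E3 → ℝ) (g : E3 → Vec) (d : (E3 →₀ ℕ) → ℝ) :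
    bernPoly k s c g d ∈ polyDeg k := by
  refine Submodule.sum_mem _ fun α hα => Submodule.smul_mem _ _ ?_
  rw [MvPolynomial.mem_restrictTotalDegree]
  refine (MvPolynomial.totalDegree_finsetProd _ _).trans ?_
  rw [← (Finset.mem_finsuppAntidiag.1 hα).1]
  refine Finset.sum_le_sum fun v _ => (MvPolynomial.totalDegree_pow _ _).trans ?_
  have := (MvPolynomial.mem_restrictTotalDegree (σ := Fin 3) (R := ℝ) 1 _).1 (affPoly_mem (c v) (g v))
  nlinarith

/-- The restriction of a polynomial in Bernstein form to a face depends only on the coefficients of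
this face. -/
lemma ev_bernPoly_face (k : ℕ) {s t : Finset E3} {c : E3 → ℝ} {g : E3 → Vec} (hb : IsBary s c g)
    (hts : t ⊆ s) (d : (E3 →₀ ℕ) → ℝ) {μ : E3 → ℝ} (hμ : ∑ v ∈ t, μ v = 1) :
    ev (bernPoly k s c g d) (∑ v ∈ t, μ v • v) =
      ∑ α ∈ t.finsuppAntidiag k, d α * ∏ v ∈ t, μ v ^ α v := by
  classical
  -- The weights on the face are extended by zero to the remaining vertex.
  set ν : E3 → ℝ := fun v => if v ∈ t then μ v else 0 with hν
  have hν1 : ∑ v ∈ s, ν v = 1 := by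
    rw [← hμ, hν, ← Finset.sum_filter, Finset.filter_mem_eq_inter, Finset.inter_eq_right.2 hts]
  have hν2 : ∑ v ∈ t, μ v • v = ∑ v ∈ s, ν v • v := by
    simp only [hν, ite_smul, zero_smul]
    rw [← Finset.sum_filter, Finset.filter_mem_eq_inter, Finset.inter_eq_right.2 hts]
  rw [hν2, bernPoly, ev_sum]
  have h1 : ∀ α ∈ s.finsuppAntidiag k,
      ev (d α • ∏ v ∈ s, affPoly (c v) (g v) ^ α v) (∑ v ∈ s, ν v • v) =
        d α * ∏ v ∈ s, ν v ^ α v := by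
    intro α _
    rw [ev_smul, ev_prod]
    congr 1
    exact Finset.prod_congr rfl fun v hv => by rw [ev_pow, hb.ev_sum hν1 hv]
  rw [Finset.sum_congr rfl h1]
  have hsub : t.finsuppAntidiag k ⊆ s.finsuppAntidiag k := Finset.finsuppAntidiag_mono hts k
  rw [← Finset.sum_subset hsub]
  · refine Finset.sum_congr rfl fun α hα => ?_
    have hαt := (Finset.mem_finsuppAntidiag.1 hα).2
    congr 1
    rw [← Finset.prod_subset hts]
    · exact Finset.prod_congr rfl fun v hv => by rw [hν]; simp only [if_pos hv]
    · intro v _ hv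
      have : α v = 0 := by
        by_contra h
        exact hv (hαt (Finsupp.mem_support_iff.2 h))
      rw [this, pow_zero]
  -- A multi-index that involves a vertex off the face produces a factor zero.
  · intro α hα hαt
    rw [Finset.mem_finsuppAntidiag] at hα
    have : ¬ α.support ⊆ t := fun h => hαt <| Finset.mem_finsuppAntidiag.2 ⟨by
      rw [← hα.1]
      exact Finset.sum_subset hts fun v _ hv => by
        by_contra h'
        exact hv (h (Finsupp.mem_support_iff.2 h')), h⟩
    obtain ⟨v, hv, hvt⟩ := Finset.not_subset.1 this
    rw [Finset.prod_eq_zero (hα.2 hv), mul_zero]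
    simp only [hν, if_neg hvt]
    exact zero_pow (Finsupp.mem_support_iff.1 hv)

/-- The norm equivalence, with a vanishing integral. It turns the boundary condition for `p̂` into
one for its coefficients. -/
lemma bcoef_eq_zero {n k : ℕ} {s : Finset E3} (hs : IsSimplex n s) {p : Poly} (hp : p ∈ polyDeg k)
    (h : ∀ x ∈ hull s, ev p x = 0) : ∀ α ∈ s.finsuppAntidiag k, bcoef k p α = 0 := by
  obtain ⟨a, ha⟩ := hs.exists_enumerates
  obtain ⟨C, hC, hle⟩ := exists_coefSq_le n k
  have h1 := hle s a ha p hp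
  have h2 : ∫ y in corner n, ev p (par a y) ^ 2 = 0 := by
    rw [setIntegral_congr_fun (g := fun _ => (0 : ℝ)) (measurableSet_corner n), integral_zero]
    intro y hy
    have hmem : par a y ∈ hull s := by
      rw [← ha.convexHull, convexHull_range_eq_image]
      exact Set.mem_image_of_mem _ hy
    simp [h _ hmem]
  rw [h2, mul_zero] at h1
  intro α hα
  have h3 := (Finset.sum_eq_zero_iff_of_nonneg fun α _ => sq_nonneg (bcoef k p α)).1
    (le_antisymm h1 (coefSq_nonneg k s p)) α hα
  exact pow_eq_zero_iff (two_ne_zero) |>.1 h3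

/-! ### Nodal averages on the components of the star of a multi-index -/

section Star

variable {Ω : Set E3} (M : TetMesh Ω)

/-- Two cells are adjacent at the multi-index `α` if they share a face that contains the support of
`α`. -/
def starGraph (α : E3 →₀ ℕ) : SimpleGraph M.Cell :=
  SimpleGraph.fromRel fun S T => ∃ F : M.Face, F.1 ⊆ S.1 ∧ F.1 ⊆ T.1 ∧ α.support ⊆ F.1

variable {M}

lemma starGraph_adj {α : E3 →₀ ℕ} {S T : M.Cell} (h : (starGraph M α).Adj S T) :
    ∃ F : M.Face, F.1 ⊆ S.1 ∧ F.1 ⊆ T.1 ∧ α.support ⊆ F.1 := by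
  rw [starGraph, SimpleGraph.fromRel_adj] at h
  rcases h.2 with ⟨F, h1, h2, h3⟩ | ⟨F, h1, h2, h3⟩
  exacts [⟨F, h1, h2, h3⟩, ⟨F, h2, h1, h3⟩]

lemma starGraph_reachable {α : E3 →₀ ℕ} {S T : M.Cell} {F : M.Face} (hS : F.1 ⊆ S.1)
    (hT : F.1 ⊆ T.1) (hF : α.support ⊆ F.1) : (starGraph M α).Reachable S T := by
  rcases eq_or_ne S T with rfl | h
  · exact SimpleGraph.Reachable.refl _
  · refine SimpleGraph.Adj.reachable ?_
    rw [starGraph, SimpleGraph.fromRel_adj]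
    exact ⟨h, Or.inl ⟨F, hS, hT, hF⟩⟩

/-- Consecutive cells of a walk share a face that contains the support. -/
lemma starGraph_support_subset {α : E3 →₀ ℕ} {T S : M.Cell} (w : (starGraph M α).Walk T S)
    (hT : α.support ⊆ T.1) : ∀ X ∈ w.support, α.support ⊆ X.1 := by
  induction w with
  | nil => simpa using hT
  | cons h w ih =>
    intro X hX
    rw [SimpleGraph.Walk.support_cons, List.mem_cons] at hX
    rcases hX with rfl | hX
    · exact hT
    · obtain ⟨F, _, h2, h3⟩ := starGraph_adj h
      exact ih (h3.trans h2) X hX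

lemma starGraph_reachable_subset {α : E3 →₀ ℕ} {T S : M.Cell} (h : (starGraph M α).Reachable T S)
    (hT : α.support ⊆ T.1) : α.support ⊆ S.1 := by
  obtain ⟨w⟩ := h
  exact starGraph_support_subset w hT S w.end_mem_support

/-- A path does not repeat cells, and all of its cells contain the support of `α`, so it visits at
most `κ³` of them. -/
lemma exists_short_walk {κ : ℝ} (hκ : 0 < κ) (hM : M.ShapeRegular κ) {α : E3 →₀ ℕ}
    (hα : α.support.Nonempty) {T S : M.Cell} (h : (starGraph M α).Reachable T S)
    (hT : α.support ⊆ T.1) : ∃ w : (starGraph M α).Walk T S, (w.length : ℝ) ≤ κ ^ 3 := by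
  classical
  obtain ⟨w, hw⟩ := h.exists_isPath
  refine ⟨w, le_trans ?_ (hM.card_cells_superset_le hκ hα)⟩
  have h1 : w.support.toFinset ⊆ Finset.univ.filter fun T : M.Cell => α.support ⊆ T.1 := by
    intro X hX
    rw [Finset.mem_filter]
    exact ⟨Finset.mem_univ _, starGraph_support_subset w hT X (List.mem_toFinset.1 hX)⟩
  have h2 := Finset.card_le_card h1
  rw [List.toFinset_card_of_nodup hw.support_nodup, SimpleGraph.Walk.length_support] at h2
  have h3 : w.length ≤ (Finset.univ.filter fun T : M.Cell => α.support ⊆ T.1).card := by omega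
  exact_mod_cast h3

/-- The component of the cell `T` in the star of `α` has a boundary face at `α`. -/
def TouchesBoundary (α : E3 →₀ ℕ) (T : M.Cell) : Prop :=
  ∃ S : M.Cell, (starGraph M α).Reachable T S ∧
    ∃ F : M.Face, M.IsBoundary F ∧ F.1 ⊆ S.1 ∧ α.support ⊆ F.1

/-- A representative of a component of the star. -/
def starRep {α : E3 →₀ ℕ} (c : (starGraph M α).ConnectedComponent) : M.Cell := c.exists_rep.choose

lemma reachable_starRep (α : E3 →₀ ℕ) (T : M.Cell) :
    (starGraph M α).Reachable T (starRep ((starGraph M α).connectedComponentMk T)) :=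
  SimpleGraph.ConnectedComponent.exact
    ((starGraph M α).connectedComponentMk T).exists_rep.choose_spec.symm

open scoped Classical in
/-- The value at `α` of the conforming approximation of the coefficients `b` in the cell `T`: zero if
the component of `T` touches the boundary, and the coefficient of a representative otherwise. -/
def nodal (b : M.Cell → ℝ) (α : E3 →₀ ℕ) (T : M.Cell) : ℝ :=
  if TouchesBoundary α T then 0 else b (starRep ((starGraph M α).connectedComponentMk T))

/-- Both the case distinction and the representative depend only on the component. Since cells on
either side of a face at `α` are in the same component, this yields continuity. -/
lemma nodal_eq (b : M.Cell → ℝ) {α : E3 →₀ ℕ} {S T : M.Cell}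
    (h : (starGraph M α).Reachable S T) : nodal b α S = nodal b α T := by
  have h1 : TouchesBoundary α S ↔ TouchesBoundary α T :=
    ⟨fun ⟨X, hX, hF⟩ => ⟨X, h.symm.trans hX, hF⟩, fun ⟨X, hX, hF⟩ => ⟨X, h.trans hX, hF⟩⟩
  have h2 : (starGraph M α).connectedComponentMk S = (starGraph M α).connectedComponentMk T :=
    SimpleGraph.ConnectedComponent.sound h
  unfold nodal
  rw [h2]
  by_cases h3 : TouchesBoundary α T
  · rw [if_pos h3, if_pos (h1.2 h3)]
  · rw [if_neg h3, if_neg fun h4 => h3 (h1.1 h4)]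

lemma nodal_boundary (b : M.Cell → ℝ) {α : E3 →₀ ℕ} {T : M.Cell} {F : M.Face}
    (hF : M.IsBoundary F) (hFT : F.1 ⊆ T.1) (hα : α.support ⊆ F.1) : nodal b α T = 0 := by
  rw [nodal, if_pos]
  exact ⟨T, SimpleGraph.Reachable.refl _, F, hF, hFT, hα⟩

/-- Telescoping along the walk. Differences need to be bounded only inside the component of the
starting cell. -/
lemma abs_sub_le_of_walk {α : E3 →₀ ℕ} {b : M.Cell → ℝ} {D : ℝ} {T S : M.Cell}
    (w : (starGraph M α).Walk T S)
    (hD : ∀ X Y, (starGraph M α).Reachable T X → (starGraph M α).Adj X Y → |b X - b Y| ≤ D) :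
    |b T - b S| ≤ w.length * D := by
  induction w with
  | nil => simp
  | cons h w ih =>
    have h1 := ih fun X Y hX hXY => hD X Y (h.reachable.trans hX) hXY
    have h2 := hD _ _ (SimpleGraph.Reachable.refl _) h
    rw [SimpleGraph.Walk.length_cons]
    push_cast
    refine (abs_sub_le _ _ _).trans ((add_le_add h2 h1).trans_eq ?_)
    ring

/-- Neighbouring cells have comparable sizes because both are comparable with the face they share.
-/
lemma size_le_of_walk {κ K : ℝ} (hκ : 0 < κ) (hK : 1 ≤ K) (hK2 : κ ≤ 2 * K)
    (hM : M.ShapeRegular κ) {α : E3 →₀ ℕ} {T S : M.Cell} (w : (starGraph M α).Walk T S) :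
    size T.1 ≤ K ^ w.length * size S.1 := by
  induction w with
  | nil => simp
  | @cons X Y Z h w ih =>
    obtain ⟨F, h1, h2, _⟩ := starGraph_adj h
    have h3 := hM.cell_size_le hκ h1
    have h4 := TetMesh.face_size_le h2
    have h5 := (TetMesh.face_size_pos F).le
    rw [SimpleGraph.Walk.length_cons, pow_succ]
    have h6 : size X.1 ≤ K * size Y.1 := by
      refine le_of_mul_le_mul_left (h3.trans ?_) two_pos
      calc κ * size F.1 ≤ (2 * K) * size F.1 := mul_le_mul_of_nonneg_right hK2 h5
        _ ≤ (2 * K) * size Y.1 := mul_le_mul_of_nonneg_left h4 (by positivity)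
        _ = _ := by ring
    calc _ ≤ K * size Y.1 := h6
      _ ≤ K * (K ^ w.length * size Z.1) := mul_le_mul_of_nonneg_left ih (by positivity)
      _ = _ := by ring

open scoped Classical in
/-- The sum over all pairs of a cell and a face of this cell at `α`. -/
def starSum (M : TetMesh Ω) (α : E3 →₀ ℕ) (f : M.Cell → M.Face → ℝ) : ℝ :=
  ∑ S : M.Cell with α.support ⊆ S.1, ∑ F : M.Face with F.1 ⊆ S.1 ∧ α.support ⊆ F.1, f S F

lemma starSum_mono {α : E3 →₀ ℕ} {f g : M.Cell → M.Face → ℝ}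
    (h : ∀ S F, α.support ⊆ S.1 → F.1 ⊆ S.1 → α.support ⊆ F.1 → f S F ≤ g S F) :
    starSum M α f ≤ starSum M α g :=
  Finset.sum_le_sum fun S hS => Finset.sum_le_sum fun F hF =>
    h S F (Finset.mem_filter.1 hS).2 (Finset.mem_filter.1 hF).2.1 (Finset.mem_filter.1 hF).2.2

lemma starSum_mul (α : E3 →₀ ℕ) (c : ℝ) (f : M.Cell → M.Face → ℝ) :
    starSum M α (fun S F => c * f S F) = c * starSum M α f := by
  simp only [starSum, Finset.mul_sum]

lemma le_starSum {α : E3 →₀ ℕ} {f : M.Cell → M.Face → ℝ} (hf : ∀ S F, 0 ≤ f S F) {S : M.Cell}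
    {F : M.Face} (hS : α.support ⊆ S.1) (hFS : F.1 ⊆ S.1) (hF : α.support ⊆ F.1) :
    f S F ≤ starSum M α f := by
  classical
  have h1 : f S F ≤ ∑ F : M.Face with F.1 ⊆ S.1 ∧ α.support ⊆ F.1, f S F :=
    Finset.single_le_sum (f := f S) (fun F _ => hf S F)
      (Finset.mem_filter.2 ⟨Finset.mem_univ F, hFS, hF⟩)
  refine h1.trans ?_
  unfold starSum
  have hS' : S ∈ Finset.univ.filter fun S : M.Cell => α.support ⊆ S.1 :=
    Finset.mem_filter.2 ⟨Finset.mem_univ S, hS⟩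
  rw [← Finset.add_sum_erase _ _ hS']
  exact le_add_of_nonneg_right (Finset.sum_nonneg fun S _ => Finset.sum_nonneg fun F _ => hf S F)

/-- Cauchy–Schwarz twice: at most `κ³` cells contain the support, and each cell has at most four
faces at it. -/
lemma starSum_sq_le {κ : ℝ} (hκ : 0 < κ) (hM : M.ShapeRegular κ) {α : E3 →₀ ℕ}
    (hα : α.support.Nonempty) (f : M.Cell → M.Face → ℝ) :
    starSum M α f ^ 2 ≤ 4 * κ ^ 3 * starSum M α (fun S F => f S F ^ 2) := by
  classical
  rw [starSum, starSum, Finset.mul_sum]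
  refine sq_sum_le_card_mul_sum_sq.trans ?_
  rw [Finset.mul_sum]
  refine Finset.sum_le_sum fun S _ => ?_
  have h1 : ((Finset.univ.filter fun F : M.Face => F.1 ⊆ S.1 ∧ α.support ⊆ F.1).card : ℝ) ≤ 4 := by
    have h2 : (Finset.univ.filter fun F : M.Face => F.1 ⊆ S.1).card = 4 := by
      have := TetMesh.sum_faces S (fun _ => 1)
      rw [Finset.sum_const, Finset.sum_const, (TetMesh.cell_isSimplex S).card] at this
      simpa using this
    have h3 : (Finset.univ.filter fun F : M.Face => F.1 ⊆ S.1 ∧ α.support ⊆ F.1).card ≤ 4 :=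
      (Finset.card_le_card fun F hF => by
        simp only [Finset.mem_filter, Finset.mem_univ, true_and] at hF ⊢
        exact hF.1).trans h2.le
    exact_mod_cast h3
  have h3 := hM.card_cells_superset_le hκ hα
  have h4 : 0 ≤ ∑ F : M.Face with F.1 ⊆ S.1 ∧ α.support ⊆ F.1, f S F ^ 2 :=
    Finset.sum_nonneg fun _ _ => sq_nonneg _
  calc _ ≤ κ ^ 3 * (4 * ∑ F : M.Face with F.1 ⊆ S.1 ∧ α.support ⊆ F.1, f S F ^ 2) := by
        refine mul_le_mul h3 (sq_sum_le_card_mul_sum_sq.trans ?_) (sq_nonneg _) (by positivity)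
        exact mul_le_mul_of_nonneg_right h1 h4
    _ = _ := by ring

/-- The error of the nodal values is bounded by the jumps in the star. -/
theorem exists_nodal_error_le {κ : ℝ} (hκ : 0 < κ) : ∃ C : ℝ, 0 < C ∧
    ∀ {Ω : Set E3} (M : TetMesh Ω), M.ShapeRegular κ → ∀ α : E3 →₀ ℕ, α.support.Nonempty →
      ∀ (b : M.Cell → ℝ) (bhat : M.Face → ℝ),
        (∀ F, M.IsBoundary F → α.support ⊆ F.1 → bhat F = 0) → ∀ T : M.Cell, α.support ⊆ T.1 →
          size T.1 * (b T - nodal b α T) ^ 2 ≤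
            C * starSum M α fun S F => size S.1 * (b S - bhat F) ^ 2 := by
  classical
  -- One step of a walk changes the size by at most the factor `K`. The maximum with one makes its
  -- powers increase with the length, which is at most `N`.
  set K : ℝ := max 1 κ with hKdef
  set N : ℕ := ⌊κ ^ 3⌋₊ with hN
  have hK1 : 1 ≤ K := le_max_left _ _
  have hKκ : κ ≤ 2 * K := by have := le_max_right 1 κ; linarith
  refine ⟨K ^ N * ((2 * κ ^ 3 + 1) ^ 2 * (4 * κ ^ 3)), by positivity,
    fun M hM α hα b bhat hbd T hT => ?_⟩
  -- Jumps in other components are dropped, since only cells reachable from `T` have sizes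
  -- comparable with that of `T` through the walks.
  set f : M.Cell → M.Face → ℝ := fun S F =>
    if (starGraph M α).Reachable T S then |b S - bhat F| else 0 with hf
  have hf0 : ∀ S F, 0 ≤ f S F := fun S F => by
    simp only [hf]
    split_ifs
    exacts [abs_nonneg _, le_rfl]
  set D := starSum M α f with hD
  have hjump : ∀ S F, (starGraph M α).Reachable T S → F.1 ⊆ S.1 → α.support ⊆ F.1 →
      |b S - bhat F| ≤ D := by
    intro S F hS hFS hF
    have := le_starSum hf0 (starGraph_reachable_subset hS hT) hFS hF
    simpa only [hf, if_pos hS] using this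
  have hD0 : 0 ≤ D := Finset.sum_nonneg fun S _ => Finset.sum_nonneg fun F _ => hf0 S F
  -- Crossing a face costs two jumps, from `b X` to `bhat F` and on to `b Y`.
  have hwalk : ∀ S, (starGraph M α).Reachable T S → |b T - b S| ≤ κ ^ 3 * (2 * D) := by
    intro S hS
    obtain ⟨w, hw⟩ := exists_short_walk hκ hM hα hS hT
    refine (abs_sub_le_of_walk w (D := 2 * D) fun X Y hX hXY => ?_).trans
      (mul_le_mul_of_nonneg_right hw (by positivity))
    obtain ⟨F, h1, h2, h3⟩ := starGraph_adj hXY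
    have h4 := hjump X F hX h1 h3
    have h5 := hjump Y F (hX.trans hXY.reachable) h2 h3
    rw [abs_sub_comm] at h5
    linarith [abs_sub_le (b X) (bhat F) (b Y)]
  have herr : |b T - nodal b α T| ≤ (2 * κ ^ 3 + 1) * D := by
    rw [nodal]
    split_ifs with h
    -- At a boundary face `bhat` vanishes, so the value `b S` is itself a jump and ends the path at
    -- zero.
    · obtain ⟨S, hS, F, hF, hFS, hαF⟩ := h
      have h1 := hwalk S hS
      have h2 := hjump S F hS hFS hαF
      rw [hbd F hF hαF] at h2
      linarith [abs_sub_le (b T) (b S) 0]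
    · linarith [hwalk _ (reachable_starRep α T)]
  have hsq : (b T - nodal b α T) ^ 2 ≤ (2 * κ ^ 3 + 1) ^ 2 * D ^ 2 := by
    rw [← sq_abs, ← mul_pow]
    exact pow_le_pow_left₀ (abs_nonneg _) herr 2
  have hDsq := starSum_sq_le hκ hM hα f
  have hsz := TetMesh.cell_size_pos T
  calc size T.1 * (b T - nodal b α T) ^ 2
      ≤ size T.1 * ((2 * κ ^ 3 + 1) ^ 2 * D ^ 2) := mul_le_mul_of_nonneg_left hsq hsz.le
    _ ≤ size T.1 * ((2 * κ ^ 3 + 1) ^ 2 * (4 * κ ^ 3 * starSum M α (fun S F => f S F ^ 2))) := by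
        gcongr
    _ = ((2 * κ ^ 3 + 1) ^ 2 * (4 * κ ^ 3)) * starSum M α (fun S F => size T.1 * f S F ^ 2) := by
        rw [starSum_mul]; ring
    _ ≤ ((2 * κ ^ 3 + 1) ^ 2 * (4 * κ ^ 3)) *
          starSum M α (fun S F => K ^ N * (size S.1 * (b S - bhat F) ^ 2)) := by
        refine mul_le_mul_of_nonneg_left (starSum_mono fun S F _ _ _ => ?_) (by positivity)
        have hS0 := TetMesh.cell_size_pos S
        simp only [hf]
        split_ifs with h
        -- The weight is moved from the cell `T` to the cell `S` along a short walk.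
        · obtain ⟨w, hw⟩ := exists_short_walk hκ hM hα h hT
          have h1 := size_le_of_walk hκ hK1 hKκ hM w
          have h2 : K ^ w.length ≤ K ^ N := pow_le_pow_right₀ hK1 (Nat.le_floor hw)
          rw [sq_abs, ← mul_assoc]
          refine mul_le_mul_of_nonneg_right (h1.trans ?_) (sq_nonneg _)
          exact mul_le_mul_of_nonneg_right h2 hS0.le
        · rw [zero_pow two_ne_zero, mul_zero]
          positivity
    _ = _ := by rw [starSum_mul]; ring

end Star

/-! ### Approximation by conforming piecewise polynomials -/

/-- A discontinuous piecewise polynomial is approximated by one that is continuous across the faces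
and vanishes on the boundary, up to the jumps. -/
theorem exists_conforming {k : ℕ} (hk : 1 ≤ k) {κ : ℝ} (hκ : 0 < κ) : ∃ C : ℝ, 0 < C ∧
    ∀ {Ω : Set E3} (M : TetMesh Ω), M.ShapeRegular κ →
      ∀ p : M.Cell → Poly, (∀ T, p T ∈ polyDeg k) → ∀ phat : M.Face → Poly,
        (∀ F, phat F ∈ polyDeg k) → (∀ F, M.IsBoundary F → ∀ x ∈ hull F.1, ev (phat F) x = 0) →
          ∃ pI : M.Cell → Poly, (∀ T, pI T ∈ polyDeg k) ∧
            (∀ (F : M.Face) (S T : M.Cell), F.1 ⊆ S.1 → F.1 ⊆ T.1 →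
              ∀ x ∈ hull F.1, ev (pI S) x = ev (pI T) x) ∧
            (∀ (F : M.Face) (T : M.Cell), M.IsBoundary F → F.1 ⊆ T.1 →
              ∀ x ∈ hull F.1, ev (pI T) x = 0) ∧
            volSum M (fun T x => sqLen (evV (grad (p T - pI T)) x)) ≤
              C * bdrySum M (fun T F x => (size F.1)⁻¹ * (ev (p T) x - ev (phat F) x) ^ 2) := by
  classical
  obtain ⟨C1, hC1, hnodal⟩ := exists_nodal_error_le hκ
  obtain ⟨C2, hC2, hgrad⟩ := exists_gradient_le k hκ
  obtain ⟨C3, hC3, hface⟩ := exists_coefSq_le_faceInt k hκ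
  refine ⟨3 * C2 * (κ ^ 3 * C1 * C3), by positivity, fun M hM p hp phat hphat hbd => ?_⟩
  choose c g hb using fun T : M.Cell => exists_isBary (TetMesh.cell_isSimplex T)
  set b : (E3 →₀ ℕ) → M.Cell → ℝ := fun α T => bcoef k (p T) α with hbdef
  set bhat : (E3 →₀ ℕ) → M.Face → ℝ := fun α F => bcoef k (phat F) α with hbhat
  -- Here `1 ≤ k` enters: a multi-index of order `k` involves at least one vertex, so its star can
  -- be counted.
  have hsupp : ∀ {t : Finset E3} {α : E3 →₀ ℕ}, α ∈ t.finsuppAntidiag k → α.support.Nonempty := by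
    intro t α hα
    rw [Finset.mem_finsuppAntidiag] at hα
    rw [Finsupp.support_nonempty_iff]
    rintro rfl
    simp at hα
    omega
  -- The approximation has the nodal values as coefficients. On a face only the multi-indices
  -- supported in it matter, and these have equal values from both sides, or zero on the boundary.
  refine ⟨fun T => bernPoly k T.1 (c T) (g T) fun α => nodal (b α) α T, fun T => bernPoly_mem _ _ _ _ _,
    fun F S T hS hT x hx => ?_, fun F T hF hT x hx => ?_, ?_⟩
  · obtain ⟨μ, -, h1, rfl⟩ := mem_hull_iff.1 hx
    rw [ev_bernPoly_face k (hb S) hS _ h1, ev_bernPoly_face k (hb T) hT _ h1]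
    refine Finset.sum_congr rfl fun α hα => ?_
    rw [nodal_eq (b α) (starGraph_reachable hS hT (Finset.mem_finsuppAntidiag.1 hα).2)]
  · obtain ⟨μ, -, h1, rfl⟩ := mem_hull_iff.1 hx
    rw [ev_bernPoly_face k (hb T) hT _ h1]
    refine Finset.sum_eq_zero fun α hα => ?_
    rw [nodal_boundary (b α) hF hT (Finset.mem_finsuppAntidiag.1 hα).2, zero_mul]
  have hsub : ∀ T, p T - bernPoly k T.1 (c T) (g T) (fun α => nodal (b α) α T) =
      bernPoly k T.1 (c T) (g T) (fun α => b α T - nodal (b α) α T) := by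
    intro T
    conv_lhs => rw [eq_bernPoly (hb T) (hp T)]
    simp only [bernPoly, ← Finset.sum_sub_distrib, ← sub_smul, hbdef]
  set E : (E3 →₀ ℕ) → M.Cell → ℝ := fun α T => size T.1 * (b α T - nodal (b α) α T) ^ 2 with hE
  set H : (E3 →₀ ℕ) → M.Cell → M.Face → ℝ := fun α S F => size S.1 * (b α S - bhat α F) ^ 2 with hH
  -- the gradient is bounded by the errors of the coefficients
  have hgradient : volSum M (fun T x => sqLen (evV (grad (p T -
      bernPoly k T.1 (c T) (g T) fun α => nodal (b α) α T)) x)) ≤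
      3 * C2 * ∑ T : M.Cell, ∑ α ∈ T.1.finsuppAntidiag k, E α T := by
    simp only [hsub, sqLen_evV, grad]
    rw [volSum_finset_sum _ fun i T => by fun_prop]
    have : ∀ j : Fin 3, volSum M (fun T x => ev (MvPolynomial.pderiv j (bernPoly k T.1 (c T) (g T)
        (fun α => b α T - nodal (b α) α T))) x ^ 2) ≤
        C2 * ∑ T : M.Cell, ∑ α ∈ T.1.finsuppAntidiag k, E α T := by
      intro j
      rw [volSum, Finset.mul_sum]
      refine Finset.sum_le_sum fun T _ => ?_
      refine (hgrad T.1 (hM.isRegular T) _ _ (hb T) _ j).trans_eq ?_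
      simp only [hE, ← Finset.mul_sum]
      ring
    refine (Finset.sum_le_sum fun j _ => this j).trans_eq ?_
    simp
    ring
  -- All multi-indices of the mesh, so that sums over cells and sums over multi-indices can be
  -- interchanged.
  set A : Finset (E3 →₀ ℕ) := Finset.univ.biUnion fun T : M.Cell => T.1.finsuppAntidiag k with hA
  have hAmem : ∀ α ∈ A, α.support.Nonempty ∧ ∀ t : Finset E3, α.support ⊆ t →
      α ∈ t.finsuppAntidiag k := by
    intro α hα
    obtain ⟨T, -, hT⟩ := Finset.mem_biUnion.1 hα
    refine ⟨hsupp hT, fun t ht => Finset.mem_finsuppAntidiag.2 ⟨?_, ht⟩⟩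
    rw [Finset.mem_finsuppAntidiag] at hT
    rw [← hT.1, ← Finset.sum_subset ht fun v _ hv => Finsupp.notMem_support_iff.1 hv,
      ← Finset.sum_subset hT.2 fun v _ hv => Finsupp.notMem_support_iff.1 hv]
  have hswap1 : ∑ T : M.Cell, ∑ α ∈ T.1.finsuppAntidiag k, E α T =
      ∑ α ∈ A, ∑ T : M.Cell with α.support ⊆ T.1, E α T := by
    refine Finset.sum_comm' fun T α => ?_
    constructor
    · rintro ⟨_, hα⟩
      exact ⟨Finset.mem_filter.2 ⟨Finset.mem_univ _, (Finset.mem_finsuppAntidiag.1 hα).2⟩,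
        Finset.mem_biUnion.2 ⟨T, Finset.mem_univ _, hα⟩⟩
    · rintro ⟨hT, hα⟩
      exact ⟨Finset.mem_univ _, (hAmem α hα).2 _ (Finset.mem_filter.1 hT).2⟩
  -- At most `κ³` cells share the node, and each of them has the same bound by the jumps in the
  -- star.
  have hnodes : ∀ α ∈ A, ∑ T : M.Cell with α.support ⊆ T.1, E α T ≤
      κ ^ 3 * (C1 * starSum M α (H α)) := by
    intro α hα
    have h0 : 0 ≤ starSum M α (H α) := Finset.sum_nonneg fun S _ => Finset.sum_nonneg fun F _ =>
      mul_nonneg (TetMesh.cell_size_pos S).le (sq_nonneg _)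
    have h1 : ∀ T ∈ Finset.univ.filter fun T : M.Cell => α.support ⊆ T.1,
        E α T ≤ C1 * starSum M α (H α) := by
      intro T hT
      refine hnodal M hM α (hAmem α hα).1 (b α) (bhat α) (fun F hF hαF => ?_) T
        (Finset.mem_filter.1 hT).2
      exact bcoef_eq_zero (TetMesh.face_isSimplex F) (hphat F) (hbd F hF) α ((hAmem α hα).2 _ hαF)
    refine (Finset.sum_le_card_nsmul _ _ _ h1).trans ?_
    rw [nsmul_eq_mul]
    exact mul_le_mul_of_nonneg_right (hM.card_cells_superset_le hκ (hAmem α hα).1) (by positivity)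
  have hswap2 : ∑ α ∈ A, starSum M α (H α) =
      ∑ S : M.Cell, ∑ F : M.Face with F.1 ⊆ S.1, ∑ α ∈ F.1.finsuppAntidiag k, H α S F := by
    simp only [starSum]
    rw [Finset.sum_comm' (t' := Finset.univ) (s' := fun S => A.filter fun α => α.support ⊆ S.1)
      (fun α S => by simp)]
    refine Finset.sum_congr rfl fun S _ => ?_
    refine Finset.sum_comm' fun α F => ?_
    simp only [Finset.mem_filter, Finset.mem_univ, true_and]
    constructor
    · rintro ⟨⟨hα, _⟩, hF, hαF⟩
      exact ⟨(hAmem α hα).2 _ hαF, hF⟩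
    · rintro ⟨hα, hF⟩
      have h1 := (Finset.mem_finsuppAntidiag.1 hα).2
      exact ⟨⟨Finset.mem_biUnion.2 ⟨S, Finset.mem_univ _, Finset.finsuppAntidiag_mono hF k hα⟩,
        h1.trans hF⟩, hF, h1⟩
  -- On a face, the differences of coefficients are the coefficients of `p S - phat F`, and the norm
  -- equivalence on the face applies. Finally `h_T⁻¹` is at most `h_F⁻¹`.
  have hfaces : ∑ S : M.Cell, ∑ F : M.Face with F.1 ⊆ S.1, ∑ α ∈ F.1.finsuppAntidiag k, H α S F ≤
      C3 * bdrySum M (fun T F x => (size F.1)⁻¹ * (ev (p T) x - ev (phat F) x) ^ 2) := by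
    rw [bdrySum, Finset.mul_sum]
    refine Finset.sum_le_sum fun S _ => ?_
    rw [Finset.mul_sum]
    refine Finset.sum_le_sum fun F hF => ?_
    have hFS := (Finset.mem_filter.1 hF).2
    have hS0 := TetMesh.cell_size_pos S
    have hF0 := TetMesh.face_size_pos F
    obtain ⟨v, hv, hFv⟩ := TetMesh.exists_eq_erase hFS
    have h1 := hface S.1 (hM.isRegular S) v hv (p S - phat F)
      (Submodule.sub_mem _ (hp S) (hphat F))
    rw [← hFv] at h1
    have h2 : ∑ α ∈ F.1.finsuppAntidiag k, H α S F = size S.1 * coefSq k F.1 (p S - phat F) := by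
      rw [coefSq, Finset.mul_sum]
      exact Finset.sum_congr rfl fun α _ => by rw [bcoef_sub]
    rw [h2, faceInt, integral_const_mul]
    simp only [ev_sub] at h1
    set I := ∫ x in hull F.1, (ev (p S) x - ev (phat F) x) ^ 2 ∂μHE[2] with hI
    have hI0 : 0 ≤ I := integral_nonneg fun x => sq_nonneg _
    have h3 : size S.1 * coefSq k F.1 (p S - phat F) ≤ C3 * ((size S.1)⁻¹ * I) := by
      rw [← mul_assoc, mul_comm C3, mul_assoc, ← div_eq_inv_mul, le_div_iff₀ hS0]
      calc _ = size S.1 ^ 2 * coefSq k F.1 (p S - phat F) := by ring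
        _ ≤ _ := h1
    refine h3.trans ?_
    have h4 : (size S.1)⁻¹ ≤ (size F.1)⁻¹ := inv_anti₀ hF0 (TetMesh.face_size_le hFS)
    gcongr
  calc _ ≤ 3 * C2 * ∑ T : M.Cell, ∑ α ∈ T.1.finsuppAntidiag k, E α T := hgradient
    _ ≤ 3 * C2 * ∑ α ∈ A, κ ^ 3 * (C1 * starSum M α (H α)) := by
        rw [hswap1]
        exact mul_le_mul_of_nonneg_left (Finset.sum_le_sum hnodes) (by positivity)
    _ = 3 * C2 * (κ ^ 3 * C1) * ∑ S : M.Cell, ∑ F : M.Face with F.1 ⊆ S.1,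
          ∑ α ∈ F.1.finsuppAntidiag k, H α S F := by
        rw [← hswap2]
        simp only [Finset.mul_sum]
        exact Finset.sum_congr rfl fun α _ => by ring
    _ ≤ 3 * C2 * (κ ^ 3 * C1) * (C3 * bdrySum M (fun T F x =>
          (size F.1)⁻¹ * (ev (p T) x - ev (phat F) x) ^ 2)) :=
        mul_le_mul_of_nonneg_left hfaces (by positivity)
    _ = _ := by ring

/-! ### Tangential traces -/

section Tangential

variable {Ω : Set E3} {M : TetMesh Ω}

/-- Vectors that are normal to the same face are parallel. -/
lemma cross_eq_zero_of_normal {F : M.Face} {n w : Vec}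
    (hn : ∀ a ∈ F.1, ∀ b ∈ F.1, n ⬝ᵥ (fun i => b i - a i) = 0)
    (hw : ∀ a ∈ F.1, ∀ b ∈ F.1, w ⬝ᵥ (fun i => b i - a i) = 0) : n ⨯₃ w = 0 := by
  obtain ⟨T, hT⟩ := TetMesh.exists_cell F
  obtain ⟨v, hv, he⟩ := TetMesh.exists_eq_erase hT
  obtain ⟨c, g, hb⟩ := exists_isBary (TetMesh.cell_isSimplex T)
  obtain ⟨u, hu⟩ := (TetMesh.face_isSimplex F).nonempty
  rw [he] at hn hw hu
  rw [hb.eq_smul_grad hv (hn u hu), hb.eq_smul_grad hv (hw u hu)]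
  simp

lemma cross_cross_self {n : Vec} (hn : sqLen n = 1) (w : Vec) :
    n ⨯₃ (n ⨯₃ w) = (n ⬝ᵥ w) • n - w := by
  rw [sqLen, dot_eq] at hn
  funext i
  fin_cases i <;> simp only [cross_apply, dot_eq, Pi.sub_apply, Pi.smul_apply, smul_eq_mul,
    Fin.zero_eta, Fin.mk_one, Fin.reduceFinMk, Matrix.cons_val_zero, Matrix.cons_val_one,
    Matrix.cons_val]
  · linear_combination (-w 0) * hn
  · linear_combination (-w 1) * hn
  · linear_combination (-w 2) * hn

/-- The two normals are parallel, so `n ⨯₃ (n ⨯₃ n')` vanishes; expanding this double product gives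
the multiple. -/
lemma IsUnitNormal.eq_smul {F : M.Face} {n n' : Vec} (hn : IsUnitNormal F.1 n)
    (hn' : IsUnitNormal F.1 n') : n' = (n ⬝ᵥ n') • n := by
  have h := cross_cross_self hn.1 n'
  rw [cross_eq_zero_of_normal hn.2 hn'.2, map_zero] at h
  exact (sub_eq_zero.1 h.symm).symm

/-- The gradient of a polynomial that vanishes on a face is normal to the face. -/
lemma cross_grad_eq_zero {F : M.Face} {p : Poly} (hp : ∀ x ∈ hull F.1, ev p x = 0) {n : Vec}
    (hn : IsUnitNormal F.1 n) {x : E3} (hx : x ∈ hull F.1) : n ⨯₃ evV (grad p) x = 0 := by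
  -- The polynomial vanishes on the segment from `x` to the vertex `a`, hence so does its one-sided
  -- derivative at `x`. Differences of these derivatives cover the edges of the face.
  have key : ∀ a ∈ F.1, evV (grad p) x ⬝ᵥ (fun i => a i - x i) = 0 := by
    intro a ha
    have hderiv := hasDerivAt_ev p (x := fun t : ℝ => x + t • (a - x)) (x' := a - x) (t := 0)
      fun i => by
        have := ((hasDerivAt_id (0 : ℝ)).mul_const (a i - x i)).const_add (x i)
        simpa using this
    have hzero : ∀ t ∈ Set.Icc (0 : ℝ) 1, ev p (x + t • (a - x)) = 0 := fun t ht =>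
      hp _ ((convex_convexHull ℝ _).add_smul_sub_mem hx (mem_hull ha) ht)
    have h1 := (hderiv.hasDerivWithinAt (s := Set.Icc (0 : ℝ) 1)).congr (f₁ := fun _ => (0 : ℝ))
      (fun t ht => (hzero t ht).symm) (hzero 0 ⟨le_rfl, zero_le_one⟩).symm
    have h2 := (uniqueDiffOn_Icc_zero_one 0 ⟨le_rfl, zero_le_one⟩).eq_deriv _ h1
      (hasDerivWithinAt_const _ _ _)
    rw [zero_smul, add_zero] at h2
    rw [dotProduct, ← h2]
    exact Finset.sum_congr rfl fun i _ => mul_comm _ _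
  refine cross_eq_zero_of_normal hn.2 fun a ha b hb => ?_
  have h1 := key a ha
  have h2 := key b hb
  rw [dot_eq] at h1 h2 ⊢
  linarith

/-- The tangential part of a vector field, for the normal vector `n`. -/
def tang (n : Vec) (v : VPoly) : VPoly := fun i => v i - ∑ j, (n i * n j) • v j

lemma evV_tang (n : Vec) (v : VPoly) (x : E3) :
    evV (tang n v) x = evV v x - (n ⬝ᵥ evV v x) • n := by
  funext i
  simp only [evV, tang, ev_sub, ev_sum, ev_smul, Pi.sub_apply, Pi.smul_apply, smul_eq_mul,
    dotProduct, Finset.sum_mul]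
  congr 1
  exact Finset.sum_congr rfl fun j _ => by ring

lemma tang_mem {k : ℕ} {v : VPoly} (hv : ∀ i, v i ∈ polyDeg k) (n : Vec) (i : Fin 3) :
    tang n v i ∈ polyDeg k :=
  Submodule.sub_mem _ (hv i) (Submodule.sum_mem _ fun j _ => Submodule.smul_mem _ _ (hv j))

lemma dot_tang {n : Vec} (hn : sqLen n = 1) (v : VPoly) (x : E3) : n ⬝ᵥ evV (tang n v) x = 0 := by
  rw [evV_tang, dotProduct_sub, dotProduct_smul, ← sqLen, hn, smul_eq_mul, mul_one, sub_self]

lemma sqLen_neg (v : Vec) : sqLen (-v) = sqLen v := by rw [sqLen, sqLen, neg_dotProduct_neg]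

lemma sqLen_zero : sqLen 0 = 0 := zero_dotProduct _

/-- The gradient of a piecewise polynomial that is continuous across the faces and vanishes on the
boundary has a tangential trace. -/
lemma exists_trace_grad {k : ℕ} {q : M.Cell → Poly} (hq : ∀ T, q T ∈ polyDeg k)
    (hcont : ∀ (F : M.Face) (S T : M.Cell), F.1 ⊆ S.1 → F.1 ⊆ T.1 →
      ∀ x ∈ hull F.1, ev (q S) x = ev (q T) x)
    (hbd : ∀ (F : M.Face) (T : M.Cell), M.IsBoundary F → F.1 ⊆ T.1 →
      ∀ x ∈ hull F.1, ev (q T) x = 0) :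
    ∃ w : M.Face → E3 → Vec, IsTraceField M k w ∧ ∀ (T : M.Cell) (F : M.Face), F.1 ⊆ T.1 →
      ∀ x ∈ hull F.1, outerNormal T.1 F.1 ⨯₃ (evV (grad (q T)) x - w F x) = 0 := by
  classical
  choose S hS using fun F : M.Face => TetMesh.exists_cell F
  have hn := fun F : M.Face => (TetMesh.isOuterNormal (hS F)).1
  set N : M.Face → Vec := fun F => outerNormal (S F).1 F.1 with hN
  -- The trace is the tangential part of the gradient from one chosen cell. Any other cell at the
  -- face gives the same, since the difference of the two polynomials vanishes on the face.
  set W : M.Face → VPoly := fun F => tang (N F) (grad (q (S F))) with hW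
  refine ⟨fun F x => (hull F.1).indicator (evV (W F)) x, ⟨fun F i => ⟨W F i, ?_, ?_⟩,
    fun F n hF x hx => ?_, fun F hF n hnF x hx => ?_⟩, fun T F hT x hx => ?_⟩
  · exact tang_mem (fun i => polyDeg_mono (Nat.sub_le _ _) (grad_mem (hq _) i)) _ i
  · funext x
    by_cases hx : x ∈ hull F.1
    · simp only [Set.indicator_of_mem hx, evV]
    · simp only [Set.indicator_of_notMem hx, Pi.zero_apply]
  · rw [Set.indicator_of_mem hx, (hn F).eq_smul hF, smul_dotProduct, dot_tang (hn F).1, smul_zero]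
  · rw [Set.indicator_of_mem hx, evV_tang, map_sub, map_smul,
      cross_grad_eq_zero (hbd F _ hF (hS F)) hnF hx, cross_eq_zero_of_normal hnF.2 (hn F).2]
    simp
  · have hT' := (TetMesh.isOuterNormal hT).1
    have h1 : ∀ y ∈ hull F.1, ev (q T - q (S F)) y = 0 := fun y hy => by
      rw [ev_sub, hcont F T (S F) hT (hS F) y hy, sub_self]
    have h2 := cross_grad_eq_zero h1 hT' hx
    have h3 : evV (grad (q T)) x = evV (grad (q T - q (S F))) x + evV (grad (q (S F))) x := by
      funext i
      simp only [evV, grad, map_sub, ev_sub, Pi.add_apply]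
      ring
    beta_reduce
    rw [Set.indicator_of_mem hx, evV_tang, h3, add_sub_assoc, sub_sub_cancel, map_add, map_smul, h2,
      cross_eq_zero_of_normal hT'.2 (hn F).2]
    simp

end Tangential

/-! ### Inequalities for the sums of integrals -/

/-- Young's inequality with weight `t`, from `4AB ≤ (tA + t⁻¹B)²`. -/
lemma two_mul_abs_le {f A B t : ℝ} (ht : 0 < t) (hA : 0 ≤ A) (hB : 0 ≤ B) (h : f ^ 2 ≤ A * B) :
    |2 * f| ≤ t * A + t⁻¹ * B := by
  refine abs_le_of_sq_le_sq ?_ (by positivity)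
  have h1 : t * A * (t⁻¹ * B) = A * B := by field_simp
  nlinarith [sq_nonneg (t * A - t⁻¹ * B)]

section Mesh

variable {Ω : Set E3} {M : TetMesh Ω}

lemma volSum_neg (f : M.Cell → E3 → ℝ) : volSum M (fun T x => -f T x) = -volSum M f := by
  simp only [volSum, cellInt, integral_neg, Finset.sum_neg_distrib]

lemma bdrySum_neg (f : M.Cell → M.Face → E3 → ℝ) :
    bdrySum M (fun T F x => -f T F x) = -bdrySum M f := by
  simp only [bdrySum, faceInt, integral_neg, Finset.sum_neg_distrib]

lemma abs_volSum_le {f g : M.Cell → E3 → ℝ} (hf : ∀ T, ContinuousOn (f T) (hull T.1))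
    (hg : ∀ T, ContinuousOn (g T) (hull T.1)) (h : ∀ T, ∀ x ∈ hull T.1, |f T x| ≤ g T x) :
    |volSum M f| ≤ volSum M g := by
  refine abs_le'.2 ⟨volSum_mono hf hg fun T x hx => (abs_le'.1 (h T x hx)).1, ?_⟩
  rw [← volSum_neg]
  exact volSum_mono (fun T => (hf T).neg) hg fun T x hx => (abs_le'.1 (h T x hx)).2

lemma abs_bdrySum_le {f g : M.Cell → M.Face → E3 → ℝ}
    (hf : ∀ T F, F.1 ⊆ T.1 → ContinuousOn (f T F) (hull F.1))
    (hg : ∀ T F, F.1 ⊆ T.1 → ContinuousOn (g T F) (hull F.1))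
    (h : ∀ T F, F.1 ⊆ T.1 → ∀ x ∈ hull F.1, |f T F x| ≤ g T F x) :
    |bdrySum M f| ≤ bdrySum M g := by
  refine abs_le'.2 ⟨bdrySum_mono hf hg fun T F hT x hx => (abs_le'.1 (h T F hT x hx)).1, ?_⟩
  rw [← bdrySum_neg]
  exact bdrySum_mono (fun T F hT => (hf T F hT).neg) hg
    fun T F hT x hx => (abs_le'.1 (h T F hT x hx)).2

/-- A weighted Cauchy–Schwarz inequality in additive form. The parameter `t` is later chosen so that
one term can be absorbed. -/
lemma two_mul_abs_volSum_le {f A B : M.Cell → E3 → ℝ} {t : ℝ} (ht : 0 < t)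
    (hf : ∀ T, ContinuousOn (f T) (hull T.1)) (hA : ∀ T, ContinuousOn (A T) (hull T.1))
    (hB : ∀ T, ContinuousOn (B T) (hull T.1)) (hA0 : ∀ T x, 0 ≤ A T x) (hB0 : ∀ T x, 0 ≤ B T x)
    (h : ∀ T x, f T x ^ 2 ≤ A T x * B T x) :
    |2 * volSum M f| ≤ t * volSum M A + t⁻¹ * volSum M B := by
  rw [← volSum_const_mul, ← volSum_const_mul, ← volSum_const_mul, ← volSum_add
    (f := fun T x => t * A T x) (g := fun T x => t⁻¹ * B T x) (fun T => continuousOn_const.mul (hA T)) (fun T => continuousOn_const.mul (hB T))]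
  exact abs_volSum_le (fun T => continuousOn_const.mul (hf T))
    (fun T => (continuousOn_const.mul (hA T)).add (continuousOn_const.mul (hB T)))
    fun T x _ => two_mul_abs_le ht (hA0 T x) (hB0 T x) (h T x)

lemma two_mul_abs_bdrySum_le {f A B : M.Cell → M.Face → E3 → ℝ} {t : ℝ} (ht : 0 < t)
    (hf : ∀ T F, F.1 ⊆ T.1 → ContinuousOn (f T F) (hull F.1))
    (hA : ∀ T F, F.1 ⊆ T.1 → ContinuousOn (A T F) (hull F.1))
    (hB : ∀ T F, F.1 ⊆ T.1 → ContinuousOn (B T F) (hull F.1))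
    (hA0 : ∀ T F x, 0 ≤ A T F x) (hB0 : ∀ T F x, 0 ≤ B T F x)
    (h : ∀ T F, F.1 ⊆ T.1 → ∀ x, f T F x ^ 2 ≤ A T F x * B T F x) :
    |2 * bdrySum M f| ≤ t * bdrySum M A + t⁻¹ * bdrySum M B := by
  rw [← bdrySum_const_mul, ← bdrySum_const_mul, ← bdrySum_const_mul, ← bdrySum_add
    (f := fun T F x => t * A T F x) (g := fun T F x => t⁻¹ * B T F x) (fun T F hT => continuousOn_const.mul (hA T F hT))
    (fun T F hT => continuousOn_const.mul (hB T F hT))]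
  exact abs_bdrySum_le (fun T F hT => continuousOn_const.mul (hf T F hT))
    (fun T F hT => (continuousOn_const.mul (hA T F hT)).add (continuousOn_const.mul (hB T F hT)))
    fun T F hT x _ => two_mul_abs_le ht (hA0 T F x) (hB0 T F x) (h T F hT x)

/-! ### The jump of the normal component -/

open scoped Classical in
/-- The jump of the normal component on a face as a polynomial. -/
def jumpPoly (v : M.Cell → VPoly) (F : M.Face) : Poly :=
  ∑ T : M.Cell with F.1 ⊆ T.1, ∑ j, outerNormal T.1 F.1 j • v T j

lemma ev_jumpPoly (v : M.Cell → VPoly) (F : M.Face) (x : E3) :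
    ev (jumpPoly v F) x = normalJump M v F x := by
  simp only [jumpPoly, normalJump, ev_sum, ev_smul, dotProduct, evV]

lemma jumpPoly_mem {k : ℕ} {v : M.Cell → VPoly} (hv : ∀ T i, v T i ∈ polyDeg k) (F : M.Face) :
    jumpPoly v F ∈ polyDeg k :=
  Submodule.sum_mem _ fun T _ => Submodule.sum_mem _ fun j _ => Submodule.smul_mem _ _ (hv T j)

-- Cauchy–Schwarz over the cells at the face, whose number is at most `κ³`, and unit length of the
-- normals.
open scoped Classical in
lemma normalJump_sq_le {κ : ℝ} (hκ : 0 < κ) (hM : M.ShapeRegular κ) (v : M.Cell → VPoly)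
    (F : M.Face) (x : E3) :
    normalJump M v F x ^ 2 ≤ κ ^ 3 * ∑ T : M.Cell with F.1 ⊆ T.1, sqLen (evV (v T) x) := by
  refine sq_sum_le_card_mul_sum_sq.trans ?_
  have h0 : 0 ≤ ∑ T : M.Cell with F.1 ⊆ T.1, (outerNormal T.1 F.1 ⬝ᵥ evV (v T) x) ^ 2 :=
    Finset.sum_nonneg fun _ _ => sq_nonneg _
  refine (mul_le_mul_of_nonneg_right
    (hM.card_cells_superset_le hκ (TetMesh.face_isSimplex F).nonempty) h0).trans ?_
  refine mul_le_mul_of_nonneg_left (Finset.sum_le_sum fun T hT => ?_) (by positivity)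
  have h1 := dot_sq_le (outerNormal T.1 F.1) (evV (v T) x)
  rwa [(TetMesh.isOuterNormal (Finset.mem_filter.1 hT).2).1.1, one_mul] at h1

/-- A sum over the interior faces is bounded by the sum over the boundaries of the cells. -/
lemma interiorFaceSum_le {f : M.Face → E3 → ℝ} {g : M.Cell → M.Face → E3 → ℝ}
    (hf : ∀ F, ContinuousOn (f F) (hull F.1)) (hf0 : ∀ F, ∀ x, 0 ≤ f F x)
    (hg : ∀ T F, F.1 ⊆ T.1 → ContinuousOn (g T F) (hull F.1))
    (h : ∀ F x, open scoped Classical in f F x ≤ ∑ T : M.Cell with F.1 ⊆ T.1, g T F x) :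
    interiorFaceSum M f ≤ bdrySum M g := by
  classical
  rw [bdrySum_comm, interiorFaceSum]
  have h1 : ∀ F : M.Face, faceInt F.1 (f F) ≤
      ∑ T : M.Cell with F.1 ⊆ T.1, faceInt F.1 (g T F) := by
    intro F
    have hint : ∀ T ∈ Finset.univ.filter fun T : M.Cell => F.1 ⊆ T.1,
        IntegrableOn (g T F) (hull F.1) μHE[2] := fun T hT =>
      integrableOn_face F (hg T F (Finset.mem_filter.1 hT).2)
    simp only [faceInt]
    rw [← integral_finsetSum _ hint]
    exact setIntegral_mono_on (integrableOn_face F (hf F)) (integrable_finsetSum _ hint)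
      (measurableSet_hull _) fun x _ => h F x
  refine (Finset.sum_le_sum_of_subset_of_nonneg (Finset.filter_subset _ _) fun F _ _ =>
    integral_nonneg (hf0 F)).trans (Finset.sum_le_sum fun F _ => h1 F)

/-- The inverse inequality for the seminorm of `H(div)`. -/
lemma exists_divSq_le (k : ℕ) {κ : ℝ} (hκ : 0 < κ) : ∃ C : ℝ, 0 < C ∧
    ∀ {Ω : Set E3} (M : TetMesh Ω), M.ShapeRegular κ →
      ∀ v : M.Cell → VPoly, (∀ T i, v T i ∈ polyDeg k) →
        divSq M v ≤ C * volSum M (fun T x => sqLen (evV (v T) x)) := by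
  classical
  obtain ⟨C1, hC1, h1⟩ := exists_volSum_jacSq_le k hκ
  obtain ⟨C2, hC2, h2⟩ := exists_bdrySum_sqLen_le k hκ
  refine ⟨3 * C1 + κ ^ 3 * C2, by positivity, fun M hM v hv => ?_⟩
  have e1 := h1 M hM (fun _ => 1) (fun _ => zero_le_one) v hv
  have e2 := h2 M hM (fun _ => 1) (fun _ => zero_le_one) v hv
  simp only [one_mul] at e1 e2
  have hsq : ∀ (T : M.Cell) (s : Set E3), ContinuousOn (fun x => sqLen (evV (v T) x)) s :=
    fun T s => continuousOn_sqLen (continuousOn_evV _ _)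
  have e3 : volSum M (fun T x => (size T.1 * ev (divg (v T)) x) ^ 2) ≤
      3 * volSum M (fun T x => size T.1 ^ 2 * jacSq (v T) x) := by
    rw [← volSum_const_mul]
    refine volSum_mono (fun T => by fun_prop) (fun T => by fun_prop) fun T x _ => ?_
    rw [mul_pow]
    nlinarith [mul_le_mul_of_nonneg_left (ev_divg_sq_le (v T) x) (sq_nonneg (size T.1))]
  have e4 : interiorFaceSum M (fun F x => size F.1 * normalJump M v F x ^ 2) ≤
      κ ^ 3 * bdrySum M (fun T _ x => size T.1 * sqLen (evV (v T) x)) := by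
    rw [← bdrySum_const_mul]
    refine interiorFaceSum_le (fun F => ?_)
      (fun F x => mul_nonneg (TetMesh.face_size_pos F).le (sq_nonneg _))
      (fun T F _ => continuousOn_const.mul (continuousOn_const.mul (hsq T _))) fun F x => ?_
    · simp only [← ev_jumpPoly]
      fun_prop
    · have h3 := mul_le_mul_of_nonneg_left (normalJump_sq_le hκ hM v F x)
        (TetMesh.face_size_pos F).le
      refine h3.trans ?_
      rw [Finset.mul_sum, Finset.mul_sum]
      refine Finset.sum_le_sum fun T hT => ?_
      have h4 := TetMesh.face_size_le (Finset.mem_filter.1 hT).2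
      have h5 := mul_le_mul_of_nonneg_right h4
        (mul_nonneg (pow_nonneg hκ.le 3) (sqLen_nonneg (evV (v T) x)))
      linarith
  rw [divSq, add_mul]
  have e5 := mul_le_mul_of_nonneg_left e2 (pow_nonneg hκ.le 3)
  linarith

end Mesh

/-! ### The parts of the norm -/

section Norm

variable {Ω : Set E3} (M : TetMesh Ω)

/-- `‖r‖²`. -/
def fieldSq (r : M.Cell → VPoly) : ℝ := volSum M fun T x => sqLen (evV (r T) x)

/-- `‖∇×∇×u‖²`. -/
def curlCurlSq (u : M.Cell → VPoly) : ℝ :=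
  volSum M fun T x => sqLen (evV (curl (curl (u T))) x)

/-- `‖h_F^{-3/2} n×(u-û)‖²`. -/
def tangJumpSq (u : M.Cell → VPoly) (uhat : M.Face → E3 → Vec) : ℝ :=
  bdrySum M fun T F x => ((size F.1)⁻¹) ^ 3 *
    sqLen (outerNormal T.1 F.1 ⨯₃ (evV (u T) x - uhat F x))

/-- `‖h_F^{-1/2} n×(∇×u-ĉ)‖²`. -/
def curlJumpSq (u : M.Cell → VPoly) (chat : M.Face → E3 → Vec) : ℝ :=
  bdrySum M fun T F x => (size F.1)⁻¹ *
    sqLen (outerNormal T.1 F.1 ⨯₃ (evV (curl (u T)) x - chat F x))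

/-- `‖∇p‖²`. -/
def gradSq (p : M.Cell → Poly) : ℝ := volSum M fun T x => sqLen (evV (grad (p T)) x)

/-- `‖h_F^{-1/2} (p-p̂)‖²`. -/
def traceJumpSq (p : M.Cell → Poly) (phat : M.Face → E3 → ℝ) : ℝ :=
  bdrySum M fun T F x => (size F.1)⁻¹ * (ev (p T) x - phat F x) ^ 2

/-- The square of the norm `‖·‖_{Σ_h}`. -/
def sigmaSq (α β : ℕ) (σ : Tuple M) : ℝ :=
  volSum M (fun T x => sqLen (evV (σ.r T) x))
    + normUSq M σ.u σ.uhat σ.chat + normPSq M α β σ.p σ.phat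

variable {M}

lemma sigmaSq_zero_zero (σ : Tuple M) : sigmaSq M 0 0 σ = fieldSq M σ.r + curlCurlSq M σ.u +
    tangJumpSq M σ.u σ.uhat + curlJumpSq M σ.u σ.chat + divSq M σ.u + gradSq M σ.p +
      traceJumpSq M σ.p σ.phat := by
  simp only [sigmaSq, normUSq, curlSq, normPSq, pow_zero, one_pow, one_mul, fieldSq, curlCurlSq,
    tangJumpSq, curlJumpSq, gradSq, traceJumpSq]
  ring

lemma fieldSq_nonneg (r : M.Cell → VPoly) : 0 ≤ fieldSq M r :=
  volSum_nonneg fun _ _ _ => sqLen_nonneg _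

lemma curlCurlSq_nonneg (u : M.Cell → VPoly) : 0 ≤ curlCurlSq M u :=
  volSum_nonneg fun _ _ _ => sqLen_nonneg _

lemma tangJumpSq_nonneg (u : M.Cell → VPoly) (uhat : M.Face → E3 → Vec) :
    0 ≤ tangJumpSq M u uhat :=
  bdrySum_nonneg fun _ F _ _ _ =>
    mul_nonneg (pow_nonneg (inv_nonneg.2 (TetMesh.face_size_pos F).le) 3) (sqLen_nonneg _)

lemma curlJumpSq_nonneg (u : M.Cell → VPoly) (chat : M.Face → E3 → Vec) :
    0 ≤ curlJumpSq M u chat :=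
  bdrySum_nonneg fun _ F _ _ _ =>
    mul_nonneg (inv_nonneg.2 (TetMesh.face_size_pos F).le) (sqLen_nonneg _)

lemma interiorFaceSum_nonneg {f : M.Face → E3 → ℝ} (h : ∀ F x, 0 ≤ f F x) :
    0 ≤ interiorFaceSum M f :=
  Finset.sum_nonneg fun F _ => integral_nonneg (h F)

lemma divSq_nonneg (u : M.Cell → VPoly) : 0 ≤ divSq M u :=
  add_nonneg (volSum_nonneg fun _ _ _ => sq_nonneg _)
    (interiorFaceSum_nonneg fun F _ => mul_nonneg (TetMesh.face_size_pos F).le (sq_nonneg _))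

lemma gradSq_nonneg (p : M.Cell → Poly) : 0 ≤ gradSq M p :=
  volSum_nonneg fun _ _ _ => sqLen_nonneg _

lemma traceJumpSq_nonneg (p : M.Cell → Poly) (phat : M.Face → E3 → ℝ) :
    0 ≤ traceJumpSq M p phat :=
  bdrySum_nonneg fun _ F _ _ _ =>
    mul_nonneg (inv_nonneg.2 (TetMesh.face_size_pos F).le) (sq_nonneg _)

/-! ### Tuples with few components -/

lemma zero_mem_facePoly (t : Finset E3) (j : ℕ) : (fun _ => 0) ∈ facePoly t j := by
  refine ⟨0, Submodule.zero_mem _, ?_⟩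
  funext x
  by_cases hx : x ∈ hull t
  · rw [Set.indicator_of_mem hx, ev_zero]
  · rw [Set.indicator_of_notMem hx]

lemma isTraceField_zero (M : TetMesh Ω) (j : ℕ) : IsTraceField M j 0 :=
  ⟨fun F _ => zero_mem_facePoly F.1 j, fun _ _ _ _ _ => dotProduct_zero _,
    fun _ _ _ _ _ _ => map_zero _⟩

lemma IsTraceField.neg {j : ℕ} {w : M.Face → E3 → Vec} (h : IsTraceField M j w) :
    IsTraceField M j (-w) := by
  refine ⟨fun F i => ?_, fun F n hn x hx => ?_, fun F hF n hn x hx => ?_⟩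
  · obtain ⟨p, hp, he⟩ := h.poly F i
    refine ⟨-p, Submodule.neg_mem _ hp, ?_⟩
    funext x
    have h1 := congrFun he x
    by_cases hx : x ∈ hull F.1
    · rw [Set.indicator_of_mem hx] at h1 ⊢
      rw [ev_neg, ← h1]
      rfl
    · rw [Set.indicator_of_notMem hx] at h1 ⊢
      exact neg_eq_zero.2 h1
  · exact (dotProduct_neg _ _).trans (neg_eq_zero.2 (h.tangential F n hn x hx))
  · exact (map_neg _ _).trans (neg_eq_zero.2 (h.boundary F hF n hn x hx))

lemma memSigmaZero_field {k : ℕ} {s : M.Cell → VPoly} (hs : ∀ T i, s T i ∈ polyDeg (k - 1)) :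
    MemSigmaZero M k ⟨s, 0, 0, 0, 0, 0⟩ :=
  ⟨hs, fun _ _ => Submodule.zero_mem _, isTraceField_zero M _, isTraceField_zero M _,
    fun _ => Submodule.zero_mem _, fun F => zero_mem_facePoly F.1 k, fun _ _ _ _ => rfl⟩

lemma memSigmaZero_potential {k : ℕ} {v : M.Cell → VPoly} {vhat dhat : M.Face → E3 → Vec}
    (hv : ∀ T i, v T i ∈ polyDeg k) (hvhat : IsTraceField M k vhat)
    (hdhat : IsTraceField M (k - 1) dhat) : MemSigmaZero M k ⟨0, v, vhat, dhat, 0, 0⟩ :=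
  ⟨fun _ _ => Submodule.zero_mem _, hv, hvhat, hdhat, fun _ => Submodule.zero_mem _,
    fun F => zero_mem_facePoly F.1 k, fun _ _ _ _ => rfl⟩

lemma memSigmaZero_scalar {k : ℕ} {q : M.Cell → Poly} {qhat : M.Face → E3 → ℝ}
    (hq : ∀ T, q T ∈ polyDeg k) (hqhat : ∀ F : M.Face, qhat F ∈ facePoly F.1 k)
    (h0 : ∀ F : M.Face, M.IsBoundary F → ∀ x ∈ hull F.1, qhat F x = 0) :
    MemSigmaZero M k ⟨0, 0, 0, 0, q, qhat⟩ :=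
  ⟨fun _ _ => Submodule.zero_mem _, fun _ _ => Submodule.zero_mem _, isTraceField_zero M _,
    isTraceField_zero M _, hq, hqhat, h0⟩

lemma divg_zero : divg 0 = 0 := by simp [divg]

lemma grad_zero : grad 0 = 0 := by
  funext i
  simp [grad]

lemma fieldSq_zero : fieldSq M 0 = 0 := by simp [fieldSq, evV_zero, sqLen_zero, volSum_zero]

lemma curlCurlSq_zero : curlCurlSq M 0 = 0 := by
  simp [curlCurlSq, curl_zero, evV_zero, sqLen_zero, volSum_zero]

lemma tangJumpSq_zero : tangJumpSq M 0 0 = 0 := by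
  simp [tangJumpSq, evV_zero, sqLen_zero, bdrySum_zero]

lemma curlJumpSq_zero : curlJumpSq M 0 0 = 0 := by
  simp [curlJumpSq, curl_zero, evV_zero, sqLen_zero, bdrySum_zero]

lemma divSq_zero : divSq M 0 = 0 := by
  simp [divSq, divg_zero, ev_zero, volSum_zero, normalJump, evV_zero, interiorFaceSum, faceInt]

lemma gradSq_zero : gradSq M 0 = 0 := by
  simp [gradSq, grad_zero, evV_zero, sqLen_zero, volSum_zero]

lemma traceJumpSq_zero : traceJumpSq M 0 0 = 0 := by
  simp [traceJumpSq, ev_zero, bdrySum_zero]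

lemma formA_zero (r : M.Cell → VPoly) : formA M r 0 = 0 := by
  simp [formA, evV_zero, volSum_zero]

lemma formB_zero_left (s : M.Cell → VPoly) : formB M 0 0 0 s = 0 := by
  simp [formB, evV_zero, volSum_zero, bdrySum_zero]

lemma formB_zero_right (u : M.Cell → VPoly) (uhat chat : M.Face → E3 → Vec) :
    formB M u uhat chat 0 = 0 := by
  simp [formB, curl_zero, evV_zero, volSum_zero, bdrySum_zero]

lemma formC_zero_left (u : M.Cell → VPoly) : formC M 0 0 u = 0 := by
  simp [formC, ev_zero, volSum_zero, bdrySum_zero]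

lemma formC_zero_right (q : M.Cell → Poly) (qhat : M.Face → E3 → ℝ) : formC M q qhat 0 = 0 := by
  simp [formC, divg_zero, ev_zero, evV_zero, volSum_zero, bdrySum_zero]

lemma formSU_zero (u : M.Cell → VPoly) (uhat chat : M.Face → E3 → Vec) :
    formSU M u uhat chat 0 0 0 = 0 := by
  simp [formSU, curl_zero, evV_zero, bdrySum_zero]

lemma formSP_zero (p : M.Cell → Poly) (phat : M.Face → E3 → ℝ) : formSP M p phat 0 0 = 0 := by
  simp [formSP, ev_zero, bdrySum_zero]

lemma Bh_field (σ : Tuple M) (s : M.Cell → VPoly) :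
    Bh M σ ⟨s, 0, 0, 0, 0, 0⟩ = formA M σ.r s + formB M σ.u σ.uhat σ.chat s := by
  simp only [Bh, formB_zero_left, formC_zero_left, formC_zero_right, formSU_zero, formSP_zero]
  ring

lemma Bh_potential (σ : Tuple M) (v : M.Cell → VPoly) (vhat dhat : M.Face → E3 → Vec) :
    Bh M σ ⟨0, v, vhat, dhat, 0, 0⟩ = formB M v vhat dhat σ.r + formC M σ.p σ.phat v -
      formSU M σ.u σ.uhat σ.chat v vhat dhat := by
  simp only [Bh, formA_zero, formB_zero_right, formC_zero_left, formSP_zero]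
  ring

lemma Bh_scalar (σ : Tuple M) (q : M.Cell → Poly) (qhat : M.Face → E3 → ℝ) :
    Bh M σ ⟨0, 0, 0, 0, q, qhat⟩ = formC M q qhat σ.u + formSP M σ.p σ.phat q qhat := by
  simp only [Bh, formA_zero, formB_zero_left, formB_zero_right, formC_zero_right, formSU_zero]
  ring

lemma sigmaSq_field (s : M.Cell → VPoly) :
    sigmaSq M 0 0 ⟨s, 0, 0, 0, 0, 0⟩ = fieldSq M s := by
  rw [sigmaSq_zero_zero]
  simp only [curlCurlSq_zero, tangJumpSq_zero, curlJumpSq_zero, divSq_zero, gradSq_zero,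
    traceJumpSq_zero, add_zero]

lemma sigmaSq_potential (v : M.Cell → VPoly) (vhat dhat : M.Face → E3 → Vec) :
    sigmaSq M 0 0 ⟨0, v, vhat, dhat, 0, 0⟩ =
      curlCurlSq M v + tangJumpSq M v vhat + curlJumpSq M v dhat + divSq M v := by
  rw [sigmaSq_zero_zero]
  simp only [fieldSq_zero, gradSq_zero, traceJumpSq_zero, add_zero, zero_add]

lemma sigmaSq_scalar (q : M.Cell → Poly) (qhat : M.Face → E3 → ℝ) :
    sigmaSq M 0 0 ⟨0, 0, 0, 0, q, qhat⟩ = gradSq M q + traceJumpSq M q qhat := by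
  rw [sigmaSq_zero_zero]
  simp only [fieldSq_zero, curlCurlSq_zero, tangJumpSq_zero, curlJumpSq_zero, divSq_zero, zero_add]

end Norm

/-! ### Test functions -/

section Test

variable {Ω : Set E3} {M : TetMesh Ω}

lemma cross_neg_sub (n v w : Vec) : n ⨯₃ (-v - -w) = -(n ⨯₃ (v - w)) := by
  rw [← map_neg]
  congr 1
  abel

/-- The test function that yields the stabilization terms. -/
lemma exists_test_stabilization {k : ℕ} {σ : Tuple M} (hσ : σ ∈ sigmaZero M k) :
    ∃ τ ∈ sigmaZero M k, Bh M σ τ = fieldSq M σ.r + tangJumpSq M σ.u σ.uhat +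
      curlJumpSq M σ.u σ.chat + traceJumpSq M σ.p σ.phat ∧ sigmaSq M 0 0 τ = sigmaSq M 0 0 σ := by
  -- With the sign of the `u`-part reversed, the terms `b_h` and `c_h` cancel in pairs, and the
  -- negative stabilization of `u` becomes positive. The norm is unaffected.
  refine ⟨⟨σ.r, -σ.u, -σ.uhat, -σ.chat, σ.p, σ.phat⟩, ⟨hσ.r_mem,
    fun T i => Submodule.neg_mem _ (hσ.u_mem T i), hσ.uhat_mem.neg, hσ.chat_mem.neg, hσ.p_mem,
    hσ.phat_mem, hσ.phat_boundary⟩, ?_, ?_⟩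
  · have h1 : formB M (-σ.u) (-σ.uhat) (-σ.chat) σ.r = -formB M σ.u σ.uhat σ.chat σ.r := by
      simp only [formB, Pi.neg_apply, evV_neg, map_neg, neg_dotProduct, volSum_neg, bdrySum_neg]
      ring
    have h2 : formC M σ.p σ.phat (-σ.u) = -formC M σ.p σ.phat σ.u := by
      have : ∀ T, divg (-σ.u T) = -divg (σ.u T) := fun T => by simp [divg]
      simp only [formC, Pi.neg_apply, this, ev_neg, evV_neg, dotProduct_neg, neg_mul, volSum_neg,
        bdrySum_neg]
      ring
    have h3 : formSU M σ.u σ.uhat σ.chat (-σ.u) (-σ.uhat) (-σ.chat) =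
        -(tangJumpSq M σ.u σ.uhat + curlJumpSq M σ.u σ.chat) := by
      simp only [formSU, Pi.neg_apply, evV_neg, curl_neg, cross_neg_sub, dotProduct_neg, mul_neg,
        bdrySum_neg, tangJumpSq, curlJumpSq, sqLen]
      ring
    have h4 : formSP M σ.p σ.phat σ.p σ.phat = traceJumpSq M σ.p σ.phat := by
      simp only [formSP, traceJumpSq, pow_two]
    have h5 : formA M σ.r σ.r = fieldSq M σ.r := rfl
    rw [Bh, h1, h2, h3, h4, h5]
    ring
  · have h1 : curlCurlSq M (-σ.u) = curlCurlSq M σ.u := by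
      simp only [curlCurlSq, Pi.neg_apply, curl_neg, evV_neg, sqLen_neg]
    have h2 : tangJumpSq M (-σ.u) (-σ.uhat) = tangJumpSq M σ.u σ.uhat := by
      simp only [tangJumpSq, Pi.neg_apply, evV_neg, cross_neg_sub, sqLen_neg]
    have h3 : curlJumpSq M (-σ.u) (-σ.chat) = curlJumpSq M σ.u σ.chat := by
      simp only [curlJumpSq, Pi.neg_apply, curl_neg, evV_neg, cross_neg_sub, sqLen_neg]
    have h4 : divSq M (-σ.u) = divSq M σ.u := by
      have : ∀ T, divg (-σ.u T) = -divg (σ.u T) := fun T => by simp [divg]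
      simp only [divSq, normalJump, Pi.neg_apply, this, ev_neg, evV_neg, dotProduct_neg, mul_neg,
        neg_sq, Finset.sum_neg_distrib]
    simp only [sigmaSq_zero_zero, h1, h2, h3, h4]

lemma continuousOn_cross_sub (n : Vec) (v : VPoly) {w : M.Face → E3 → Vec} (hw : FaceContinuous w)
    (F : M.Face) (i : Fin 3) : ContinuousOn (fun x => (n ⨯₃ (evV v x - w F x)) i) (hull F.1) :=
  continuousOn_cross _ (continuousOn_vsub (continuousOn_evV _ _) (hw F)) i

/-- The test function that yields the norm of `∇×∇×u`. -/
lemma exists_test_curlCurl (k : ℕ) {κ : ℝ} (hκ : 0 < κ) : ∃ C : ℝ, 0 < C ∧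
    ∀ {Ω : Set E3} (M : TetMesh Ω), M.ShapeRegular κ → ∀ σ ∈ sigmaZero M k,
      ∃ τ ∈ sigmaZero M k, curlCurlSq M σ.u ≤ 2 * Bh M σ τ +
        C * (fieldSq M σ.r + tangJumpSq M σ.u σ.uhat + curlJumpSq M σ.u σ.chat) ∧
        sigmaSq M 0 0 τ ≤ curlCurlSq M σ.u := by
  obtain ⟨C1, hC1, htrace⟩ := exists_bdrySum_sqLen_le k hκ
  obtain ⟨C2, hC2, hinv⟩ := exists_volSum_jacSq_le k hκ
  refine ⟨1 + C1 * (2 * C2) + C1, by positivity, fun M hM σ hσ => ?_⟩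
  -- The sign matches the minus in front of the volume term of `formB_eq`; two curls lower the
  -- degree enough for the space of `r`.
  set s : M.Cell → VPoly := fun T => -curl (curl (σ.u T)) with hs
  have hsmem : ∀ T i, s T i ∈ polyDeg (k - 1) := fun T i => Submodule.neg_mem _
    (polyDeg_mono (Nat.sub_le _ _) (curl_mem (fun i => curl_mem (hσ.u_mem T) i) i))
  have hsk : ∀ T i, s T i ∈ polyDeg k := fun T i => polyDeg_mono (Nat.sub_le _ _) (hsmem T i)
  have hK : fieldSq M s = curlCurlSq M σ.u := by
    simp only [fieldSq, curlCurlSq, hs, evV_neg, sqLen_neg]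
  set K := curlCurlSq M σ.u with hKdef
  refine ⟨_, memSigmaZero_field hsmem, ?_, (sigmaSq_field s).trans_le hK.le⟩
  have hu := hσ.uhat_mem.faceContinuous
  have hc := hσ.chat_mem.faceContinuous
  have hsq : ∀ (v : VPoly) (S : Set E3), ContinuousOn (fun x => sqLen (evV v x)) S :=
    fun v S => continuousOn_sqLen (continuousOn_evV _ _)
  have hB := formB_eq σ.u hu hc s
  have e1 : volSum M (fun T x => evV (curl (curl (σ.u T))) x ⬝ᵥ evV (s T) x) = -K := by
    simp only [hs, evV_neg, dotProduct_neg, volSum_neg]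
    rfl
  have hJ : volSum M (fun T x => size T.1 ^ 2 * sqLen (evV (curl (s T)) x)) ≤ 2 * C2 * K := by
    have h1 := hinv M hM (fun _ => 1) (fun _ => zero_le_one) s hsk
    simp only [one_mul] at h1
    change _ ≤ C2 * fieldSq M s at h1
    rw [hK] at h1
    have h2 : volSum M (fun T x => size T.1 ^ 2 * sqLen (evV (curl (s T)) x)) ≤
        2 * volSum M (fun T x => size T.1 ^ 2 * jacSq (s T) x) := by
      rw [← volSum_const_mul]
      refine volSum_mono (fun T => continuousOn_const.mul (hsq _ _)) (fun T => by fun_prop)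
        fun T x _ => ?_
      have := mul_le_mul_of_nonneg_left (sqLen_curl_le (s T) x) (sq_nonneg (size T.1))
      linarith
    linarith
  -- The trace inequality with weight `h_T²` and the inverse inequality for the curl together
  -- compensate the weight `h_F⁻³` of the tangential jump.
  have b1 : bdrySum M (fun T F x => size F.1 ^ 3 * sqLen (evV (curl (s T)) x)) ≤
      C1 * (2 * C2 * K) := by
    refine le_trans (bdrySum_mono (fun T F _ => continuousOn_const.mul (hsq _ _))
      (fun T F _ => (continuousOn_const (c := size T.1 ^ 2 * size T.1)).mul (hsq _ _))
      fun T F hT x _ => ?_) ((htrace M hM (fun T => size T.1 ^ 2) (fun T => sq_nonneg _)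
      (fun T => curl (s T)) fun T i => polyDeg_mono (Nat.sub_le _ _)
        (curl_mem (hsk T) i)).trans (mul_le_mul_of_nonneg_left hJ hC1.le))
    refine mul_le_mul_of_nonneg_right ?_ (sqLen_nonneg _)
    rw [← pow_succ]
    exact pow_le_pow_left₀ (TetMesh.face_size_pos F).le (TetMesh.face_size_le hT) 3
  have b2 : bdrySum M (fun T F x => size F.1 * sqLen (evV (s T) x)) ≤ C1 * K := by
    have h1 := htrace M hM (fun _ => 1) (fun _ => zero_le_one) s hsk
    simp only [one_mul] at h1
    change _ ≤ C1 * fieldSq M s at h1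
    rw [hK] at h1
    refine le_trans (bdrySum_mono (fun T F _ => continuousOn_const.mul (hsq _ _))
      (fun T F _ => continuousOn_const.mul (hsq _ _)) fun T F hT x _ => ?_) h1
    exact mul_le_mul_of_nonneg_right (TetMesh.face_size_le hT) (sqLen_nonneg _)
  -- The sum of the bounds for the three test-function factors is `c K`. With Young weight `c⁻¹`
  -- they amount to exactly `K`, half of the gain `2 K`.
  set c := 1 + C1 * (2 * C2) + C1 with hcdef
  have hc0 : 0 < c := by positivity
  have y1 := two_mul_abs_volSum_le (M := M) (inv_pos.2 hc0)
    (f := fun T x => evV (σ.r T) x ⬝ᵥ evV (s T) x) (A := fun T x => sqLen (evV (s T) x))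
    (B := fun T x => sqLen (evV (σ.r T) x))
    (fun T => continuousOn_dot (continuousOn_evV _ _) (continuousOn_evV _ _))
    (fun T => hsq _ _) (fun T => hsq _ _) (fun T x => sqLen_nonneg _) (fun T x => sqLen_nonneg _)
    fun T x => (dot_sq_le _ _).trans_eq (mul_comm _ _)
  have y2 := two_mul_abs_bdrySum_le (M := M) (inv_pos.2 hc0)
    (f := fun T F x => (outerNormal T.1 F.1 ⨯₃ (evV (σ.u T) x - σ.uhat F x)) ⬝ᵥ
      evV (curl (s T)) x) (A := fun T F x => size F.1 ^ 3 * sqLen (evV (curl (s T)) x))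
    (B := fun T F x => ((size F.1)⁻¹) ^ 3 *
      sqLen (outerNormal T.1 F.1 ⨯₃ (evV (σ.u T) x - σ.uhat F x)))
    (fun T F _ => continuousOn_dot (continuousOn_cross_sub _ _ hu F) (continuousOn_evV _ _))
    (fun T F _ => continuousOn_const.mul (hsq _ _))
    (fun T F _ => continuousOn_const.mul (continuousOn_sqLen (continuousOn_cross_sub _ _ hu F)))
    (fun T F x => mul_nonneg (pow_nonneg (TetMesh.face_size_pos F).le 3) (sqLen_nonneg _))
    (fun T F x => mul_nonneg (pow_nonneg (inv_nonneg.2 (TetMesh.face_size_pos F).le) 3)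
      (sqLen_nonneg _))
    fun T F _ x => by
      refine (dot_sq_le _ _).trans_eq ?_
      have := (TetMesh.face_size_pos F).ne'
      field_simp
  have y3 := two_mul_abs_bdrySum_le (M := M) (inv_pos.2 hc0)
    (f := fun T F x => (outerNormal T.1 F.1 ⨯₃ (evV (curl (σ.u T)) x - σ.chat F x)) ⬝ᵥ
      evV (s T) x) (A := fun T F x => size F.1 * sqLen (evV (s T) x))
    (B := fun T F x => (size F.1)⁻¹ *
      sqLen (outerNormal T.1 F.1 ⨯₃ (evV (curl (σ.u T)) x - σ.chat F x)))
    (fun T F _ => continuousOn_dot (continuousOn_cross_sub _ _ hc F) (continuousOn_evV _ _))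
    (fun T F _ => continuousOn_const.mul (hsq _ _))
    (fun T F _ => continuousOn_const.mul (continuousOn_sqLen (continuousOn_cross_sub _ _ hc F)))
    (fun T F x => mul_nonneg (TetMesh.face_size_pos F).le (sqLen_nonneg _))
    (fun T F x => mul_nonneg (inv_nonneg.2 (TetMesh.face_size_pos F).le) (sqLen_nonneg _))
    fun T F _ x => by
      refine (dot_sq_le _ _).trans_eq ?_
      have := (TetMesh.face_size_pos F).ne'
      field_simp
  rw [inv_inv] at y1 y2 y3
  change _ ≤ c⁻¹ * fieldSq M s + c * fieldSq M σ.r at y1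
  change _ ≤ _ + c * tangJumpSq M σ.u σ.uhat at y2
  change _ ≤ _ + c * curlJumpSq M σ.u σ.chat at y3
  change |2 * formA M σ.r s| ≤ _ at y1
  rw [hK] at y1
  rw [Bh_field, hB, e1]
  have z1 := (abs_le.1 y1).1
  have z2 := (abs_le.1 y2).1
  have z3 := (abs_le.1 y3).1
  have w2 := mul_le_mul_of_nonneg_left b1 (inv_pos.2 hc0).le
  have w3 := mul_le_mul_of_nonneg_left b2 (inv_pos.2 hc0).le
  have hsum : c⁻¹ * K + c⁻¹ * (C1 * (2 * C2 * K)) + c⁻¹ * (C1 * K) = K := by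
    have : c⁻¹ * K + c⁻¹ * (C1 * (2 * C2 * K)) + c⁻¹ * (C1 * K) = c⁻¹ * c * K := by
      rw [hcdef]; ring
    rw [this, inv_mul_cancel₀ hc0.ne', one_mul]
  linarith

end Test

/-! ### Gradient test fields and the estimate for the scalar variable. -/

section Test

variable {Ω : Set E3} {M : TetMesh Ω}

/-- After integration by parts the form contains only the double curl of `v` and the two tangential
jumps. A curl-free field with matching trace and zero curl trace has none of these. -/
lemma formB_eq_zero {v : M.Cell → VPoly} {vhat : M.Face → E3 → Vec} (hv : FaceContinuous vhat)
    (hcurl : ∀ T, curl (v T) = 0)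
    (htr : ∀ (T : M.Cell) (F : M.Face), F.1 ⊆ T.1 → ∀ x ∈ hull F.1,
      outerNormal T.1 F.1 ⨯₃ (evV (v T) x - vhat F x) = 0) (s : M.Cell → VPoly) :
    formB M v vhat 0 s = 0 := by
  have h0 : FaceContinuous (M := M) 0 := (isTraceField_zero M 0).faceContinuous
  have h1 : bdrySum M (fun T F x => (outerNormal T.1 F.1 ⨯₃ (evV (v T) x - vhat F x)) ⬝ᵥ
      evV (curl (s T)) x) = 0 := by
    rw [← bdrySum_zero (M := M)]
    exact bdrySum_congr fun T F hT x hx => by rw [htr T F hT x hx, zero_dotProduct]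
  rw [formB_eq v hv h0 s, h1]
  simp [hcurl, curl_zero, evV_zero, volSum_zero, bdrySum_zero]

lemma formSU_eq_zero (u : M.Cell → VPoly) (uhat chat : M.Face → E3 → Vec) {v : M.Cell → VPoly}
    {vhat : M.Face → E3 → Vec} (hcurl : ∀ T, curl (v T) = 0)
    (htr : ∀ (T : M.Cell) (F : M.Face), F.1 ⊆ T.1 → ∀ x ∈ hull F.1,
      outerNormal T.1 F.1 ⨯₃ (evV (v T) x - vhat F x) = 0) :
    formSU M u uhat chat v vhat 0 = 0 := by
  have h1 : bdrySum M (fun T F x => ((size F.1)⁻¹) ^ 3 *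
      ((outerNormal T.1 F.1 ⨯₃ (evV (u T) x - uhat F x)) ⬝ᵥ
        (outerNormal T.1 F.1 ⨯₃ (evV (v T) x - vhat F x)))) = 0 := by
    rw [← bdrySum_zero (M := M)]
    exact bdrySum_congr fun T F hT x hx => by rw [htr T F hT x hx, dotProduct_zero, mul_zero]
  rw [formSU, h1]
  simp [hcurl, evV_zero, bdrySum_zero]

lemma curl_parts_eq_zero {v : M.Cell → VPoly} {vhat : M.Face → E3 → Vec}
    (hcurl : ∀ T, curl (v T) = 0)
    (htr : ∀ (T : M.Cell) (F : M.Face), F.1 ⊆ T.1 → ∀ x ∈ hull F.1,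
      outerNormal T.1 F.1 ⨯₃ (evV (v T) x - vhat F x) = 0) :
    curlCurlSq M v + tangJumpSq M v vhat + curlJumpSq M v 0 = 0 := by
  have h1 : tangJumpSq M v vhat = 0 := by
    rw [← bdrySum_zero (M := M)]
    exact bdrySum_congr fun T F hT x hx => by rw [htr T F hT x hx, sqLen_zero, mul_zero]
  rw [h1]
  simp [curlCurlSq, curlJumpSq, hcurl, curl_zero, evV_zero, sqLen_zero, volSum_zero, bdrySum_zero]

lemma sqLen_add_sub (a b : Vec) : 2 * (a ⬝ᵥ b) = sqLen a + sqLen b - sqLen (a - b) := by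
  simp only [sqLen, dot_eq, Pi.sub_apply]
  ring

lemma evV_grad_sub (p q : Poly) (x : E3) :
    evV (grad (p - q)) x = evV (grad p) x - evV (grad q) x := by
  funext i
  simp only [evV, grad, map_sub, ev_sub, Pi.sub_apply]

/-- Polarization splits the pairing produced by `c_h` into the wanted `‖∇p‖²`, a useful `‖∇q‖²`, and
the approximation error. -/
lemma two_mul_volSum_grad (p q : M.Cell → Poly) :
    2 * volSum M (fun T x => evV (grad (p T)) x ⬝ᵥ evV (grad (q T)) x) =
      gradSq M p + gradSq M q - gradSq M (fun T => p T - q T) := by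
  have hsq : ∀ (v : VPoly) (S : Set E3), ContinuousOn (fun x => sqLen (evV v x)) S :=
    fun v S => continuousOn_sqLen (continuousOn_evV _ _)
  rw [eq_sub_iff_add_eq, gradSq, gradSq, gradSq, ← volSum_add (fun T => hsq _ _) (fun T => hsq _ _),
    ← volSum_const_mul, ← volSum_add
      (f := fun T x => 2 * evV (grad (p T)) x ⬝ᵥ evV (grad (q T)) x)
      (fun T => continuousOn_const.mul
        (continuousOn_dot (continuousOn_evV _ _) (continuousOn_evV _ _))) (fun T => hsq _ _)]
  refine volSum_congr fun T x _ => ?_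
  rw [sqLen_add_sub, evV_grad_sub]
  ring

lemma gradSq_le (p q : M.Cell → Poly) :
    gradSq M q ≤ 2 * gradSq M p + 2 * gradSq M (fun T => p T - q T) := by
  have hsq : ∀ (v : VPoly) (S : Set E3), ContinuousOn (fun x => sqLen (evV v x)) S :=
    fun v S => continuousOn_sqLen (continuousOn_evV _ _)
  have h2 : ∀ (v : VPoly) (S : Set E3), ContinuousOn (fun x => 2 * sqLen (evV v x)) S :=
    fun v S => continuousOn_const.mul (hsq v S)
  rw [gradSq, gradSq, gradSq, ← volSum_const_mul, ← volSum_const_mul,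
    ← volSum_add (fun T => h2 _ _) (fun T => h2 _ _)]
  refine volSum_mono (fun T => hsq _ _) (fun T => (h2 _ _).add (h2 _ _)) fun T x _ => ?_
  rw [evV_grad_sub]
  generalize evV (grad (p T)) x = a
  generalize evV (grad (q T)) x = b
  have h1 := sqLen_nonneg (fun i => 2 * a i - b i)
  simp only [sqLen, dot_eq, Pi.sub_apply] at h1 ⊢
  nlinarith

lemma continuousOn_const_dot (n : Vec) (v : VPoly) (S : Set E3) :
    ContinuousOn (fun x => n ⬝ᵥ evV v x) S :=
  continuousOn_dot (fun _ => continuousOn_const) (continuousOn_evV _ _)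

lemma fieldSq_neg (v : M.Cell → VPoly) : fieldSq M (fun T => -v T) = fieldSq M v := by
  simp only [fieldSq, evV_neg, sqLen_neg]

lemma exists_bdrySum_size_le (k : ℕ) {κ : ℝ} (hκ : 0 < κ) : ∃ C : ℝ, 0 < C ∧
    ∀ {Ω : Set E3} (M : TetMesh Ω), M.ShapeRegular κ →
      ∀ v : M.Cell → VPoly, (∀ T i, v T i ∈ polyDeg k) →
        bdrySum M (fun T F x => size F.1 * sqLen (evV (v T) x)) ≤ C * fieldSq M v := by
  obtain ⟨C, hC, htrace⟩ := exists_bdrySum_sqLen_le k hκ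
  refine ⟨C, hC, fun M hM v hv => ?_⟩
  have hsq : ∀ (v : VPoly) (S : Set E3), ContinuousOn (fun x => sqLen (evV v x)) S :=
    fun v S => continuousOn_sqLen (continuousOn_evV _ _)
  have h1 := htrace M hM (fun _ => 1) (fun _ => zero_le_one) v hv
  simp only [one_mul] at h1
  refine le_trans (bdrySum_mono (fun T F _ => continuousOn_const.mul (hsq _ _))
    (fun T F _ => continuousOn_const.mul (hsq _ _)) fun T F hT x _ => ?_) h1
  exact mul_le_mul_of_nonneg_right (TetMesh.face_size_le hT) (sqLen_nonneg _)

/-- Unit length of the normal, with the weight split as `h_F` and `h_F⁻¹`. -/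
lemma two_mul_abs_bdrySum_normal_le {t : ℝ} (ht : 0 < t) (v : M.Cell → VPoly) (p : M.Cell → Poly)
    {phat : M.Face → E3 → ℝ} (hp : ∀ F, ContinuousOn (phat F) (hull F.1)) :
    |2 * bdrySum M (fun T F x => (outerNormal T.1 F.1 ⬝ᵥ evV (v T) x) * (ev (p T) x - phat F x))| ≤
      t * bdrySum M (fun T F x => size F.1 * sqLen (evV (v T) x)) + t⁻¹ * traceJumpSq M p phat := by
  have hc : ∀ (T : M.Cell) (F : M.Face), ContinuousOn (fun x => ev (p T) x - phat F x) (hull F.1) :=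
    fun T F => (continuous_ev _).continuousOn.sub (hp F)
  refine two_mul_abs_bdrySum_le ht (fun T F _ => ?_) (fun T F _ => ?_) (fun T F _ => ?_)
    (fun T F x => ?_) (fun T F x => ?_) fun T F hT x => ?_
  · exact (continuousOn_const_dot _ _ _).mul (hc T F)
  · exact continuousOn_const.mul (continuousOn_sqLen (continuousOn_evV _ _))
  · exact continuousOn_const.mul ((hc T F).pow 2)
  · exact mul_nonneg (TetMesh.face_size_pos F).le (sqLen_nonneg _)
  · exact mul_nonneg (inv_nonneg.2 (TetMesh.face_size_pos F).le) (sq_nonneg _)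
  · have h1 := dot_sq_le (outerNormal T.1 F.1) (evV (v T) x)
    rw [(TetMesh.isOuterNormal hT).1.1, one_mul] at h1
    have := (TetMesh.face_size_pos F).ne'
    rw [mul_pow]
    refine (mul_le_mul_of_nonneg_right h1 (sq_nonneg _)).trans_eq ?_
    field_simp

lemma two_mul_abs_formSP_le {t : ℝ} (ht : 0 < t) (p q : M.Cell → Poly)
    {phat qhat : M.Face → E3 → ℝ} (hp : ∀ F, ContinuousOn (phat F) (hull F.1))
    (hq : ∀ F, ContinuousOn (qhat F) (hull F.1)) :
    |2 * formSP M p phat q qhat| ≤ t * traceJumpSq M q qhat + t⁻¹ * traceJumpSq M p phat := by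
  have hc : ∀ (p : M.Cell → Poly) {phat : M.Face → E3 → ℝ},
      (∀ F, ContinuousOn (phat F) (hull F.1)) → ∀ (T : M.Cell) (F : M.Face),
        ContinuousOn (fun x => ev (p T) x - phat F x) (hull F.1) :=
    fun p phat hp T F => (continuous_ev _).continuousOn.sub (hp F)
  refine two_mul_abs_bdrySum_le ht (fun T F _ => ?_) (fun T F _ => ?_) (fun T F _ => ?_)
    (fun T F x => ?_) (fun T F x => ?_) fun T F hT x => le_of_eq (by ring)
  · exact continuousOn_const.mul ((hc p hp T F).mul (hc q hq T F))
  · exact continuousOn_const.mul ((hc q hq T F).pow 2)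
  · exact continuousOn_const.mul ((hc p hp T F).pow 2)
  · exact mul_nonneg (inv_nonneg.2 (TetMesh.face_size_pos F).le) (sq_nonneg _)
  · exact mul_nonneg (inv_nonneg.2 (TetMesh.face_size_pos F).le) (sq_nonneg _)

/-- The scalar variable is approximated by a piecewise polynomial whose gradient has a tangential
trace. -/
lemma exists_grad_trace {k : ℕ} (hk : 1 ≤ k) {κ : ℝ} (hκ : 0 < κ) : ∃ C : ℝ, 0 < C ∧
    ∀ {Ω : Set E3} (M : TetMesh Ω), M.ShapeRegular κ → ∀ σ ∈ sigmaZero M k,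
      ∃ (q : M.Cell → Poly) (w : M.Face → E3 → Vec), (∀ T, q T ∈ polyDeg k) ∧
        IsTraceField M k w ∧ (∀ (T : M.Cell) (F : M.Face), F.1 ⊆ T.1 → ∀ x ∈ hull F.1,
          outerNormal T.1 F.1 ⨯₃ (evV (grad (q T)) x - w F x) = 0) ∧
        gradSq M (fun T => σ.p T - q T) ≤ C * traceJumpSq M σ.p σ.phat := by
  obtain ⟨C, hC, hconf⟩ := exists_conforming hk hκ
  refine ⟨C, hC, fun M hM σ hσ => ?_⟩
  -- The face functions are polynomials cut off outside the face; the approximation lemma takes the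
  -- polynomials themselves.
  choose ph hph hphat using fun F => hσ.phat_mem F
  have hev : ∀ (F : M.Face), ∀ x ∈ hull F.1, σ.phat F x = ev (ph F) x := fun F x hx => by
    rw [hphat F, Set.indicator_of_mem hx]
  obtain ⟨q, hq, hcont, hbd, herr⟩ := hconf M hM σ.p hσ.p_mem ph hph
    fun F hF x hx => by rw [← hev F x hx, hσ.phat_boundary F hF x hx]
  obtain ⟨w, hw, hwq⟩ := exists_trace_grad hq hcont hbd
  exact ⟨q, w, hq, hw, hwq, herr.trans_eq <| congrArg (C * ·) <|
    bdrySum_congr fun T F _ x hx => by rw [hev F x hx]⟩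

/-- The test function that yields the norm of `∇p`. -/
lemma exists_test_grad {k : ℕ} (hk : 1 ≤ k) {κ : ℝ} (hκ : 0 < κ) : ∃ C : ℝ, 0 < C ∧
    ∀ {Ω : Set E3} (M : TetMesh Ω), M.ShapeRegular κ → ∀ σ ∈ sigmaZero M k,
      ∃ τ ∈ sigmaZero M k, gradSq M σ.p ≤ 2 * Bh M σ τ + C * traceJumpSq M σ.p σ.phat ∧
        sigmaSq M 0 0 τ ≤ C * (gradSq M σ.p + traceJumpSq M σ.p σ.phat) := by
  obtain ⟨C0, hC0, hconf⟩ := exists_grad_trace hk hκ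
  obtain ⟨C1, hC1, htrace⟩ := exists_bdrySum_size_le k hκ
  obtain ⟨C2, hC2, hdiv⟩ := exists_divSq_le k hκ
  refine ⟨C0 + C1 + 2 * C2 * (1 + C0), by positivity, fun M hM σ hσ => ?_⟩
  obtain ⟨q, w, hq, hw, hwq, herr⟩ := hconf M hM σ hσ
  -- The sign turns the term `-(v, ∇p)` of `formC_eq` into `(∇q, ∇p)`.
  set v : M.Cell → VPoly := fun T => -grad (q T) with hv
  have hvmem : ∀ T i, v T i ∈ polyDeg k := fun T i =>
    Submodule.neg_mem _ (polyDeg_mono (Nat.sub_le _ _) (grad_mem (hq T) i))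
  have hcurl : ∀ T, curl (v T) = 0 := fun T => by rw [hv, curl_neg, curl_grad, neg_zero]
  have htr : ∀ (T : M.Cell) (F : M.Face), F.1 ⊆ T.1 → ∀ x ∈ hull F.1,
      outerNormal T.1 F.1 ⨯₃ (evV (v T) x - (-w) F x) = 0 := fun T F hT x hx => by
    rw [hv, Pi.neg_apply, Pi.neg_apply, evV_neg, cross_neg_sub, hwq T F hT x hx, neg_zero]
  have hphc : ∀ F, ContinuousOn (σ.phat F) (hull F.1) := fun F =>
    facePoly_continuousOn (hσ.phat_mem F)
  set G := gradSq M σ.p with hG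
  set S := traceJumpSq M σ.p σ.phat with hSdef
  set V := gradSq M q with hV
  set E := gradSq M (fun T => σ.p T - q T) with hE
  have hG0 : 0 ≤ G := gradSq_nonneg _
  have hS0 : 0 ≤ S := traceJumpSq_nonneg _ _
  have hvV : fieldSq M v = V := fieldSq_neg _
  have hcross : 2 * volSum M (fun T x => evV (v T) x ⬝ᵥ evV (grad (σ.p T)) x) = -(G + V - E) := by
    rw [hG, hV, hE, ← two_mul_volSum_grad, ← mul_neg, ← volSum_neg]
    exact congrArg (2 * ·) <| volSum_congr fun T x _ => by
      rw [hv, evV_neg, neg_dotProduct, dotProduct_comm]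
  have hVle : V ≤ 2 * G + 2 * E := gradSq_le _ _
  -- With Young weight `C1⁻¹` the boundary term costs exactly `V`, which the term `V` from
  -- polarization pays for.
  have y := two_mul_abs_bdrySum_normal_le (inv_pos.2 hC1) v σ.p hphc
  have b1 := htrace M hM v hvmem
  rw [hvV] at b1
  rw [inv_inv] at y
  have z := (abs_le.1 y).1
  have b2 := mul_le_mul_of_nonneg_left b1 (inv_pos.2 hC1).le
  rw [inv_mul_cancel_left₀ hC1.ne'] at b2
  refine ⟨_, memSigmaZero_potential hvmem hw.neg (isTraceField_zero M _), ?_, ?_⟩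
  · rw [Bh_potential, formB_eq_zero hw.neg.faceContinuous hcurl htr,
      formSU_eq_zero _ _ _ hcurl htr, formC_eq _ hphc]
    have : 0 ≤ 2 * C2 * (1 + C0) * S := mul_nonneg (by positivity) hS0
    linarith
  · rw [sigmaSq_potential, curl_parts_eq_zero hcurl htr, zero_add]
    refine (hdiv M hM v hvmem).trans ?_
    change C2 * fieldSq M v ≤ _
    rw [hvV]
    have h1 : V ≤ 2 * (G + C0 * S) := by linarith
    have h2 := mul_le_mul_of_nonneg_left h1 hC2.le
    have h3 := mul_nonneg (add_pos hC0 hC1).le (add_nonneg hG0 hS0)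
    have h4 := mul_nonneg (mul_pos hC2 hC0).le hG0
    have h5 := mul_nonneg hC2.le hS0
    linarith

/-! ### The jump of the normal component as a test function on the faces. -/

open scoped Classical in
/-- The polynomial `-h_F ⟦n·u⟧` on the interior faces, zero on the boundary faces. -/
def jumpTrace (u : M.Cell → VPoly) (F : M.Face) : Poly :=
  if M.IsBoundary F then 0 else -size F.1 • jumpPoly u F

lemma jumpTrace_mem {k : ℕ} {u : M.Cell → VPoly} (hu : ∀ T i, u T i ∈ polyDeg k) (F : M.Face) :
    jumpTrace u F ∈ polyDeg k := by
  rw [jumpTrace]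
  split_ifs
  exacts [Submodule.zero_mem _, Submodule.smul_mem _ _ (jumpPoly_mem hu F)]

lemma ev_jumpTrace_boundary (u : M.Cell → VPoly) {F : M.Face} (hF : M.IsBoundary F) (x : E3) :
    ev (jumpTrace u F) x = 0 := by rw [jumpTrace, if_pos hF, ev_zero]

lemma ev_jumpTrace_interior (u : M.Cell → VPoly) {F : M.Face} (hF : ¬ M.IsBoundary F) (x : E3) :
    ev (jumpTrace u F) x = -size F.1 * normalJump M u F x := by
  rw [jumpTrace, if_neg hF, ev_smul, ev_jumpPoly]

/-- The test function has one value per face, so summing over the adjacent cells turns the normal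
components into their jump; boundary faces drop out. -/
lemma bdrySum_normal_jumpTrace (u : M.Cell → VPoly) :
    bdrySum M (fun T F x => (outerNormal T.1 F.1 ⬝ᵥ evV (u T) x) * ev (jumpTrace u F) x) =
      -interiorFaceSum M (fun F x => size F.1 * normalJump M u F x ^ 2) := by
  classical
  rw [bdrySum_comm, interiorFaceSum, Finset.sum_filter, ← Finset.sum_neg_distrib]
  refine Finset.sum_congr rfl fun F _ => ?_
  have hint : ∀ T : M.Cell, IntegrableOn
      (fun x => (outerNormal T.1 F.1 ⬝ᵥ evV (u T) x) * ev (jumpTrace u F) x) (hull F.1) μHE[2] :=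
    fun T => integrableOn_face F ((continuousOn_const_dot _ _ _).mul (continuous_ev _).continuousOn)
  simp only [faceInt]
  rw [← integral_finsetSum _ fun T _ => hint T]
  simp only [← Finset.sum_mul]
  by_cases hF : M.IsBoundary F
  · simp only [ev_jumpTrace_boundary u hF, mul_zero, integral_zero, if_neg (not_not.2 hF), neg_zero]
  · rw [if_pos hF, ← integral_neg]
    refine setIntegral_congr_fun (measurableSet_hull _) fun x _ => ?_
    simp only [ev_jumpTrace_interior u hF, normalJump]
    ring

/-- Each face is counted once for every adjacent cell, at most `κ³` times. -/
lemma bdrySum_jumpTrace_sq_le {κ : ℝ} (hκ : 0 < κ) (hM : M.ShapeRegular κ) (u : M.Cell → VPoly) :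
    bdrySum M (fun _ F x => (size F.1)⁻¹ * ev (jumpTrace u F) x ^ 2) ≤
      κ ^ 3 * interiorFaceSum M (fun F x => size F.1 * normalJump M u F x ^ 2) := by
  classical
  rw [bdrySum_comm, interiorFaceSum, Finset.sum_filter, Finset.mul_sum]
  refine Finset.sum_le_sum fun F _ => ?_
  rw [Finset.sum_const, nsmul_eq_mul]
  have h0 : 0 ≤ faceInt F.1 (fun x => (size F.1)⁻¹ * ev (jumpTrace u F) x ^ 2) :=
    integral_nonneg fun x => mul_nonneg (inv_nonneg.2 (TetMesh.face_size_pos F).le) (sq_nonneg _)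
  refine (mul_le_mul_of_nonneg_right
    (hM.card_cells_superset_le hκ (TetMesh.face_isSimplex F).nonempty) h0).trans_eq ?_
  congr 1
  by_cases hF : M.IsBoundary F
  · simp [ev_jumpTrace_boundary u hF, if_neg (not_not.2 hF), faceInt]
  · rw [if_pos hF]
    refine setIntegral_congr_fun (measurableSet_hull _) fun x _ => ?_
    simp only [ev_jumpTrace_interior u hF]
    have := (TetMesh.face_size_pos F).ne'
    field_simp

lemma traceJumpSq_le (q : M.Cell → Poly) (J : M.Face → Poly) :
    traceJumpSq M q (fun F => (hull F.1).indicator (ev (J F))) ≤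
      2 * bdrySum M (fun T F x => (size F.1)⁻¹ * ev (q T) x ^ 2) +
        2 * bdrySum M (fun _ F x => (size F.1)⁻¹ * ev (J F) x ^ 2) := by
  have h1 : traceJumpSq M q (fun F => (hull F.1).indicator (ev (J F))) =
      bdrySum M (fun T F x => (size F.1)⁻¹ * (ev (q T) x - ev (J F) x) ^ 2) :=
    bdrySum_congr fun T F _ x hx => by
      beta_reduce
      rw [Set.indicator_of_mem hx]
  rw [h1, ← bdrySum_const_mul, ← bdrySum_const_mul, ← bdrySum_add
    (f := fun T F x => 2 * ((size F.1)⁻¹ * ev (q T) x ^ 2))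
    (g := fun _ F x => 2 * ((size F.1)⁻¹ * ev (J F) x ^ 2)) (fun T F _ => by fun_prop)
    (fun T F _ => by fun_prop)]
  refine bdrySum_mono (fun T F _ => by fun_prop) (fun T F _ => by fun_prop) fun T F _ x _ => ?_
  have h2 := inv_pos.2 (TetMesh.face_size_pos F)
  nlinarith [mul_nonneg h2.le (sq_nonneg (ev (q T) x + ev (J F) x))]

/-- The weighted inverse and trace inequalities, with weight `h_T²`. The factor `κ / 2` trades
`h_F⁻¹` for `h_T⁻¹`. -/
lemma exists_scaled_le (k : ℕ) {κ : ℝ} (hκ : 0 < κ) : ∃ C : ℝ, 0 < C ∧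
    ∀ {Ω : Set E3} (M : TetMesh Ω), M.ShapeRegular κ →
      ∀ d : M.Cell → Poly, (∀ T, d T ∈ polyDeg k) →
        bdrySum M (fun T F x => (size F.1)⁻¹ * ev (size T.1 ^ 2 • d T) x ^ 2) ≤
          C * volSum M (fun T x => (size T.1 * ev (d T) x) ^ 2) ∧
        gradSq M (fun T => size T.1 ^ 2 • d T) ≤
          C * volSum M (fun T x => (size T.1 * ev (d T) x) ^ 2) := by
  obtain ⟨C1, hC1, htrace⟩ := exists_bdrySum_le k hκ
  obtain ⟨C2, hC2, hgrad⟩ := exists_volSum_grad_le k hκ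
  refine ⟨κ / 2 * C1 + C2, by positivity, fun M hM d hd => ?_⟩
  have h0 : 0 ≤ volSum M (fun T x => (size T.1 * ev (d T) x) ^ 2) :=
    volSum_nonneg fun _ _ _ => sq_nonneg _
  have h1 := htrace M hM (fun T => size T.1 ^ 2) (fun T => sq_nonneg _) d hd
  have h2 := hgrad M hM (fun T => size T.1 ^ 2) (fun T => sq_nonneg _) d hd
  simp only [← mul_pow] at h1 h2
  constructor
  · have h3 := mul_le_mul_of_nonneg_left h1 (by positivity : 0 ≤ κ / 2)
    rw [← bdrySum_const_mul] at h3
    refine (bdrySum_mono (fun T F _ => by fun_prop) (fun T F _ => by fun_prop)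
      fun T F hT x _ => ?_).trans (h3.trans ?_)
    · have h4 := hM.cell_size_le hκ hT
      have h5 := TetMesh.face_size_pos F
      have h6 := TetMesh.cell_size_pos T
      have h7 : (size F.1)⁻¹ * size T.1 ≤ κ / 2 := by
        rw [← div_eq_inv_mul, div_le_iff₀ h5]
        linarith
      have h8 := mul_le_mul_of_nonneg_right h7
        (by positivity : 0 ≤ size T.1 ^ 3 * ev (d T) x ^ 2)
      rw [ev_smul]
      calc _ = (size F.1)⁻¹ * size T.1 * (size T.1 ^ 3 * ev (d T) x ^ 2) := by ring
        _ ≤ _ := h8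
        _ = _ := by ring
    · linarith [mul_nonneg hC2.le h0]
  · refine le_trans (le_of_eq_of_le (volSum_congr fun T x _ => ?_) h2) ?_
    · simp only [sqLen_evV, grad, Derivation.map_smul, ev_smul, mul_pow, Finset.mul_sum]
      exact Finset.sum_congr rfl fun i _ => by ring
    · linarith [mul_nonneg (mul_nonneg (half_pos hκ).le hC1.le) h0]

/-- The test function that yields the seminorm of `H(div)`. -/
lemma exists_test_div (k : ℕ) {κ : ℝ} (hκ : 0 < κ) : ∃ C : ℝ, 0 < C ∧
    ∀ {Ω : Set E3} (M : TetMesh Ω), M.ShapeRegular κ → ∀ σ ∈ sigmaZero M k,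
      ∃ τ ∈ sigmaZero M k, divSq M σ.u ≤ 2 * Bh M σ τ + C * traceJumpSq M σ.p σ.phat ∧
        sigmaSq M 0 0 τ ≤ C * divSq M σ.u := by
  obtain ⟨C, hC, hscaled⟩ := exists_scaled_le k hκ
  refine ⟨3 * C + 2 * κ ^ 3, by positivity, fun M hM σ hσ => ?_⟩
  set d : M.Cell → Poly := fun T => divg (σ.u T) with hd
  have hdmem : ∀ T, d T ∈ polyDeg k := fun T =>
    polyDeg_mono (Nat.sub_le _ _) (divg_mem (hσ.u_mem T))
  obtain ⟨hq1, hq2⟩ := hscaled M hM d hdmem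
  -- This choice makes `c_h` equal to the squared seminorm: the volume part is weighted by `h_T²`,
  -- and the face part comes from `jumpTrace`.
  set q : M.Cell → Poly := fun T => size T.1 ^ 2 • d T with hq
  set qhat : M.Face → E3 → ℝ := fun F => (hull F.1).indicator (ev (jumpTrace σ.u F)) with hqhat
  have hqhatmem : ∀ F : M.Face, qhat F ∈ facePoly F.1 k := fun F =>
    ⟨_, jumpTrace_mem hσ.u_mem F, rfl⟩
  have hqhatev : ∀ F : M.Face, ∀ x ∈ hull F.1, qhat F x = ev (jumpTrace σ.u F) x :=
    fun F x hx => Set.indicator_of_mem hx _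
  set D1 := volSum M (fun T x => (size T.1 * ev (d T) x) ^ 2) with hD1
  set D2 := interiorFaceSum M (fun F x => size F.1 * normalJump M σ.u F x ^ 2) with hD2
  have hD : divSq M σ.u = D1 + D2 := rfl
  have hD10 : 0 ≤ D1 := volSum_nonneg fun _ _ _ => sq_nonneg _
  have hD20 : 0 ≤ D2 := interiorFaceSum_nonneg fun F _ =>
    mul_nonneg (TetMesh.face_size_pos F).le (sq_nonneg _)
  have hform : formC M q qhat σ.u = D1 + D2 := by
    have h1 : volSum M (fun T x => ev (divg (σ.u T)) x * ev (q T) x) = D1 :=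
      volSum_congr fun T x _ => by
        simp only [hq, ev_smul]
        ring
    have h2 : bdrySum M (fun T F x => (outerNormal T.1 F.1 ⬝ᵥ evV (σ.u T) x) * qhat F x) =
        -D2 := by
      rw [hD2, ← bdrySum_normal_jumpTrace]
      exact bdrySum_congr fun T F _ x hx => by rw [hqhatev F x hx]
    rw [formC, h1, h2, sub_neg_eq_add]
  have hN : traceJumpSq M q qhat ≤ (2 * C + 2 * κ ^ 3) * (D1 + D2) := by
    have h1 := traceJumpSq_le q (jumpTrace σ.u)
    have h2 := bdrySum_jumpTrace_sq_le hκ hM σ.u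
    have h3 : 0 ≤ 2 * κ ^ 3 * D1 + 2 * C * D2 := by positivity
    linarith
  have hS0 : 0 ≤ traceJumpSq M σ.p σ.phat := traceJumpSq_nonneg _ _
  -- With Young weight `c⁻¹` the stabilization term costs at most one of the two copies of the
  -- seminorm.
  set c := 2 * C + 2 * κ ^ 3 with hc
  have hc0 : 0 < c := by positivity
  have y := two_mul_abs_formSP_le (inv_pos.2 hc0) σ.p q
    (fun F => facePoly_continuousOn (hσ.phat_mem F)) fun F => facePoly_continuousOn (hqhatmem F)
  rw [inv_inv] at y
  have z := (abs_le.1 y).1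
  have b := mul_le_mul_of_nonneg_left hN (inv_pos.2 hc0).le
  rw [inv_mul_cancel_left₀ hc0.ne'] at b
  refine ⟨_, memSigmaZero_scalar (q := q) (fun T => Submodule.smul_mem _ _ (hdmem T)) hqhatmem
    (fun F hF x hx => by rw [hqhatev F x hx, ev_jumpTrace_boundary _ hF]), ?_, ?_⟩
  · rw [Bh_scalar, hform, hD]
    linarith [mul_nonneg hC.le hS0]
  · rw [sigmaSq_scalar, hD]
    linarith [mul_nonneg hC.le hD20]

end Test

/-! ### The stability estimate -/

/-- The stabilization terms are bounded first. They pay for the remainders of the other three tests,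
and every test tuple has norm at most a constant times that of `σ`. Altogether the squared norm is
at most a constant times `m` times the norm, and one factor cancels. -/
theorem exists_stability {k : ℕ} (hk : 1 ≤ k) {κ : ℝ} (hκ : 0 < κ) : ∃ C : ℝ, 0 < C ∧
    ∀ {Ω : Set E3} (M : TetMesh Ω), M.ShapeRegular κ → ∀ σ ∈ sigmaZero M k, ∀ m : ℝ, 0 ≤ m →
      (∀ τ ∈ sigmaZero M k, Bh M σ τ ≤ m * Real.sqrt (sigmaSq M 0 0 τ)) →
        Real.sqrt (sigmaSq M 0 0 σ) ≤ C * m := by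
  obtain ⟨C1, hC1, htest1⟩ := exists_test_curlCurl k hκ
  obtain ⟨C2, hC2, htest2⟩ := exists_test_grad hk hκ
  obtain ⟨C3, hC3, htest3⟩ := exists_test_div k hκ
  -- The square roots come from the norms of the test tuples, the constants themselves from the
  -- remainders. The number seven is generous.
  refine ⟨7 + C1 + (2 * Real.sqrt C2 + C2) + (2 * Real.sqrt C3 + C3), by positivity,
    fun M hM σ hσ m hm h => ?_⟩
  obtain ⟨τ0, hτ0, hB0, hN0⟩ := exists_test_stabilization hσ
  obtain ⟨τ1, hτ1, hB1, hN1⟩ := htest1 M hM σ hσ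
  obtain ⟨τ2, hτ2, hB2, hN2⟩ := htest2 M hM σ hσ
  obtain ⟨τ3, hτ3, hB3, hN3⟩ := htest3 M hM σ hσ
  have hsum := sigmaSq_zero_zero σ
  have p1 := fieldSq_nonneg σ.r
  have p2 := curlCurlSq_nonneg σ.u
  have p3 := tangJumpSq_nonneg σ.u σ.uhat
  have p4 := curlJumpSq_nonneg σ.u σ.chat
  have p5 := divSq_nonneg σ.u
  have p6 := gradSq_nonneg σ.p
  have p7 := traceJumpSq_nonneg σ.p σ.phat
  have h0 := h τ0 hτ0
  have h1 := h τ1 hτ1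
  have h2 := h τ2 hτ2
  have h3 := h τ3 hτ3
  generalize fieldSq M σ.r = R at *
  generalize curlCurlSq M σ.u = K at *
  generalize tangJumpSq M σ.u σ.uhat = J1 at *
  generalize curlJumpSq M σ.u σ.chat = J2 at *
  generalize divSq M σ.u = D at *
  generalize gradSq M σ.p = G at *
  generalize traceJumpSq M σ.p σ.phat = S at *
  generalize sigmaSq M 0 0 σ = Q2 at *
  generalize Bh M σ τ0 = B0 at *
  generalize Bh M σ τ1 = B1 at *
  generalize Bh M σ τ2 = B2 at *
  generalize Bh M σ τ3 = B3 at *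
  generalize sigmaSq M 0 0 τ0 = N0 at *
  generalize sigmaSq M 0 0 τ1 = N1 at *
  generalize sigmaSq M 0 0 τ2 = N2 at *
  generalize sigmaSq M 0 0 τ3 = N3 at *
  have hQ2 : 0 ≤ Q2 := by rw [hsum]; positivity
  set Q := Real.sqrt Q2 with hQ
  have hQ0 : 0 ≤ Q := Real.sqrt_nonneg _
  have hQQ : Q ^ 2 = Q2 := Real.sq_sqrt hQ2
  rw [hN0, ← hQ] at h0
  have e1 : Real.sqrt N1 ≤ Q := Real.sqrt_le_sqrt (by linarith)
  have e2 : Real.sqrt N2 ≤ Real.sqrt C2 * Q := by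
    rw [hQ, ← Real.sqrt_mul hC2.le]
    exact Real.sqrt_le_sqrt (hN2.trans (mul_le_mul_of_nonneg_left (by linarith) hC2.le))
  have e3 : Real.sqrt N3 ≤ Real.sqrt C3 * Q := by
    rw [hQ, ← Real.sqrt_mul hC3.le]
    exact Real.sqrt_le_sqrt (hN3.trans (mul_le_mul_of_nonneg_left (by linarith) hC3.le))
  have f1 := mul_le_mul_of_nonneg_left e1 hm
  have f2 := mul_le_mul_of_nonneg_left e2 hm
  have f3 := mul_le_mul_of_nonneg_left e3 hm
  have g1 := mul_le_mul_of_nonneg_left (show R + J1 + J2 ≤ m * Q by linarith) hC1.le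
  have g2 := mul_le_mul_of_nonneg_left (show S ≤ m * Q by linarith) hC2.le
  have g3 := mul_le_mul_of_nonneg_left (show S ≤ m * Q by linarith) hC3.le
  have hmQ : 0 ≤ m * Q := mul_nonneg hm hQ0
  have hfinal : Q ^ 2 ≤
      (7 + C1 + (2 * Real.sqrt C2 + C2) + (2 * Real.sqrt C3 + C3)) * m * Q := by
    rw [hQQ, hsum]
    linarith
  rcases hQ0.eq_or_lt with h4 | h4
  · rw [← h4]
    positivity
  · exact le_of_mul_le_mul_right (by rw [← pow_two]; exact hfinal) h4

/-! ### From stability to the supremum. -/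

section Sup

variable {Ω : Set E3} {M : TetMesh Ω}

/-- The coupling terms occur in mirrored pairs, and the remaining three terms are symmetric. -/
lemma Bh_comm (σ τ : Tuple M) : Bh M σ τ = Bh M τ σ := by
  have h1 : formA M σ.r τ.r = formA M τ.r σ.r := by
    simp only [formA, dotProduct_comm]
  have h2 : formSU M σ.u σ.uhat σ.chat τ.u τ.uhat τ.chat =
      formSU M τ.u τ.uhat τ.chat σ.u σ.uhat σ.chat := by
    rw [formSU, formSU]
    exact congrArg₂ (· + ·) (bdrySum_congr fun T F _ x _ => by rw [dotProduct_comm])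
      (bdrySum_congr fun T F _ x _ => by rw [dotProduct_comm])
  have h3 : formSP M σ.p σ.phat τ.p τ.phat = formSP M τ.p τ.phat σ.p σ.phat :=
    bdrySum_congr fun T F _ x _ => by rw [mul_comm (ev (σ.p T) x - σ.phat F x)]
  rw [Bh, Bh, h1, h2, h3]
  ring

/-! ### The norms for the different powers of the mesh size -/

lemma normUSq_nonneg (u : M.Cell → VPoly) (uhat chat : M.Face → E3 → Vec) :
    0 ≤ normUSq M u uhat chat :=
  add_nonneg (add_nonneg (add_nonneg (curlCurlSq_nonneg u) (tangJumpSq_nonneg u uhat))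
    (curlJumpSq_nonneg u chat)) (divSq_nonneg u)

lemma normPSq_nonneg (α β : ℕ) (p : M.Cell → Poly) (phat : M.Face → E3 → ℝ) :
    0 ≤ normPSq M α β p phat :=
  add_nonneg (volSum_nonneg fun _ _ _ => mul_nonneg (sq_nonneg _) (sqLen_nonneg _))
    (bdrySum_nonneg fun _ F _ _ _ => mul_nonneg (mul_nonneg (sq_nonneg _)
      (inv_nonneg.2 (TetMesh.face_size_pos F).le)) (sq_nonneg _))

lemma sigmaSq_nonneg (α β : ℕ) (σ : Tuple M) : 0 ≤ sigmaSq M α β σ :=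
  add_nonneg (add_nonneg (fieldSq_nonneg _) (normUSq_nonneg _ _ _)) (normPSq_nonneg _ _ _ _)

lemma normSigma_eq (α β : ℕ) (σ : Tuple M) :
    normSigma M α β σ = Real.sqrt (sigmaSq M α β σ) := rfl

lemma pow_sq_le {s L : ℝ} (hs : 0 ≤ s) (hsL : s ≤ L) (hL : 1 ≤ L) {α : ℕ} (hα : α ≤ 1) :
    (s ^ α) ^ 2 ≤ L ^ 2 := by
  interval_cases α
  · nlinarith
  · nlinarith

/-- Positive powers of the mesh size are bounded by `L`. The case `α = β = 0` is thus the strongest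
norm up to this factor. -/
lemma normSigma_le {L : ℝ} (hL : 1 ≤ L) (hsize : ∀ T : M.Cell, size T.1 ≤ L) {α β : ℕ}
    (hα : α ≤ 1) (hβ : β ≤ 1) {k : ℕ} {σ : Tuple M} (hσ : σ ∈ sigmaZero M k) :
    normSigma M α β σ ≤ L * Real.sqrt (sigmaSq M 0 0 σ) := by
  have hL0 : 0 ≤ L := zero_le_one.trans hL
  have h1 : volSum M (fun T x => (size T.1 ^ α) ^ 2 * sqLen (evV (grad (σ.p T)) x)) ≤
      L ^ 2 * gradSq M σ.p := by
    rw [gradSq, ← volSum_const_mul]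
    have hsq : ∀ T : M.Cell, ContinuousOn (fun x => sqLen (evV (grad (σ.p T)) x)) (hull T.1) :=
      fun T => continuousOn_sqLen (continuousOn_evV _ _)
    exact volSum_mono (fun T => continuousOn_const.mul (hsq T))
      (fun T => continuousOn_const.mul (hsq T)) fun T x _ => mul_le_mul_of_nonneg_right
        (pow_sq_le (TetMesh.cell_size_pos T).le (hsize T) hL hα) (sqLen_nonneg _)
  have h2 : bdrySum M (fun T F x => (size F.1 ^ β) ^ 2 * (size F.1)⁻¹ *
      (ev (σ.p T) x - σ.phat F x) ^ 2) ≤ L ^ 2 * traceJumpSq M σ.p σ.phat := by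
    rw [traceJumpSq, ← bdrySum_const_mul]
    have hsq : ∀ (T : M.Cell) (F : M.Face),
        ContinuousOn (fun x => (ev (σ.p T) x - σ.phat F x) ^ 2) (hull F.1) := fun T F =>
      ((continuous_ev _).continuousOn.sub (facePoly_continuousOn (hσ.phat_mem F))).pow 2
    refine bdrySum_mono (fun T F _ => continuousOn_const.mul (hsq T F))
      (fun T F _ => continuousOn_const.mul (continuousOn_const.mul (hsq T F))) fun T F hT x _ => ?_
    rw [mul_assoc]
    refine mul_le_mul_of_nonneg_right (pow_sq_le (TetMesh.face_size_pos F).le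
      ((TetMesh.face_size_le hT).trans (hsize T)) hL hβ) ?_
    exact mul_nonneg (inv_nonneg.2 (TetMesh.face_size_pos F).le) (sq_nonneg _)
  have hL2 : 1 ≤ L ^ 2 := one_le_pow₀ hL
  have h3 : sigmaSq M α β σ ≤ L ^ 2 * sigmaSq M 0 0 σ := by
    have e1 : sigmaSq M α β σ = fieldSq M σ.r + normUSq M σ.u σ.uhat σ.chat +
      normPSq M α β σ.p σ.phat := rfl
    have e2 : sigmaSq M 0 0 σ = fieldSq M σ.r + normUSq M σ.u σ.uhat σ.chat +
        (gradSq M σ.p + traceJumpSq M σ.p σ.phat) := by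
      simp only [sigmaSq, normPSq, pow_zero, one_pow, one_mul, fieldSq, gradSq, traceJumpSq]
    have e3 : normPSq M α β σ.p σ.phat ≤ L ^ 2 * (gradSq M σ.p + traceJumpSq M σ.p σ.phat) := by
      rw [mul_add]
      exact add_le_add h1 h2
    have e4 := mul_le_mul_of_nonneg_right hL2 (fieldSq_nonneg σ.r)
    have e5 := mul_le_mul_of_nonneg_right hL2 (normUSq_nonneg σ.u σ.uhat σ.chat)
    rw [e1, e2]
    linarith
  rw [normSigma_eq]
  refine (Real.sqrt_le_sqrt h3).trans_eq ?_
  rw [Real.sqrt_mul (sq_nonneg L), Real.sqrt_sq hL0]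

/-- All cells lie in one ball around the closure of `Ω`, so the bound does not depend on the mesh.
-/
lemma exists_size_le (hΩ : Bornology.IsBounded Ω) :
    ∃ L : ℝ, 1 ≤ L ∧ ∀ (M : TetMesh Ω) (T : M.Cell), size T.1 ≤ L := by
  obtain ⟨r, hr⟩ := hΩ.closure.subset_closedBall (0 : E3)
  refine ⟨max 1 (2 * r), le_max_left _ _, fun M T => le_trans ?_ (le_max_right _ _)⟩
  refine size_le (c := 0) (TetMesh.cell_isSimplex T).nonempty ?_
  rw [mul_div_cancel_left₀ r two_ne_zero]
  refine subset_trans ?_ hr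
  rw [← M.covers]
  exact Set.subset_biUnion_of_mem (u := fun s => hull s) T.2

/-- A mesh without cells would have no nonzero tuple, and the supremum would be over the empty set.
-/
lemma nonempty_cell (M : TetMesh Ω) (hΩ : Ω.Nonempty) : Nonempty M.Cell := by
  obtain ⟨x, hx⟩ := hΩ.closure
  rw [← M.covers] at hx
  obtain ⟨s, hs, _⟩ := Set.mem_iUnion₂.1 hx
  exact ⟨⟨s, hs⟩⟩

/-! ### Tuples of norm zero -/

/-- A constant vector field is added to the first component. -/
def Tuple.addConst (τ : Tuple M) (t : ℝ) : Tuple M :=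
  { τ with r := fun T i => τ.r T i + MvPolynomial.C t }

lemma addConst_mem {k : ℕ} {τ : Tuple M} (hτ : τ ∈ sigmaZero M k) (t : ℝ) :
    τ.addConst t ∈ sigmaZero M k :=
  { hτ with
    r_mem := fun T i => Submodule.add_mem _ (hτ.r_mem T i) (by
      rw [MvPolynomial.mem_restrictTotalDegree, MvPolynomial.totalDegree_C]
      exact Nat.zero_le _) }

lemma curl_add_const (s : VPoly) (t : ℝ) : curl (fun i => s i + MvPolynomial.C t) = curl s := by
  funext i
  fin_cases i <;> simp [curl]

lemma evV_add_const (s : VPoly) (t : ℝ) (x : E3) :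
    evV (fun i => s i + MvPolynomial.C t) x = evV s x + t • fun _ => 1 := by
  funext i
  simp only [evV, ev_add, ev_C, Pi.add_apply, Pi.smul_apply, smul_eq_mul, mul_one]

/-- A constant field has no curl, so only the `L²` product and the term with `ĉ` react to it, both
linearly in `t`. -/
lemma exists_Bh_addConst {k : ℕ} {σ : Tuple M} (hσ : σ ∈ sigmaZero M k) :
    ∃ b : ℝ, ∀ (τ : Tuple M) (t : ℝ), Bh M σ (τ.addConst t) = Bh M σ τ + t * b := by
  refine ⟨volSum M (fun T x => evV (σ.r T) x ⬝ᵥ fun _ => 1) -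
    bdrySum M (fun T F x => (outerNormal T.1 F.1 ⨯₃ σ.chat F x) ⬝ᵥ fun _ => 1), fun τ t => ?_⟩
  have hone : ∀ (S : Set E3) (i : Fin 3),
      ContinuousOn (fun x : E3 => (fun (_ : E3) (_ : Fin 3) => (1 : ℝ)) x i) S :=
    fun S i => continuousOn_const
  have h1 : formA M σ.r (τ.addConst t).r = formA M σ.r τ.r +
      t * volSum M (fun T x => evV (σ.r T) x ⬝ᵥ fun _ => 1) := by
    rw [formA, formA, ← volSum_const_mul, ← volSum_add
      (f := fun T x => evV (σ.r T) x ⬝ᵥ evV (τ.r T) x)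
      (g := fun T x => t * (evV (σ.r T) x ⬝ᵥ fun _ => 1))
      (fun T => continuousOn_dot (continuousOn_evV _ _) (continuousOn_evV _ _))
      (fun T => continuousOn_const.mul (continuousOn_dot (continuousOn_evV _ _) (hone _)))]
    refine volSum_congr fun T x _ => ?_
    simp only [Tuple.addConst]
    rw [evV_add_const, dotProduct_add, dotProduct_smul, smul_eq_mul]
  have hch := hσ.chat_mem.faceContinuous
  have h2 : bdrySum M (fun T F x => (outerNormal T.1 F.1 ⨯₃ σ.chat F x) ⬝ᵥ
      evV ((τ.addConst t).r T) x) =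
      bdrySum M (fun T F x => (outerNormal T.1 F.1 ⨯₃ σ.chat F x) ⬝ᵥ evV (τ.r T) x) +
      t * bdrySum M (fun T F x => (outerNormal T.1 F.1 ⨯₃ σ.chat F x) ⬝ᵥ fun _ => 1) := by
    rw [← bdrySum_const_mul, ← bdrySum_add
      (f := fun T F x => (outerNormal T.1 F.1 ⨯₃ σ.chat F x) ⬝ᵥ evV (τ.r T) x)
      (g := fun T F x => t * ((outerNormal T.1 F.1 ⨯₃ σ.chat F x) ⬝ᵥ fun _ => 1))
      (fun T F _ => continuousOn_dot (continuousOn_cross _ (hch F)) (continuousOn_evV _ _))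
      (fun T F _ => continuousOn_const.mul
        (continuousOn_dot (continuousOn_cross _ (hch F)) (hone _)))]
    refine bdrySum_congr fun T F _ x _ => ?_
    simp only [Tuple.addConst]
    rw [evV_add_const, dotProduct_add, dotProduct_smul, smul_eq_mul]
  have h3 : formB M σ.u σ.uhat σ.chat (τ.addConst t).r = formB M σ.u σ.uhat σ.chat τ.r -
      t * bdrySum M (fun T F x => (outerNormal T.1 F.1 ⨯₃ σ.chat F x) ⬝ᵥ fun _ => 1) := by
    have e : ∀ T, curl ((τ.addConst t).r T) = curl (τ.r T) := fun T => curl_add_const _ _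
    simp only [formB, h2, e]
    ring
  rw [Bh, Bh, h1, h3]
  simp only [Tuple.addConst]
  ring

lemma volSum_one_pos {κ : ℝ} (hκ : 0 < κ) (hM : M.ShapeRegular κ) [Nonempty M.Cell] :
    0 < volSum M (fun _ _ => 1) := by
  refine Finset.sum_pos (fun T _ => ?_) Finset.univ_nonempty
  have h1 := (hM.isRegular T).volume_hull_ge hκ
  have h2 := TetMesh.cell_size_pos T
  have h3 := ballVol_pos
  simp only [cellInt, integral_const, MeasurableSet.univ, measureReal_restrict_apply,
    Set.univ_inter, smul_eq_mul, mul_one]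
  exact lt_of_lt_of_le (by positivity) h1

/-- Added multiples of the all-ones vector have squared length `3 t²`. Working with inequalities
avoids deducing that a field of norm zero vanishes. -/
lemma fieldSq_addConst (τ : Tuple M) (hτ : fieldSq M τ.r = 0) (t : ℝ) :
    fieldSq M (τ.addConst t).r ≤ 6 * t ^ 2 * volSum M (fun _ _ => 1) ∧
      3 * t ^ 2 * volSum M (fun _ _ => 1) ≤ 2 * fieldSq M (τ.addConst t).r := by
  have hsq : ∀ (v : VPoly) (S : Set E3), ContinuousOn (fun x => sqLen (evV v x)) S :=
    fun v S => continuousOn_sqLen (continuousOn_evV _ _)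
  have hev : ∀ T x, evV ((τ.addConst t).r T) x = evV (τ.r T) x + t • fun _ => 1 := fun T x =>
    evV_add_const _ _ _
  have h1 : fieldSq M (τ.addConst t).r ≤
      2 * fieldSq M τ.r + 6 * t ^ 2 * volSum M (fun _ _ => 1) := by
    rw [fieldSq, fieldSq, ← volSum_const_mul, ← volSum_const_mul, ← volSum_add
      (f := fun T x => 2 * sqLen (evV (τ.r T) x)) (fun T => continuousOn_const.mul (hsq _ _))
      (fun T => continuousOn_const)]
    refine volSum_mono (fun T => hsq _ _)
      (fun T => (continuousOn_const.mul (hsq _ _)).add continuousOn_const) fun T x _ => ?_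
    rw [hev]
    simp only [sqLen, dot_eq, Pi.add_apply, Pi.smul_apply, smul_eq_mul]
    nlinarith [sq_nonneg (evV (τ.r T) x 0 - t), sq_nonneg (evV (τ.r T) x 1 - t),
      sq_nonneg (evV (τ.r T) x 2 - t)]
  have h2 : 3 * t ^ 2 * volSum M (fun _ _ => 1) ≤
      2 * fieldSq M τ.r + 2 * fieldSq M (τ.addConst t).r := by
    rw [fieldSq, fieldSq, ← volSum_const_mul, ← volSum_const_mul, ← volSum_const_mul, ← volSum_add
      (f := fun T x => 2 * sqLen (evV (τ.r T) x))
      (g := fun T x => 2 * sqLen (evV ((τ.addConst t).r T) x))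
      (fun T => continuousOn_const.mul (hsq _ _)) (fun T => continuousOn_const.mul (hsq _ _))]
    refine volSum_mono (fun T => continuousOn_const) (fun T =>
      (continuousOn_const.mul (hsq _ _)).add (continuousOn_const.mul (hsq _ _))) fun T x _ => ?_
    rw [hev]
    simp only [sqLen, dot_eq, Pi.add_apply, Pi.smul_apply, smul_eq_mul]
    nlinarith [sq_nonneg (2 * evV (τ.r T) x 0 + t), sq_nonneg (2 * evV (τ.r T) x 1 + t),
      sq_nonneg (2 * evV (τ.r T) x 2 + t)]
  rw [hτ] at h1 h2
  constructor <;> linarith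

lemma sigmaSq_addConst {α β : ℕ} {τ : Tuple M} (hτ : sigmaSq M α β τ = 0) (t : ℝ) :
    sigmaSq M α β (τ.addConst t) ≤ 6 * t ^ 2 * volSum M (fun _ _ => 1) ∧
      3 * t ^ 2 * volSum M (fun _ _ => 1) ≤ 2 * sigmaSq M α β (τ.addConst t) := by
  have h1 := fieldSq_nonneg τ.r
  have h2 := normUSq_nonneg τ.u τ.uhat τ.chat
  have h3 := normPSq_nonneg α β τ.p τ.phat
  change fieldSq M τ.r + normUSq M τ.u τ.uhat τ.chat + normPSq M α β τ.p τ.phat = 0 at hτ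
  have h4 : sigmaSq M α β (τ.addConst t) = fieldSq M (τ.addConst t).r +
    normUSq M τ.u τ.uhat τ.chat + normPSq M α β τ.p τ.phat := rfl
  obtain ⟨h5, h6⟩ := fieldSq_addConst τ (by linarith) t
  rw [h4]
  constructor <;> linarith

lemma sigmaSq_zero (α β : ℕ) : sigmaSq M α β 0 = 0 := by
  have h1 : fieldSq M (0 : Tuple M).r = 0 := fieldSq_zero
  have h2 : normUSq M (0 : Tuple M).u (0 : Tuple M).uhat (0 : Tuple M).chat = 0 := by
    change curlCurlSq M 0 + tangJumpSq M 0 0 + curlJumpSq M 0 0 + divSq M 0 = 0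
    rw [curlCurlSq_zero, tangJumpSq_zero, curlJumpSq_zero, divSq_zero]
    norm_num
  have h3 : normPSq M α β (0 : Tuple M).p (0 : Tuple M).phat = 0 := by
    change normPSq M α β 0 0 = 0
    simp [normPSq, grad_zero, evV_zero, sqLen_zero, ev_zero, volSum_zero, bdrySum_zero]
  change fieldSq M (0 : Tuple M).r + normUSq M (0 : Tuple M).u (0 : Tuple M).uhat
    (0 : Tuple M).chat + normPSq M α β (0 : Tuple M).p (0 : Tuple M).phat = 0
  rw [h1, h2, h3]
  norm_num

/-- A bound for the quotients carries over to the tuples of norm zero. -/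
lemma Bh_le_of_ratio_le {κ : ℝ} (hκ : 0 < κ) (hM : M.ShapeRegular κ) [Nonempty M.Cell] {k : ℕ}
    {α β : ℕ} {σ : Tuple M} (hσ : σ ∈ sigmaZero M k) {m : ℝ} (hm : 0 ≤ m)
    (h : ∀ τ ∈ sigmaZero M k, τ ≠ 0 → Bh M σ τ / normSigma M α β τ ≤ m) {τ : Tuple M}
    (hτ : τ ∈ sigmaZero M k) : Bh M σ τ ≤ m * normSigma M α β τ := by
  have hV := volSum_one_pos hκ hM
  set V := volSum M (fun _ _ => 1) with hVdef
  have hpos : ∀ τ ∈ sigmaZero M k, 0 < sigmaSq M α β τ → Bh M σ τ ≤ m * normSigma M α β τ := by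
    intro τ hτ h0
    have h1 := h τ hτ (by rintro rfl; exact h0.ne' (sigmaSq_zero α β))
    rwa [div_le_iff₀ (by rw [normSigma_eq]; exact Real.sqrt_pos.2 h0)] at h1
  rcases (sigmaSq_nonneg α β τ).eq_or_lt with h0 | h0
  · rw [normSigma_eq, ← h0, Real.sqrt_zero, mul_zero]
    obtain ⟨b, hb⟩ := exists_Bh_addConst hσ
    -- The quotient of a tuple of norm zero is zero by convention and says nothing. A constant field
    -- of size `t` makes the norm positive and of order `t`, and the form changes linearly, so the
    -- bound can be used for all small `t`.
    have key : ∀ t : ℝ, 0 < t → Bh M σ τ ≤ t * (m * Real.sqrt (6 * V) - b) := by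
      intro t ht
      obtain ⟨h1, h2⟩ := sigmaSq_addConst h0.symm t
      rw [← hVdef] at h1 h2
      have h3 : 0 < 3 * t ^ 2 * V := by positivity
      have h4 := hpos _ (addConst_mem hτ t) (by linarith)
      have h5 : normSigma M α β (τ.addConst t) ≤ t * Real.sqrt (6 * V) := by
        rw [normSigma_eq]
        refine (Real.sqrt_le_sqrt h1).trans_eq ?_
        rw [show 6 * t ^ 2 * V = t ^ 2 * (6 * V) by ring, Real.sqrt_mul (sq_nonneg t),
          Real.sqrt_sq ht.le]
      have h6 := mul_le_mul_of_nonneg_left h5 hm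
      rw [hb] at h4
      linarith
    by_contra! hcon
    set c := m * Real.sqrt (6 * V) - b with hc
    -- If the form were positive, this `t` would bound it by less than itself.
    have h1 := key (Bh M σ τ / (2 * (|c| + 1))) (by positivity)
    rw [div_mul_eq_mul_div, le_div_iff₀ (by positivity)] at h1
    have h2 : c ≤ |c| := le_abs_self c
    nlinarith [abs_nonneg c, mul_le_mul_of_nonneg_left h2 hcon.le]
  · exact hpos τ hτ h0

lemma zero_mem_sigmaZero (M : TetMesh Ω) (k : ℕ) : (0 : Tuple M) ∈ sigmaZero M k :=
  memSigmaZero_field (s := 0) fun _ _ => Submodule.zero_mem _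

lemma Bh_zero_right (σ : Tuple M) : Bh M σ 0 = 0 := by
  have h1 := Bh_field σ 0
  rw [formA_zero, formB_zero_right, add_zero] at h1
  exact h1

/-- Some quotient is nonnegative. -/
lemma exists_ratio_nonneg {κ : ℝ} (hκ : 0 < κ) (hM : M.ShapeRegular κ) [Nonempty M.Cell] {k : ℕ}
    (α β : ℕ) {σ : Tuple M} (hσ : σ ∈ sigmaZero M k) :
    ∃ τ ∈ sigmaZero M k, τ ≠ 0 ∧ 0 ≤ Bh M σ τ / normSigma M α β τ := by
  have hV := volSum_one_pos hκ hM
  obtain ⟨b, hb⟩ := exists_Bh_addConst hσ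
  have key : ∀ t : ℝ, t ≠ 0 → 0 ≤ t * b →
      ∃ τ ∈ sigmaZero M k, τ ≠ 0 ∧ 0 ≤ Bh M σ τ / normSigma M α β τ := by
    intro t ht htb
    refine ⟨_, addConst_mem (zero_mem_sigmaZero M k) t, fun h0 => ?_, div_nonneg ?_ ?_⟩
    · have h1 := (sigmaSq_addConst (M := M) (sigmaSq_zero α β) t).2
      rw [h0, sigmaSq_zero] at h1
      have : 0 < 3 * t ^ 2 * volSum M (fun _ _ => 1) := by positivity
      linarith
    · rw [hb, Bh_zero_right, zero_add]
      exact htb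
    · rw [normSigma_eq]
      exact Real.sqrt_nonneg _
  -- The sign of the constant field is chosen to agree with the sign of `b`.
  rcases le_total 0 b with h | h
  · exact key 1 one_ne_zero (by linarith)
  · exact key (-1) (by norm_num) (by linarith)

/-- The inf-sup condition. -/
theorem exists_infSup (hne : Ω.Nonempty) (hbdd : Bornology.IsBounded Ω) {k : ℕ} (hk : 1 ≤ k)
    {κ : ℝ} (hκ : 0 < κ) : ∃ C : ℝ, 0 < C ∧ ∀ M : TetMesh Ω, M.ShapeRegular κ →
      ∀ α β : ℕ, α ≤ 1 → β ≤ 1 → ∀ σ ∈ sigmaZero M k, ((C * normSigma M α β σ : ℝ) : EReal) ≤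
        ⨆ τ ∈ {τ | τ ∈ sigmaZero M k ∧ τ ≠ 0},
          ((Bh M σ τ / normSigma M α β τ : ℝ) : EReal) := by
  obtain ⟨C, hC, hstab⟩ := exists_stability hk hκ
  obtain ⟨L, hL, hsize⟩ := exists_size_le hbdd
  have hL0 : 0 < L := zero_lt_one.trans_le hL
  -- One factor `L` compares the norms of the test tuples and one that of `σ`. The factor two makes
  -- the contradiction strict.
  refine ⟨1 / (2 * C * L ^ 2), by positivity, fun M hM α β hα hβ σ hσ => ?_⟩
  have := nonempty_cell M hne
  set m := 1 / (2 * C * L ^ 2) * normSigma M α β σ with hm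
  have hN0 : 0 ≤ normSigma M α β σ := Real.sqrt_nonneg _
  have hm0 : 0 ≤ m := by positivity
  by_contra! hcon
  have hlt : ∀ τ ∈ sigmaZero M k, τ ≠ 0 → Bh M σ τ / normSigma M α β τ < m := fun τ hτ hτ0 =>
    EReal.coe_lt_coe_iff.1 <| lt_of_le_of_lt (le_iSup₂ (f := fun τ
      (_ : τ ∈ {τ | τ ∈ sigmaZero M k ∧ τ ≠ 0}) =>
        ((Bh M σ τ / normSigma M α β τ : ℝ) : EReal)) τ ⟨hτ, hτ0⟩) hcon
  have h1 := hstab M hM σ hσ (m * L) (by positivity) fun τ hτ => by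
    refine (Bh_le_of_ratio_le hκ hM hσ hm0 (fun τ hτ h0 => (hlt τ hτ h0).le) hτ).trans ?_
    exact (mul_le_mul_of_nonneg_left (normSigma_le hL (hsize M) hα hβ hτ) hm0).trans_eq
      (mul_assoc _ _ _).symm
  have h2 := (normSigma_le hL (hsize M) hα hβ hσ).trans (mul_le_mul_of_nonneg_left h1 hL0.le)
  have h3 : L * (C * (m * L)) = normSigma M α β σ / 2 := by
    rw [hm]
    field_simp
  -- By now the norm of `σ` is at most half of itself, hence zero, and all quotients would be
  -- negative. A single nonnegative quotient refutes this.
  obtain ⟨τ, hτ, hτ0, hnonneg⟩ := exists_ratio_nonneg hκ hM α β hσ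
  have h4 := hlt τ hτ hτ0
  have h5 : normSigma M α β σ = 0 := by linarith
  rw [hm, h5, mul_zero] at h4
  linarith

end Sup

end QuadCurlHDG

end

/-! ### The two inf-sup conditions. -/

theorem theorem3p1 (Ω : Set QuadCurlHDG.E3) (hconn : IsConnected Ω)
    (hbdd : Bornology.IsBounded Ω) (hreg : interior (closure Ω) = Ω)
    (hbdry : IsConnected (frontier Ω)) (k : ℕ) (hk : 1 ≤ k) (κ : ℝ) (hκ : 0 < κ) :
    ∃ C : ℝ, 0 < C ∧
      ∀ M : QuadCurlHDG.TetMesh Ω, M.ShapeRegular κ →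
        ∀ α β : ℕ, α ≤ 1 → β ≤ 1 →
          (∀ σ ∈ QuadCurlHDG.sigmaZero M k,
            ((C * QuadCurlHDG.normSigma M α β σ : ℝ) : EReal) ≤
              ⨆ τ ∈ {τ | τ ∈ QuadCurlHDG.sigmaZero M k ∧ τ ≠ 0},
                ((QuadCurlHDG.Bh M σ τ / QuadCurlHDG.normSigma M α β τ : ℝ) : EReal)) ∧
          (∀ τ ∈ QuadCurlHDG.sigmaZero M k,
            ((C * QuadCurlHDG.normSigma M α β τ : ℝ) : EReal) ≤
              ⨆ σ ∈ {σ | σ ∈ QuadCurlHDG.sigmaZero M k ∧ σ ≠ 0},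
                ((QuadCurlHDG.Bh M σ τ / QuadCurlHDG.normSigma M α β σ : ℝ) : EReal)) := by
  obtain ⟨C, hC, h⟩ := QuadCurlHDG.exists_infSup hconn.nonempty hbdd hk hκ
  refine ⟨C, hC, fun M hM α β hα hβ => ⟨h M hM α β hα hβ, fun τ hτ => ?_⟩⟩
  -- By symmetry the second condition is the first with the roles exchanged.
  simp only [QuadCurlHDG.Bh_comm _ τ]
  exact h M hM α β hα hβ τ hτ
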